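/- Let $n\ge 1$ and $p\ge 2$ be integers and let $q$ be an integer coprime to $p$. Write $[X,Y]$ for the set of homotopy classes of continuous maps $X\to Y$. Let $L(p,q)$ be the lens space, the orbit space of $S^3\subset\mathbb{C}^2$ under the action of $\mathbb{Z}/p\mathbb{Z}$ generated by $(z_0,z_1)\mapsto(e^{2\pi i/p}z_0,e^{2\pi iq/p}z_1)$. Let $P^2(p)=S^1\cup_{z\mapsto z^p}D^2$ be the mod-$p$ Moore space (the mapping cone of the degree $p$ map of $S^1$), let $i\colon P^2(p)\to L(p,q)$, $[z]\mapsto[(z,\sqrt{1-|z|^2})]$, be the inclusion of the $2$-skeleton, and let $\pi\colon P^2(p)\to P^2(p)/S^1\cong S^2$ be the pinch map to the top cell. For $X\in\{S^2,P^2(p),L(p,q)\}$ the set $[X,BU(n)]$ is given the following addition. If $n=1$, it is that of $[X,K(\mathbb{Z},2)]$, that is, the tensor product of line bundles. If $n\ge2$, it is the one induced from $[X,BU(\infty)]$ by stabilization: $\gamma=\alpha+\beta$ if and only if $\alpha\oplus\beta$ and $\gamma\oplus\varepsilon^n$ become equal in $[X,BU(2n+k)]$ after adding the trivial bundle $\varepsilon^k$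 for some $k\ge0$. Then these are abelian group structures, $[S^2,BU(n)]\cong\mathbb{Z}$, and: (a) there is a group isomorphism $[P^2(p),BU(n)]\cong\mathbb{Z}/p\mathbb{Z}$; (b) under these isomorphisms, $\pi^*\colon[S^2,BU(n)]\to[P^2(p),BU(n)]$ is the reduction $\mathbb{Z}\to\mathbb{Z}/p\mathbb{Z}$ mod $p$; (c) $i^*\colon[L(p,q),BU(n)]\to[P^2(p),BU(n)]$ is a group isomorphism; (d) there is a map $\overline{\pi}\colon L(p,q)\to S^2$ with $\overline{\pi}\circ i=\pi$, and for every map $\overline{\pi}\colon L(p,q)\to S^2$ with $\overline{\pi}\circ i\simeq\pi$ the map $\overline{\pi}^*\colon[S^2,BU(n)]\to[L(p,q),BU(n)]$ is, under the isomorphisms of (a) and (c), reduction mod $p$. -/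

import Mathlib

/-! ### Homotopy classes of maps -/

/-- Homotopy of continuous maps, as a setoid. -/
def homotopySetoid (X Y : Type) [TopologicalSpace X] [TopologicalSpace Y] : Setoid C(X, Y) :=
  ⟨ContinuousMap.Homotopic, ContinuousMap.Homotopic.equivalence⟩

/-- The set `[X, Y]` of homotopy classes of continuous maps `X → Y`. -/
def HtpyClasses (X Y : Type) [TopologicalSpace X] [TopologicalSpace Y] : Type :=
  Quotient (homotopySetoid X Y)

/-- The homotopy class of a map. -/
def htpyClass {X Y : Type} [TopologicalSpace X] [TopologicalSpace Y] (f : C(X, Y)) :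
    HtpyClasses X Y :=
  Quotient.mk (homotopySetoid X Y) f

/-- The induced map `g^* : [Y, Z] → [X, Z]`, `[f] ↦ [f ∘ g]`. -/
def htpyPullback {X Y : Type} (Z : Type) [TopologicalSpace X] [TopologicalSpace Y]
    [TopologicalSpace Z] (g : C(X, Y)) : HtpyClasses Y Z → HtpyClasses X Z :=
  Quotient.map (fun f => f.comp g)
    (fun _ _ h => ContinuousMap.Homotopic.comp h (ContinuousMap.Homotopic.refl g))

/-! ### The classifying space `BU(n)` and sums of bundles -/

/-- The complex Hilbert space `ℓ²(ℕ)`. -/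
abbrev EllTwo : Type := lp (fun _ : ℕ => ℂ) 2

/-- `BU(n)` as the Grassmannian of `n`-dimensional complex subspaces of `ℓ²(ℕ)`, a subspace being
identified with the orthogonal projection onto it, with the norm topology. It is the quotient of
the (contractible) space of isometries `ℂⁿ → ℓ²(ℕ)` by the free action of `U(n)`. -/
abbrev BU (n : ℕ) : Type :=
  {P : EllTwo →L[ℂ] EllTwo // IsStarProjection P ∧ Module.rank ℂ P.range = n}

/-- The standard Hilbert basis of `ℓ²(ℕ)`. -/
noncomputable def ellBasis : HilbertBasis ℕ ℂ EllTwo :=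
  HilbertBasis.ofRepr (LinearIsometryEquiv.refl ℂ EllTwo)

/-- The isometry of `ℓ²(ℕ)` taking the basis vector `e i` to `e (φ i)`, for injective `φ`. -/
noncomputable def ellEmb (φ : ℕ → ℕ) (hφ : Function.Injective φ) : EllTwo →ₗᵢ[ℂ] EllTwo :=
  (ellBasis.orthonormal.comp φ hφ).orthogonalFamily.linearIsometry

theorem ellEmb_inner_zero (φ ψ : ℕ → ℕ) (hφ : Function.Injective φ) (hψ : Function.Injective ψ)
    (h : ∀ i j, φ i ≠ ψ j) (u w : EllTwo) : inner ℂ (ellEmb φ hφ u) (ellEmb ψ hψ w) = 0 := by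
  have key : ∀ (j : ℕ) (c : ℂ), inner ℂ (ellEmb φ hφ u) (c • ellBasis (ψ j)) = 0 := by
    intro j c
    have h1 := (ellBasis.orthonormal.comp φ hφ).orthogonalFamily.hasSum_linearIsometry u
    have h2 := h1.mapL (innerSL ℂ (c • ellBasis (ψ j)))
    have h3 : inner ℂ (c • ellBasis (ψ j)) (ellEmb φ hφ u) = 0 := by
      refine h2.unique ?_
      convert hasSum_zero with i
      simp [ellBasis.orthonormal.2 (h i j).symm]
    exact inner_eq_zero_symm.1 h3
  have h1 := (ellBasis.orthonormal.comp ψ hψ).orthogonalFamily.hasSum_linearIsometry w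
  have h2 := h1.mapL (innerSL ℂ (ellEmb φ hφ u))
  refine h2.unique ?_
  convert hasSum_zero with i
  simpa using key i (w i)

/-- The isometry `e i ↦ e (2 i)`. -/
noncomputable def evenEmb : EllTwo →ₗᵢ[ℂ] EllTwo :=
  ellEmb (fun i => 2 * i) (fun a b h => by simpa using h)

/-- The isometry `e i ↦ e (2 i + 1)`. -/
noncomputable def oddEmb : EllTwo →ₗᵢ[ℂ] EllTwo :=
  ellEmb (fun i => 2 * i + 1) (fun a b h => by simpa using h)

/-- The block sum `P ⊕ Q` of two operators, along `ℓ²(ℕ) ⊕ ℓ²(ℕ) ≅ ℓ²(ℕ)`, `(u, w) ↦ even u + odd w`. -/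
noncomputable def blockSum (P Q : EllTwo →L[ℂ] EllTwo) : EllTwo →L[ℂ] EllTwo :=
  evenEmb.toContinuousLinearMap ∘L P ∘L evenEmb.toContinuousLinearMap.adjoint +
    oddEmb.toContinuousLinearMap ∘L Q ∘L oddEmb.toContinuousLinearMap.adjoint

theorem evenEmb_adjoint_even (u : EllTwo) :
    evenEmb.toContinuousLinearMap.adjoint (evenEmb u) = u := by
  refine ext_inner_left ℂ fun v => ?_
  rw [ContinuousLinearMap.adjoint_inner_right]
  exact evenEmb.inner_map_map v u

theorem oddEmb_adjoint_odd (u : EllTwo) :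
    oddEmb.toContinuousLinearMap.adjoint (oddEmb u) = u := by
  refine ext_inner_left ℂ fun v => ?_
  rw [ContinuousLinearMap.adjoint_inner_right]
  exact oddEmb.inner_map_map v u

theorem evenEmb_adjoint_odd (u : EllTwo) :
    evenEmb.toContinuousLinearMap.adjoint (oddEmb u) = 0 := by
  refine ext_inner_left ℂ fun v => ?_
  rw [ContinuousLinearMap.adjoint_inner_right, inner_zero_right]
  exact ellEmb_inner_zero (fun i => 2 * i) (fun i => 2 * i + 1) (fun a b h => by simpa using h)
    (fun a b h => by simpa using h) (fun i j => by omega) v u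

theorem oddEmb_adjoint_even (u : EllTwo) :
    oddEmb.toContinuousLinearMap.adjoint (evenEmb u) = 0 := by
  refine ext_inner_left ℂ fun v => ?_
  rw [ContinuousLinearMap.adjoint_inner_right, inner_zero_right]
  exact ellEmb_inner_zero (fun i => 2 * i + 1) (fun i => 2 * i) (fun a b h => by simpa using h)
    (fun a b h => by simpa using h) (fun i j => by omega) v u

theorem blockSum_apply (P Q : EllTwo →L[ℂ] EllTwo) (u : EllTwo) :
    blockSum P Q u = evenEmb (P (evenEmb.toContinuousLinearMap.adjoint u)) +
      oddEmb (Q (oddEmb.toContinuousLinearMap.adjoint u)) := rfl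

theorem blockSum_isStarProjection {P Q : EllTwo →L[ℂ] EllTwo} (hP : IsStarProjection P)
    (hQ : IsStarProjection Q) : IsStarProjection (blockSum P Q) := by
  constructor
  · ext1 u
    have h1 : ∀ v, P (P v) = P v := fun v => congrArg (fun T => T v) hP.isIdempotentElem.eq
    have h2 : ∀ v, Q (Q v) = Q v := fun v => congrArg (fun T => T v) hQ.isIdempotentElem.eq
    rw [mul_apply_eq_comp, blockSum_apply P Q (blockSum P Q u), blockSum_apply P Q u]
    simp only [map_add, evenEmb_adjoint_even, evenEmb_adjoint_odd, oddEmb_adjoint_even,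
      oddEmb_adjoint_odd, h1, h2, add_zero, zero_add]
  · have hp : P.adjoint = P := hP.isSelfAdjoint.star_eq
    have hq : Q.adjoint = Q := hQ.isSelfAdjoint.star_eq
    rw [IsSelfAdjoint, ContinuousLinearMap.star_eq_adjoint, blockSum]
    simp only [map_add, ContinuousLinearMap.adjoint_comp, ContinuousLinearMap.adjoint_adjoint, hp,
      hq, ContinuousLinearMap.comp_assoc]

theorem blockSum_rank {P Q : EllTwo →L[ℂ] EllTwo} :
    Module.rank ℂ (blockSum P Q).range =
      Module.rank ℂ P.range + Module.rank ℂ Q.range := by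
  let T : (P.range × Q.range) →ₗ[ℂ] EllTwo :=
    (evenEmb.toLinearMap ∘ₗ P.range.subtype).coprod
      (oddEmb.toLinearMap ∘ₗ Q.range.subtype)
  have hT : ∀ x, T x = evenEmb x.1 + oddEmb x.2 := fun x => rfl
  have hinj : Function.Injective T := by
    intro x y hxy
    rw [hT, hT] at hxy
    have h1 := congrArg evenEmb.toContinuousLinearMap.adjoint hxy
    have h2 := congrArg oddEmb.toContinuousLinearMap.adjoint hxy
    simp only [map_add, evenEmb_adjoint_even, evenEmb_adjoint_odd, oddEmb_adjoint_even,
      oddEmb_adjoint_odd, add_zero, zero_add] at h1 h2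
    exact Prod.ext (Subtype.ext h1) (Subtype.ext h2)
  have hr : LinearMap.range T = (blockSum P Q).range := by
    ext v
    constructor
    · rintro ⟨⟨⟨_, a, rfl⟩, ⟨_, b, rfl⟩⟩, rfl⟩
      refine ⟨evenEmb a + oddEmb b, ?_⟩
      change blockSum P Q _ = _
      rw [blockSum_apply, hT]
      simp only [map_add, evenEmb_adjoint_even, evenEmb_adjoint_odd, oddEmb_adjoint_even,
        oddEmb_adjoint_odd, add_zero, zero_add]
      rfl
    · rintro ⟨u, rfl⟩
      exact ⟨(⟨_, _, rfl⟩, ⟨_, _, rfl⟩), rfl⟩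
  rw [← hr, ← (LinearEquiv.ofInjective T hinj).rank_eq, rank_prod']

theorem continuous_blockSum :
    Continuous fun x : (EllTwo →L[ℂ] EllTwo) × (EllTwo →L[ℂ] EllTwo) => blockSum x.1 x.2 := by
  unfold blockSum
  fun_prop

/-- The Whitney sum map `BU(m) × BU(n) → BU(m + n)`. -/
noncomputable def whitneySum (m n : ℕ) : C(BU m × BU n, BU (m + n)) where
  toFun x := ⟨blockSum x.1.1 x.2.1, blockSum_isStarProjection x.1.2.1 x.2.2.1, by
    rw [blockSum_rank, x.1.2.2, x.2.2.2, Nat.cast_add]⟩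
  continuous_toFun := Continuous.subtype_mk (continuous_blockSum.comp
    ((continuous_subtype_val.comp continuous_fst).prodMk
      (continuous_subtype_val.comp continuous_snd))) _

/-- The Whitney sum of homotopy classes, `[X, BU(m)] × [X, BU(n)] → [X, BU(m + n)]`. -/
noncomputable def classSum {X : Type} [TopologicalSpace X] {m n : ℕ} :
    HtpyClasses X (BU m) → HtpyClasses X (BU n) → HtpyClasses X (BU (m + n)) :=
  Quotient.map₂ (fun f g => (whitneySum m n).comp (f.prodMk g))
    (fun _ _ h _ _ h' =>
      ContinuousMap.Homotopic.comp (ContinuousMap.Homotopic.refl _) (h.prodMk h'))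

instance ellSpan_finite (n : ℕ) :
    FiniteDimensional ℂ (Submodule.span ℂ (Set.range fun i : Fin n => ellBasis i)) :=
  FiniteDimensional.span_of_finite ℂ (Set.finite_range _)

/-- The point of `BU(n)` given by the span of the first `n` basis vectors. -/
noncomputable def basePointBU (n : ℕ) : BU n :=
  ⟨(Submodule.span ℂ (Set.range fun i : Fin n => ellBasis i)).starProjection,
    isStarProjection_starProjection, by
      have h : LinearIndependent ℂ fun i : Fin n => ellBasis i :=
        (ellBasis.orthonormal.comp (fun i : Fin n => (i : ℕ)) Fin.val_injective).linearIndependent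
      rw [Submodule.range_starProjection, rank_span h, Cardinal.mk_range_eq _ h.injective,
        Cardinal.mk_fin]⟩

/-- The class in `[X, BU(n)]` of the trivial bundle of rank `n`. -/
noncomputable def trivialClass (X : Type) [TopologicalSpace X] (n : ℕ) : HtpyClasses X (BU n) :=
  htpyClass (ContinuousMap.const X (basePointBU n))

/-- `γ` is the sum of `α` and `β` after stabilization: the classes `α ⊕ β` and `γ ⊕ n` in
`[X, BU(2n)]` become equal in some `[X, BU(2n + k)]`. For compact `X` this says that their images
in `[X, BU(∞)] = colim [X, BU(N)]` satisfy `α + β = γ` for the Whitney sum. -/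
def IsStableSum {X : Type} [TopologicalSpace X] {n : ℕ} (α β γ : HtpyClasses X (BU n)) : Prop :=
  ∃ k : ℕ, classSum (classSum α β) (trivialClass X k) =
    classSum (classSum γ (trivialClass X n)) (trivialClass X k)

/-- The line bundle classified by `h` is isomorphic to the tensor product of those classified by
`f` and `g`: there is a continuous family of bilinear maps which over every `x` restricts to a
nonzero pairing `f x ⊗ g x → h x` of lines. -/
def IsTensorMap {X : Type} [TopologicalSpace X] (f g h : C(X, BU 1)) : Prop :=
  ∃ B : C(X, EllTwo →L[ℂ] EllTwo →L[ℂ] EllTwo), ∀ x : X,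
    ∀ u ∈ (f x).1.range, ∀ w ∈ (g x).1.range,
      B x u w ∈ (h x).1.range ∧ (u ≠ 0 → w ≠ 0 → B x u w ≠ 0)

/-- `γ = α ⊗ β` in `[X, BU(1)]`; this is the addition of `H²(X; ℤ)` on `[X, K(ℤ, 2)]`. -/
def IsTensorProd {X : Type} [TopologicalSpace X] (α β γ : HtpyClasses X (BU 1)) : Prop :=
  ∃ f g h : C(X, BU 1), htpyClass f = α ∧ htpyClass g = β ∧ htpyClass h = γ ∧ IsTensorMap f g h

/-- The relation `γ = α + β` of the group `[X, BU(n)]`: for `n = 1` the group structure is that of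
`[X, K(ℤ, 2)]`, for `n ≠ 1` it is the one coming from `[X, BU(∞)]`. -/
def IsClassAdd {X : Type} [TopologicalSpace X] :
    (n : ℕ) → HtpyClasses X (BU n) → HtpyClasses X (BU n) → HtpyClasses X (BU n) → Prop
  | 1 => IsTensorProd
  | _ => IsStableSum

/-- The given group structure on `[X, BU(n)]` is the one described above (at most one is). -/
def IsBundleGroup (X : Type) [TopologicalSpace X] (n : ℕ)
    [AddCommGroup (HtpyClasses X (BU n))] : Prop :=
  ∀ α β γ : HtpyClasses X (BU n), γ = α + β ↔ IsClassAdd n α β γ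

/-! ### The sphere, the Moore space, the lens space and the maps between them -/

/-- The sphere `S²`. -/
abbrev SphereTwo : Type := Metric.sphere (0 : EuclideanSpace ℝ (Fin 3)) 1

/-- The sphere `S³ ⊆ ℂ²`. -/
abbrev SphereThree : Type := Metric.sphere (0 : EuclideanSpace ℂ (Fin 2)) 1

/-- The closed unit disc `D² ⊆ ℂ`, the cone on `S¹`. -/
abbrev DiscTwo : Type := Metric.closedBall (0 : ℂ) 1

/-- Boundary points of the disc with the same image under `z ↦ z ^ p` are identified. -/
def mooreSetoid (p : ℕ) : Setoid DiscTwo where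
  r z w := z = w ∨ (‖z.1‖ = 1 ∧ ‖w.1‖ = 1 ∧ z.1 ^ p = w.1 ^ p)
  iseqv :=
    { refl := fun _ => Or.inl rfl
      symm := by
        rintro z w (h | ⟨h1, h2, h3⟩)
        · exact Or.inl h.symm
        · exact Or.inr ⟨h2, h1, h3.symm⟩
      trans := by
        rintro z w v (rfl | ⟨h1, h2, h3⟩) (rfl | ⟨h4, h5, h6⟩)
        · exact Or.inl rfl
        · exact Or.inr ⟨h4, h5, h6⟩
        · exact Or.inr ⟨h1, h2, h3⟩
        · exact Or.inr ⟨h1, h5, h3.trans h6⟩ }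

/-- The Moore space `P²(p) = S¹ ∪ D²`, the mapping cone of the degree `p` map `z ↦ z ^ p` of `S¹`. -/
abbrev MooreSpace (p : ℕ) : Type := Quotient (mooreSetoid p)

/-- The orbit relation on `S³` of the action of `ℤ/p` generated by
`(z₀, z₁) ↦ (e^{2πi/p} z₀, e^{2πiq/p} z₁)`. -/
def lensSetoid (p : ℕ) (q : ℤ) : Setoid SphereThree where
  r x y := ∃ k : ℤ, y.1 0 = Complex.exp (2 * Real.pi * Complex.I * k / p) * x.1 0 ∧
    y.1 1 = Complex.exp (2 * Real.pi * Complex.I * (q * k) / p) * x.1 1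
  iseqv :=
    { refl := fun _ => ⟨0, by simp, by simp⟩
      symm := by
        rintro x y ⟨k, h0, h1⟩
        refine ⟨-k, ?_, ?_⟩
        · rw [h0, ← mul_assoc, ← Complex.exp_add]
          simp only [Int.cast_neg, mul_neg, neg_div, neg_add_cancel, Complex.exp_zero, one_mul]
        · rw [h1, ← mul_assoc, ← Complex.exp_add]
          simp only [Int.cast_neg, mul_neg, neg_div, neg_add_cancel, Complex.exp_zero, one_mul]
      trans := by
        rintro x y z ⟨k, h0, h1⟩ ⟨l, h2, h3⟩
        refine ⟨l + k, ?_, ?_⟩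
        · rw [h2, h0, ← mul_assoc, ← Complex.exp_add]
          simp only [Int.cast_add, mul_add, add_div]
        · rw [h3, h1, ← mul_assoc, ← Complex.exp_add]
          simp only [Int.cast_add, mul_add, add_div] }

/-- The lens space `L(p, q) = S³ / (ℤ/p)`. -/
abbrev LensSpace (p : ℕ) (q : ℤ) : Type := Quotient (lensSetoid p q)

theorem DiscTwo.norm_le (z : DiscTwo) : ‖z.1‖ ≤ 1 :=
  mem_closedBall_zero_iff.1 z.2

theorem DiscTwo.sq_sqrt (z : DiscTwo) : Real.sqrt (1 - ‖z.1‖ ^ 2) ^ 2 = 1 - ‖z.1‖ ^ 2 :=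
  Real.sq_sqrt (by nlinarith [z.norm_le, norm_nonneg z.1])

/-- The disc `z ↦ (z, √(1 - |z|²))` in `S³`. -/
noncomputable def discToSphereThree : C(DiscTwo, SphereThree) where
  toFun z := ⟨!₂[z.1, (Real.sqrt (1 - ‖z.1‖ ^ 2) : ℂ)], by
    simp [EuclideanSpace.norm_eq, DiscTwo.sq_sqrt]⟩
  continuous_toFun := by
    refine Continuous.subtype_mk ?_ _
    refine (PiLp.continuous_toLp 2 _).comp (continuous_pi fun i => ?_)
    fin_cases i
    · exact continuous_subtype_val
    · exact Complex.continuous_ofReal.comp (by fun_prop)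

/-- The inclusion `i : P²(p) → L(p, q)` of the `2`-skeleton, `[z] ↦ [(z, √(1 - |z|²))]`. Its image
is the set of orbits of points with `z₁ = 0` or `z₁ ^ p > 0`; the complement is one open `3`-cell,
the image of `{z₁ ≠ 0, 0 < arg z₁ < 2π/p}`. -/
noncomputable def skeletonIncl (p : ℕ) (q : ℤ) (hp : 2 ≤ p) : C(MooreSpace p, LensSpace p q) where
  toFun := Quotient.map discToSphereThree (by
    rintro z w (rfl | ⟨hz, hw, h⟩)
    · exact (lensSetoid p q).refl _
    · have hz0 : z.1 ≠ 0 := fun h0 => by simp [h0] at hz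
      have : NeZero p := ⟨by omega⟩
      have hζ : (w.1 / z.1) ^ p = 1 := by
        rw [div_pow, ← h, div_self (pow_ne_zero _ hz0)]
      obtain ⟨k, -, hk⟩ := (Complex.isPrimitiveRoot_exp p (NeZero.ne p)).eq_pow_of_pow_eq_one hζ
      refine ⟨k, ?_, ?_⟩
      · change w.1 = _ * z.1
        rw [eq_comm, ← eq_div_iff hz0, ← hk, ← Complex.exp_nat_mul]
        congr 1
        push_cast
        ring
      · simp [discToSphereThree, hz, hw])
  continuous_toFun := Continuous.quotient_map' discToSphereThree.continuous _

/-- The map `D² → S²`, `z ↦ (2 √(1 - |z|²) z, 2|z|² - 1)`, which collapses the boundary circle to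
the north pole and is injective on the interior. -/
noncomputable def discToSphereTwo : C(DiscTwo, SphereTwo) where
  toFun z := ⟨!₂[2 * Real.sqrt (1 - ‖z.1‖ ^ 2) * z.1.re, 2 * Real.sqrt (1 - ‖z.1‖ ^ 2) * z.1.im,
      2 * ‖z.1‖ ^ 2 - 1], by
    have h1 := z.sq_sqrt
    have h2 : ‖z.1‖ ^ 2 = z.1.re ^ 2 + z.1.im ^ 2 := by
      rw [Complex.sq_norm, Complex.normSq_apply]; ring
    rw [mem_sphere_zero_iff_norm, EuclideanSpace.norm_eq, Real.sqrt_eq_one, Fin.sum_univ_three]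
    simp only [Real.norm_eq_abs, sq_abs]
    change (2 * Real.sqrt (1 - ‖z.1‖ ^ 2) * z.1.re) ^ 2 +
      (2 * Real.sqrt (1 - ‖z.1‖ ^ 2) * z.1.im) ^ 2 + (2 * ‖z.1‖ ^ 2 - 1) ^ 2 = 1
    rw [mul_pow, mul_pow, mul_pow, mul_pow, h1, h2]
    ring⟩
  continuous_toFun := by
    refine Continuous.subtype_mk ?_ _
    refine (PiLp.continuous_toLp 2 _).comp (continuous_pi fun i => ?_)
    have h1 : Continuous fun z : DiscTwo => z.1.re :=
      Complex.continuous_re.comp continuous_subtype_val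
    have h2 : Continuous fun z : DiscTwo => z.1.im :=
      Complex.continuous_im.comp continuous_subtype_val
    fin_cases i
    · change Continuous fun z : DiscTwo => 2 * Real.sqrt (1 - ‖z.1‖ ^ 2) * z.1.re
      fun_prop
    · change Continuous fun z : DiscTwo => 2 * Real.sqrt (1 - ‖z.1‖ ^ 2) * z.1.im
      fun_prop
    · change Continuous fun z : DiscTwo => 2 * ‖z.1‖ ^ 2 - 1
      fun_prop

/-- The pinch map `π : P²(p) → P²(p)/S¹ ≅ S²` onto the top cell. -/
noncomputable def pinchMap (p : ℕ) : C(MooreSpace p, SphereTwo) where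
  toFun := Quotient.lift discToSphereTwo (by
    rintro z w (rfl | ⟨hz, hw, -⟩)
    · rfl
    · simp [discToSphereTwo, hz, hw])
  continuous_toFun := Continuous.quotient_lift discToSphereTwo.continuous _

open ContinuousMap (Homotopic)
open scoped unitInterval Matrix

/-! ### Images of projections under operators -/

/-! The invariant behind everything is the first Chern class, read off as a winding number. A bundle
on `P²(p)` has a frame `F` over the disc and a frame `G` over the circle; comparing `F` with `G`
pulled back along `z ↦ z ^ p` on the boundary gives a clutching function, and `HasDeg` records the
degree of its determinant. Another frame on the disc does not change this degree, while another
frame on the circle or an isomorphic bundle changes it by a multiple of `p` (`HasDeg.congr`). So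
`mooreDegree` lives in `ZMod p`; it is additive for Whitney sums and for tensor products of lines.

It is also complete. For line bundles of equal degree, an isomorphism over the circle can be twisted
by a power of `w` so that, in the frames on the disc, it is a function of degree zero; such a
function has a logarithm, which extends over the disc (`bundleIso_of_mooreDegree_eq_one`). In rank
at least two, general position gives a nowhere zero section over cells of dimension at most three
(`exists_section_extension`), so a trivial line splits off and induction reduces to rank one.

The lens space is `P²(p)` with one `3`-cell attached. Sections extend over it in rank at least two.
Isomorphisms of line bundles extend because a function without zeros on the boundary of a `3`-cell
has a logarithm (`exists_cyl_extension`). Hence bundles on `L(p, q)` are classified by their degree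
on the skeleton. Every degree occurs, since the pinch map extends to the lens space by a twisted
Hopf map (`exists_pinch_extension`) and bundles can be pulled back from `S²`. The sphere is the case
`p = 0`, where `ZMod 0` is `ℤ`.

Since degrees are injective and additive, both descriptions of the addition are the one transported
from `ZMod p` (`classDegree_eq_add_iff`), and (a) to (d) become comparisons of degrees. Homotopy is
handled through `BundleIso`, a continuous family of operators on `ℓ²`: over compact spaces the two
relations coincide (`BundleIso.homotopic`, `Homotopic.bundleIso`). -/

theorem IsStarProjection.apply_apply {P : EllTwo →L[ℂ] EllTwo} (hP : IsStarProjection P)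
    (u : EllTwo) : P (P u) = P u :=
  congrArg (fun T => T u) hP.isIdempotentElem.eq

theorem IsStarProjection.mem_range_iff {P : EllTwo →L[ℂ] EllTwo} (hP : IsStarProjection P)
    {u : EllTwo} : u ∈ P.range ↔ P u = u :=
  ⟨by rintro ⟨v, rfl⟩; exact hP.apply_apply v, fun h => ⟨u, h⟩⟩

theorem BU.mem_range_iff {n : ℕ} (P : BU n) {u : EllTwo} : u ∈ P.1.range ↔ P.1 u = u :=
  P.2.1.mem_range_iff

theorem BU.apply_mem {n : ℕ} (P : BU n) (u : EllTwo) : P.1 u ∈ P.1.range := ⟨u, rfl⟩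

theorem BU.ext_range {n : ℕ} {P Q : BU n} (h : P.1.range = Q.1.range) : P = Q :=
  Subtype.ext (ContinuousLinearMap.IsStarProjection.ext P.2.1 Q.2.1 h)

theorem BU.inner_apply {n : ℕ} (P : BU n) (u v : EllTwo) :
    inner ℂ (P.1 u) v = inner ℂ u (P.1 v) := by
  rw [← ContinuousLinearMap.adjoint_inner_left, ← ContinuousLinearMap.star_eq_adjoint,
    P.2.1.isSelfAdjoint.star_eq]

instance BU.finiteDimensional_range {n : ℕ} (P : BU n) : FiniteDimensional ℂ P.1.range :=
  Module.finite_of_rank_eq_nat P.2.2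

theorem BU.finrank_range {n : ℕ} (P : BU n) : Module.finrank ℂ P.1.range = n :=
  Module.finrank_eq_of_rank_eq P.2.2

/-- The operator whose inverse normalizes `A` on the range of `P`. -/
noncomputable def imgGram (A P : EllTwo →L[ℂ] EllTwo) : EllTwo →L[ℂ] EllTwo :=
  star (A * P) * (A * P) + (1 - P)

/-- The orthogonal projection onto the image under `A` of the range of `P`. -/
noncomputable def imgProj (A P : EllTwo →L[ℂ] EllTwo) : EllTwo →L[ℂ] EllTwo :=
  A * P * Ring.inverse (imgGram A P) * star (A * P)

section imgProj

variable {n : ℕ} {P : BU n} {A : EllTwo →L[ℂ] EllTwo}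

theorem imgGram_mul_proj (P : BU n) (A : EllTwo →L[ℂ] EllTwo) :
    imgGram A P.1 * P.1 = star (A * P.1) * (A * P.1) := by
  have h := P.2.1.isIdempotentElem.eq
  rw [imgGram, add_mul, sub_mul, one_mul, h, sub_self, add_zero, mul_assoc, mul_assoc A, h]

theorem proj_mul_imgGram (P : BU n) (A : EllTwo →L[ℂ] EllTwo) :
    P.1 * imgGram A P.1 = star (A * P.1) * (A * P.1) := by
  have h := P.2.1.isIdempotentElem.eq
  rw [imgGram, mul_add, mul_sub, mul_one, h, sub_self, add_zero, star_mul,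
    P.2.1.isSelfAdjoint.star_eq, ← mul_assoc, ← mul_assoc P.1 P.1, h]

theorem star_imgGram (P : BU n) (A : EllTwo →L[ℂ] EllTwo) :
    star (imgGram A P.1) = imgGram A P.1 := by
  simp [imgGram, P.2.1.isSelfAdjoint.star_eq, mul_assoc]

/-- The operator is block diagonal: the identity on the kernel of `P`, and on the range the
compression of `A* A`, which is injective there. The range is finite dimensional, so injectivity
suffices. -/
theorem isUnit_imgGram (hA : ∀ u ∈ P.1.range, A u = 0 → u = 0) : IsUnit (imgGram A P.1) := by
  have hinj : ∀ u ∈ P.1.range, imgGram A P.1 u = 0 → u = 0 := by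
    intro u hu h
    refine hA u hu ?_
    have hPu := P.mem_range_iff.1 hu
    have h1 : star (A * P.1) (A u) = 0 := by
      have := congrArg (fun T => T u) (imgGram_mul_proj P A)
      simpa [hPu, h] using this.symm
    rw [ContinuousLinearMap.star_eq_adjoint] at h1
    have h2 : inner ℂ (A u) (A u) = 0 := by
      have h3 := ContinuousLinearMap.adjoint_inner_right (A * P.1) u (A u)
      rw [h1, inner_zero_right] at h3
      simpa [hPu] using h3.symm
    exact inner_self_eq_zero.1 h2
  have hmap : ∀ u, imgGram A P.1 (P.1 u) ∈ P.1.range := by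
    intro u
    refine ⟨imgGram A P.1 u, ?_⟩
    exact congrArg (fun T => T u) ((proj_mul_imgGram P A).trans (imgGram_mul_proj P A).symm)
  have hcompl : ∀ u, imgGram A P.1 (u - P.1 u) = u - P.1 u := by
    intro u
    simp [imgGram, P.2.1.apply_apply]
  have hproj : ∀ u, P.1 (imgGram A P.1 u) = imgGram A P.1 (P.1 u) := fun u =>
    congrArg (fun T => T u) ((proj_mul_imgGram P A).trans (imgGram_mul_proj P A).symm)
  rw [ContinuousLinearMap.isUnit_iff_bijective]
  constructor
  · rw [injective_iff_map_eq_zero]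
    intro u hu
    have h1 : P.1 u = 0 := hinj _ (P.apply_mem u) (by rw [← hproj, hu, map_zero])
    have := hcompl u
    rwa [h1, sub_zero, hu, eq_comm] at this
  · let S : P.1.range →ₗ[ℂ] P.1.range := (imgGram A P.1).toLinearMap.restrict (by
      rintro _ ⟨u, rfl⟩; exact hmap u)
    have hS : Function.Surjective S := by
      rw [← LinearMap.injective_iff_surjective, injective_iff_map_eq_zero]
      intro u hu
      exact Subtype.ext (hinj u u.2 (congrArg Subtype.val hu))
    intro y
    obtain ⟨u, hu⟩ := hS ⟨P.1 y, P.apply_mem y⟩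
    refine ⟨u + (y - P.1 y), ?_⟩
    rw [map_add, hcompl, show imgGram A P.1 u = P.1 y from congrArg Subtype.val hu,
      add_sub_cancel]

/-- For `C = A * P` this is the identity `C (C* C)⁻¹ C* C = C`; the summand `1 - P` of the Gram
operator, added only to make it invertible, is killed by `P`. -/
theorem imgProj_mul (hA : ∀ u ∈ P.1.range, A u = 0 → u = 0) :
    imgProj A P.1 * (A * P.1) = A * P.1 := by
  have hu := isUnit_imgGram hA
  rw [imgProj, mul_assoc _ (star _), ← imgGram_mul_proj, ← mul_assoc, mul_assoc _ (Ring.inverse _),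
    Ring.inverse_mul_cancel _ hu, mul_one, mul_assoc, P.2.1.isIdempotentElem.eq]

theorem isStarProjection_imgProj (hA : ∀ u ∈ P.1.range, A u = 0 → u = 0) :
    IsStarProjection (imgProj A P.1) := by
  constructor
  · have h := imgProj_mul hA
    change imgProj A P.1 * imgProj A P.1 = imgProj A P.1
    nth_rw 2 [imgProj]
    rw [← mul_assoc, ← mul_assoc, h, imgProj]
  · have hu := star_imgGram P A
    have hi : star (Ring.inverse (imgGram A P.1)) = Ring.inverse (imgGram A P.1) := by
      rw [← Ring.inverse_star, hu]
    rw [IsSelfAdjoint, imgProj, star_mul, star_star, star_mul (A * P.1), hi, ← mul_assoc]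

theorem range_imgProj (hA : ∀ u ∈ P.1.range, A u = 0 → u = 0) :
    (imgProj A P.1).range = P.1.range.map A.toLinearMap := by
  ext v
  constructor
  · rintro ⟨u, rfl⟩
    exact ⟨P.1 _, P.apply_mem _, rfl⟩
  · rintro ⟨u, hu, rfl⟩
    refine ⟨A u, ?_⟩
    have := congrArg (fun T => T u) (imgProj_mul hA)
    simpa [P.mem_range_iff.1 hu] using this

theorem rank_imgProj (hA : ∀ u ∈ P.1.range, A u = 0 → u = 0) :
    Module.rank ℂ (imgProj A P.1).range = n := by
  have hinj : Function.Injective (A.toLinearMap.domRestrict P.1.range) := by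
    rw [injective_iff_map_eq_zero]
    exact fun u hu => Subtype.ext (hA u u.2 hu)
  rw [range_imgProj hA, ← LinearMap.range_domRestrict,
    ← (LinearEquiv.ofInjective _ hinj).rank_eq, P.2.2]

/-- The image under `A` of a point of `BU(n)`. -/
noncomputable def BU.img (P : BU n) (A : EllTwo →L[ℂ] EllTwo)
    (hA : ∀ u ∈ P.1.range, A u = 0 → u = 0) : BU n :=
  ⟨imgProj A P.1, isStarProjection_imgProj hA, rank_imgProj hA⟩

/-- Injectivity is needed at the single point `y`, because inversion in a Banach algebra is
continuous at every unit. -/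
theorem continuousAt_imgProj {Y : Type*} [TopologicalSpace Y] {P : Y → BU n}
    {A : Y → EllTwo →L[ℂ] EllTwo} {y : Y} (hP : ContinuousAt P y) (hA : ContinuousAt A y)
    (h : ∀ u ∈ (P y).1.range, A y u = 0 → u = 0) :
    ContinuousAt (fun y => imgProj (A y) (P y).1) y := by
  have hP' : ContinuousAt (fun y => (P y).1) y := continuous_subtype_val.continuousAt.comp hP
  have hC : ContinuousAt (fun y => A y * (P y).1) y := hA.mul hP'
  have hCs : ContinuousAt (fun y => star (A y * (P y).1)) y := hC.star
  have hG : ContinuousAt (fun y => imgGram (A y) (P y).1) y :=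
    (hCs.mul hC).add (continuousAt_const.sub hP')
  obtain ⟨x, hx⟩ := isUnit_imgGram h
  have hi : ContinuousAt (fun y => Ring.inverse (imgGram (A y) (P y).1)) y := by
    refine ContinuousAt.comp (g := Ring.inverse) (f := fun y => imgGram (A y) (P y).1) ?_ hG
    rw [← hx]
    exact NormedRing.inverse_continuousAt x
  exact (hC.mul hi).mul hCs

/-- A map to the Grassmannian is continuous if it is locally the image of a continuous one under a
continuous family of operators. -/
theorem BU.continuousAt_of_range_eq_map {Y : Type*} [TopologicalSpace Y] {Q : Y → BU n}
    {P : Y → BU n} {A : Y → EllTwo →L[ℂ] EllTwo} {y₀ : Y} (hP : ContinuousAt P y₀)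
    (hA : ContinuousAt A y₀)
    (h : ∀ᶠ y in nhds y₀, (∀ u ∈ (P y).1.range, A y u = 0 → u = 0) ∧
      (Q y).1.range = (P y).1.range.map (A y).toLinearMap) : ContinuousAt Q y₀ := by
  refine Topology.IsInducing.subtypeVal.continuousAt_iff.2 ?_
  refine (continuousAt_imgProj hP hA h.self_of_nhds.1).congr ?_
  filter_upwards [h] with y hy
  exact ContinuousLinearMap.IsStarProjection.ext (isStarProjection_imgProj hy.1) (Q y).2.1
    ((range_imgProj hy.1).trans hy.2.symm)

end imgProj

/-! ### Bundle isomorphisms and homotopies -/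

/-- The bundles classified by `f` and `g` are isomorphic, by a continuous family of operators. -/
def BundleIso {X : Type*} [TopologicalSpace X] {n : ℕ} (f g : C(X, BU n)) : Prop :=
  ∃ T : C(X, EllTwo →L[ℂ] EllTwo), ∀ x, ∀ u ∈ (f x).1.range,
    T x u ∈ (g x).1.range ∧ (T x u = 0 → u = 0)

section BundleIso

variable {X Y : Type*} [TopologicalSpace X] [TopologicalSpace Y] {n : ℕ}

theorem BundleIso.trans {f g h : C(X, BU n)} : BundleIso f g → BundleIso g h → BundleIso f h := by
  rintro ⟨T, hT⟩ ⟨S, hS⟩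
  refine ⟨S * T, fun x u hu => ⟨(hS x _ (hT x u hu).1).1, fun h => ?_⟩⟩
  exact (hT x u hu).2 ((hS x _ (hT x u hu).1).2 h)

theorem BundleIso.comp {f g : C(X, BU n)} (h : BundleIso f g) (q : C(Y, X)) :
    BundleIso (f.comp q) (g.comp q) := by
  obtain ⟨T, hT⟩ := h
  exact ⟨T.comp q, fun y => hT (q y)⟩

theorem BU.map_range_eq {P Q : BU n} {T : EllTwo →L[ℂ] EllTwo}
    (h : ∀ u ∈ P.1.range, T u ∈ Q.1.range ∧ (T u = 0 → u = 0)) :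
    P.1.range.map T.toLinearMap = Q.1.range := by
  refine Submodule.eq_of_le_of_finrank_eq ?_ ?_
  · rintro _ ⟨u, hu, rfl⟩
    exact (h u hu).1
  · rw [Q.finrank_range, ← range_imgProj fun u hu => (h u hu).2]
    exact (P.img T fun u hu => (h u hu).2).finrank_range

/-- The subspaces `A (t, x) (f x)` keep dimension `n` and depend continuously on `(t, x)`, so they
form the homotopy. -/
theorem homotopic_of_range_eq_map {f g₀ g₁ : C(X, BU n)} (A : C(I × X, EllTwo →L[ℂ] EllTwo))
    (hA : ∀ t x, ∀ u ∈ (f x).1.range, A (t, x) u = 0 → u = 0)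
    (h₀ : ∀ x, (g₀ x).1.range = (f x).1.range.map (A (0, x)).toLinearMap)
    (h₁ : ∀ x, (g₁ x).1.range = (f x).1.range.map (A (1, x)).toLinearMap) :
    Homotopic g₀ g₁ := by
  refine ⟨⟨⟨fun y => (f y.2).img (A y) (hA y.1 y.2), ?_⟩, fun x => ?_, fun x => ?_⟩⟩
  · refine continuous_iff_continuousAt.2 fun y => ?_
    refine BU.continuousAt_of_range_eq_map (P := fun y => f y.2) (A := A) (by fun_prop)
      (by fun_prop) (Filter.Eventually.of_forall fun y => ⟨hA y.1 y.2, ?_⟩)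
    exact range_imgProj (hA y.1 y.2)
  · exact BU.ext_range ((range_imgProj (hA 0 x)).trans (h₀ x).symm)
  · exact BU.ext_range ((range_imgProj (hA 1 x)).trans (h₁ x).symm)

/-- The image of a bundle under a fixed injective operator. -/
noncomputable def bundleImg (f : C(X, BU n)) (A : EllTwo →L[ℂ] EllTwo)
    (hA : ∀ u, A u = 0 → u = 0) : C(X, BU n) where
  toFun x := (f x).img A fun u _ => hA u
  continuous_toFun := continuous_iff_continuousAt.2 fun _ =>
    BU.continuousAt_of_range_eq_map (P := f) (A := fun _ => A) (by fun_prop) (by fun_prop)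
      (Filter.Eventually.of_forall fun _ => ⟨fun u _ => hA u, range_imgProj fun u _ => hA u⟩)

theorem range_bundleImg (f : C(X, BU n)) (A : EllTwo →L[ℂ] EllTwo)
    (hA : ∀ u, A u = 0 → u = 0) (x : X) :
    (bundleImg f A hA x).1.range = (f x).1.range.map A.toLinearMap :=
  range_imgProj fun u _ => hA u

/-- The segment from `1` to `V` stays injective: since `V` preserves norms, `(1 - t) u + t V u = 0`
with `u ≠ 0` forces `t = 1/2`, and then `V u = -u`. -/
theorem homotopic_bundleImg (f : C(X, BU n)) (V : EllTwo →ₗᵢ[ℂ] EllTwo)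
    (hV : ∀ u, V u = -u → u = 0) :
    Homotopic f (bundleImg f V.toContinuousLinearMap fun u h =>
      norm_eq_zero.1 ((V.norm_map u).symm.trans (norm_eq_zero.2 h))) := by
  let A : C(I × X, EllTwo →L[ℂ] EllTwo) :=
    ⟨fun y => (1 - (y.1 : ℝ) : ℂ) • (1 : EllTwo →L[ℂ] EllTwo) +
      ((y.1 : ℝ) : ℂ) • V.toContinuousLinearMap, by fun_prop⟩
  have hA : ∀ t x u, A (t, x) u = (1 - (t : ℝ) : ℂ) • u + ((t : ℝ) : ℂ) • V u :=
    fun _ _ _ => rfl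
  refine homotopic_of_range_eq_map (f := f) A ?_ ?_ ?_
  · intro t x u _ h
    rw [hA] at h
    have h1 : ((t : ℝ) : ℂ) • V u = -((1 - (t : ℝ) : ℂ) • u) := by
      rw [eq_neg_iff_add_eq_zero, add_comm, h]
    by_contra hu
    have h2 := congrArg norm h1
    have h0 : (0 : ℝ) ≤ 1 - t := sub_nonneg.2 t.2.2
    rw [norm_neg, norm_smul, norm_smul, V.norm_map, ← Complex.ofReal_one, ← Complex.ofReal_sub,
      Complex.norm_of_nonneg t.2.1, Complex.norm_of_nonneg h0] at h2
    have h3 : (t : ℝ) = 1 - t := mul_right_cancel₀ (norm_ne_zero_iff.2 hu) h2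
    have h4 : (t : ℝ) = 1 / 2 := by linarith
    rw [h4] at h1
    refine hu (hV u ?_)
    have h5 : ((1 / 2 : ℝ) : ℂ) ≠ 0 := by norm_num
    rw [show (1 - ((1 / 2 : ℝ) : ℂ)) = ((1 / 2 : ℝ) : ℂ) by push_cast; ring, ← smul_neg] at h1
    exact smul_right_injective _ h5 h1
  · intro x
    have : A (0, x) = 1 := by ext1 u; simp [hA]
    rw [this]
    exact (Submodule.map_id _).symm
  · intro x
    have : A (1, x) = V.toContinuousLinearMap := by ext1 u; simp [hA]
    rw [this]
    exact range_bundleImg _ _ _ _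

/-! ### Coordinates of the shift isometries; `-1` is not an eigenvalue. -/

theorem ellEmb_basis (φ : ℕ → ℕ) (hφ : Function.Injective φ) (i : ℕ) :
    ellEmb φ hφ (ellBasis i) = ellBasis (φ i) := by
  have h : (ellBasis i : EllTwo) = lp.single 2 i (1 : ℂ) :=
    (ellBasis.repr_symm_single i).symm
  rw [h, ellEmb, OrthogonalFamily.linearIsometry_apply_single]
  simp

theorem ellBasis_repr (u : EllTwo) (i : ℕ) : inner ℂ (ellBasis i) u = u i := by
  rw [← HilbertBasis.repr_apply_apply]; rfl

theorem inner_ellBasis_ellEmb (φ : ℕ → ℕ) (hφ : Function.Injective φ) (u : EllTwo) (i : ℕ) :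
    ellEmb φ hφ u (φ i) = u i := by
  rw [← ellBasis_repr, ← ellEmb_basis φ hφ, LinearIsometry.inner_map_map, ellBasis_repr]

theorem ellEmb_apply_of_notMem (φ : ℕ → ℕ) (hφ : Function.Injective φ) (u : EllTwo) (j : ℕ)
    (hj : ∀ i, φ i ≠ j) : ellEmb φ hφ u j = 0 := by
  have h1 := (ellBasis.orthonormal.comp φ hφ).orthogonalFamily.hasSum_linearIsometry u
  have h2 := h1.mapL (innerSL ℂ (ellBasis j))
  rw [← ellBasis_repr]
  refine h2.unique ?_
  convert hasSum_zero with i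
  simp [ellBasis.orthonormal.2 (hj i).symm]

/-- Strong induction on the coordinate: odd coordinates of the image vanish, coordinate `2 j` of the
image is `u j`, and coordinate `0` is fixed, hence equal to its own negative. -/
theorem evenEmb_ne_neg (u : EllTwo) (h : evenEmb u = -u) : u = 0 := by
  ext i
  induction i using Nat.strong_induction_on with
  | _ i ih =>
    have h1 : evenEmb u i = -u i := congrArg (fun v : EllTwo => v i) h
    obtain ⟨j, rfl | rfl⟩ := Nat.even_or_odd' i
    · have h2 : evenEmb u (2 * j) = u j := inner_ellBasis_ellEmb (fun i => 2 * i) _ u j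
      rw [h2] at h1
      rcases Nat.eq_zero_or_pos j with rfl | hj
      · exact self_eq_neg.1 h1
      · rw [ih j (by omega)] at h1
        simpa using h1.symm
    · have h2 : evenEmb u (2 * j + 1) = 0 :=
        ellEmb_apply_of_notMem (fun i => 2 * i) _ u _ fun i => by omega
      rw [h2] at h1
      simpa using h1.symm

theorem oddEmb_ne_neg (u : EllTwo) (h : oddEmb u = -u) : u = 0 := by
  ext i
  induction i using Nat.strong_induction_on with
  | _ i ih =>
    have h1 : oddEmb u i = -u i := congrArg (fun v : EllTwo => v i) h
    obtain ⟨j, rfl | rfl⟩ := Nat.even_or_odd' i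
    · have h2 : oddEmb u (2 * j) = 0 :=
        ellEmb_apply_of_notMem (fun i => 2 * i + 1) _ u _ fun i => by omega
      rw [h2] at h1
      simpa using h1.symm
    · have h2 : oddEmb u (2 * j + 1) = u j := inner_ellBasis_ellEmb (fun i => 2 * i + 1) _ u j
      rw [h2, ih j (by omega)] at h1
      simpa using h1.symm

/-- Once `f` sits in the even and `g` in the odd coordinates, the two are orthogonal, so the segment
from the even copy of `u` to the odd copy of `T x u` never meets zero. -/
theorem BundleIso.homotopic {f g : C(X, BU n)} (h : BundleIso f g) : Homotopic f g := by
  obtain ⟨T, hT⟩ := h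
  refine (homotopic_bundleImg f evenEmb evenEmb_ne_neg).trans
    (Homotopic.trans ?_ (homotopic_bundleImg g oddEmb oddEmb_ne_neg).symm)
  let A : C(I × X, EllTwo →L[ℂ] EllTwo) :=
    ⟨fun y => (1 - (y.1 : ℝ) : ℂ) • evenEmb.toContinuousLinearMap +
      ((y.1 : ℝ) : ℂ) • (oddEmb.toContinuousLinearMap ∘L T y.2), by fun_prop⟩
  have hA : ∀ t x u, A (t, x) u =
      (1 - (t : ℝ) : ℂ) • evenEmb u + ((t : ℝ) : ℂ) • oddEmb (T x u) := fun _ _ _ => rfl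
  refine homotopic_of_range_eq_map (f := f) A ?_ ?_ ?_
  · intro t x u hu h
    rw [hA] at h
    have h1 := congrArg evenEmb.toContinuousLinearMap.adjoint h
    have h2 := congrArg oddEmb.toContinuousLinearMap.adjoint h
    simp only [map_add, map_smul, evenEmb_adjoint_even, evenEmb_adjoint_odd, oddEmb_adjoint_even,
      oddEmb_adjoint_odd, smul_zero, add_zero, zero_add, map_zero] at h1 h2
    rcases smul_eq_zero.1 h2 with h3 | h3
    · simpa [h3] using h1
    · exact (hT x u hu).2 h3
  · intro x
    have : A (0, x) = evenEmb.toContinuousLinearMap := by ext1 u; simp [hA]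
    rw [this]
    exact range_bundleImg _ _ _ _
  · intro x
    have : A (1, x) = oddEmb.toContinuousLinearMap ∘L T x := by ext1 u; simp [hA]
    rw [this, range_bundleImg, ← BU.map_range_eq (hT x)]
    exact (Submodule.map_comp _ _ _).symm

/-- The projection onto `g x` is itself the isomorphism: a vector of `f x` that it kills is fixed by
the difference of the projections, whose norm is less than one. -/
theorem bundleIso_of_norm_sub_lt {f g : C(X, BU n)} (h : ∀ x, ‖(f x).1 - (g x).1‖ < 1) :
    BundleIso f g := by
  refine ⟨⟨fun x => (g x).1, by fun_prop⟩, fun x u hu => ⟨(g x).apply_mem u, fun h0 => ?_⟩⟩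
  by_contra hu0
  have h1 : ((f x).1 - (g x).1) u = u := by
    change (f x).1 u - (g x).1 u = u
    rw [show (g x).1 u = 0 from h0, (f x).mem_range_iff.1 hu, sub_zero]
  have h2 := ((f x).1 - (g x).1).le_opNorm u
  rw [h1] at h2
  nlinarith [h x, norm_pos_iff.2 hu0]

/-- Compactness of `X` makes the homotopy a path that is continuous in the sup norm, so nearby times
give isomorphic bundles; connectedness of the interval chains these isomorphisms. -/
theorem Homotopic.bundleIso [CompactSpace X] {f g : C(X, BU n)} (h : Homotopic f g) :
    BundleIso f g := by
  obtain ⟨F⟩ := h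
  let Φ : C(I, C(X, EllTwo →L[ℂ] EllTwo)) :=
    ContinuousMap.curry ⟨fun y => (F y).1, by fun_prop⟩
  have key : ∀ s t : I, BundleIso (F.curry s) (F.curry t) := by
    refine PreconnectedSpace.induction₂' (fun s t => BundleIso (F.curry s) (F.curry t)) ?_
      ⟨fun _ _ _ => BundleIso.trans⟩
    intro s
    have h1 : ∀ᶠ t in nhds s, dist (Φ t) (Φ s) < 1 :=
      Metric.tendsto_nhds.1 (Φ.continuous.tendsto s) 1 one_pos
    filter_upwards [h1] with t ht
    have h2 : ∀ x, ‖(F (t, x)).1 - (F (s, x)).1‖ < 1 := fun x => by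
      rw [← dist_eq_norm]
      exact (ContinuousMap.dist_apply_le_dist (f := Φ t) (g := Φ s) x).trans_lt ht
    exact ⟨bundleIso_of_norm_sub_lt fun x => by rw [norm_sub_rev]; exact h2 x,
      bundleIso_of_norm_sub_lt h2⟩
  have h0 : F.curry 0 = f := by ext1 x; exact F.apply_zero x
  have h1 : F.curry 1 = g := by ext1 x; exact F.apply_one x
  simpa only [h0, h1] using key 0 1

end BundleIso

/-! ### Frames -/

/-- `F` is a basis of the subspace `P`. -/
def IsFrame {n : ℕ} (P : BU n) (F : Fin n → EllTwo) : Prop :=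
  (∀ j, F j ∈ P.1.range) ∧ LinearIndependent ℂ F

theorem IsFrame.span_eq {n : ℕ} {P : BU n} {F : Fin n → EllTwo} (hF : IsFrame P F) :
    Submodule.span ℂ (Set.range F) = P.1.range := by
  refine Submodule.eq_of_le_of_finrank_eq ?_ ?_
  · rw [Submodule.span_le]
    rintro _ ⟨j, rfl⟩
    exact hF.1 j
  · rw [finrank_span_eq_card hF.2, P.finrank_range, Fintype.card_fin]

theorem exists_isFrame {n : ℕ} (P : BU n) : ∃ F : Fin n → EllTwo, IsFrame P F := by
  let b := Module.finBasisOfFinrankEq ℂ P.1.range P.finrank_range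
  refine ⟨fun j => b j, fun j => (b j).2, ?_⟩
  exact b.linearIndependent.map' P.1.range.subtype (Submodule.ker_subtype _)

theorem IsFrame.map {n : ℕ} {P Q : BU n} {F : Fin n → EllTwo} (hF : IsFrame P F)
    {T : EllTwo →L[ℂ] EllTwo} (h : ∀ u ∈ P.1.range, T u ∈ Q.1.range ∧ (T u = 0 → u = 0)) :
    IsFrame Q fun j => T (F j) := by
  refine ⟨fun j => (h _ (hF.1 j)).1, ?_⟩
  rw [Fintype.linearIndependent_iff] 
  intro c hc
  refine Fintype.linearIndependent_iff.1 hF.2 c ?_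
  refine (h _ (Submodule.sum_mem _ fun j _ => Submodule.smul_mem _ _ (hF.1 j))).2 ?_
  simpa using hc

/-- The contraction makes `f` homotopic to a constant map, and the resulting isomorphism carries a
basis of one fibre to all fibres. -/
theorem exists_frame {K : Type*} [TopologicalSpace K] [CompactSpace K] [ContractibleSpace K]
    {n : ℕ} (f : C(K, BU n)) : ∃ F : C(K, Fin n → EllTwo), ∀ x, IsFrame (f x) (F x) := by
  obtain ⟨y, hy⟩ := id_nullhomotopic K
  have h : Homotopic (ContinuousMap.const K (f y)) f :=
    (Homotopic.comp (Homotopic.refl f) hy).symm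
  obtain ⟨T, hT⟩ := Homotopic.bundleIso h
  obtain ⟨F, hF⟩ := exists_isFrame (f y)
  exact ⟨⟨fun x j => T x (F j), by fun_prop⟩, fun x => hF.map (hT x)⟩

/-- The matrix of inner products of two families of vectors. -/
noncomputable def crossGram {n : ℕ} (F G : Fin n → EllTwo) : Matrix (Fin n) (Fin n) ℂ :=
  Matrix.of fun i j => inner ℂ (F i) (G j)

theorem continuous_det_crossGram {Y : Type*} [TopologicalSpace Y] {n : ℕ}
    {F G : Y → Fin n → EllTwo} (hF : Continuous F) (hG : Continuous G) :
    Continuous fun y => (crossGram (F y) (G y)).det := by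
  refine Continuous.matrix_det (continuous_matrix fun i j => ?_)
  exact ((continuous_apply i).comp hF).inner ((continuous_apply j).comp hG)

/-- A kernel vector would give an element of `P` orthogonal to the frame `F` of `P`, hence to
itself. Cross Gram matrices stand in for transition matrices: they differ from these by an ordinary
Gram matrix, and are visibly continuous in both frames. -/
theorem IsFrame.det_crossGram_ne_zero {n : ℕ} {P : BU n} {F G : Fin n → EllTwo}
    (hF : IsFrame P F) (hG : IsFrame P G) : (crossGram F G).det ≠ 0 := by
  intro h
  obtain ⟨c, hc, h0⟩ := Matrix.exists_mulVec_eq_zero_iff.2 h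
  refine hc (funext (Fintype.linearIndependent_iff.1 hG.2 c ?_))
  set w := ∑ j, c j • G j with hw
  have hwP : w ∈ P.1.range :=
    Submodule.sum_mem _ fun j _ => Submodule.smul_mem _ _ (hG.1 j)
  have h1 : ∀ i, inner ℂ (F i) w = 0 := by
    intro i
    have := congrFun h0 i
    simpa [crossGram, Matrix.mulVec, dotProduct, hw, inner_sum, inner_smul_right, mul_comm]
      using this
  rw [← hF.span_eq] at hwP
  have h2 : ∀ v ∈ Submodule.span ℂ (Set.range F), inner ℂ v w = 0 := by
    intro v hv
    induction hv using Submodule.span_induction with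
    | mem x hx => obtain ⟨i, rfl⟩ := hx; exact h1 i
    | zero => simp
    | add x y _ _ hx hy => rw [inner_add_left, hx, hy, add_zero]
    | smul a x _ hx => rw [inner_smul_left, hx, mul_zero]
  exact inner_self_eq_zero.1 (h2 w hwP)

/-- Two frames of the same space differ by a matrix. -/
theorem IsFrame.exists_matrix {n : ℕ} {P : BU n} {F G : Fin n → EllTwo} (hF : IsFrame P F)
    (hG : IsFrame P G) : ∃ h : Matrix (Fin n) (Fin n) ℂ, ∀ j, F j = ∑ i, h i j • G i := by
  have h1 : ∀ j, ∃ c : Fin n → ℂ, ∑ i, c i • G i = F j := by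
    intro j
    have := hF.1 j
    rwa [← hG.span_eq, Submodule.mem_span_range_iff_exists_fun] at this
  choose c hc using h1
  exact ⟨Matrix.of fun i j => c j i, fun j => (hc j).symm⟩

theorem det_crossGram_of_eq {n : ℕ} {F G : Fin n → EllTwo} {h : Matrix (Fin n) (Fin n) ℂ}
    (hFG : ∀ j, F j = ∑ i, h i j • G i) (Y : Fin n → EllTwo) :
    (crossGram Y F).det = (crossGram Y G).det * h.det := by
  rw [← Matrix.det_mul]
  congr 1
  ext i j
  simp [crossGram, Matrix.mul_apply, hFG, mul_comm]

/-- If a frame is the sum of two orthogonal ones, its Gram determinants are products. -/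
theorem det_crossGram_append {m n : ℕ} (F F' : Fin m → EllTwo) (G G' : Fin n → EllTwo)
    (h : ∀ i j, inner ℂ (F i) (G' j) = 0) (h' : ∀ i j, inner ℂ (G i) (F' j) = 0) :
    (crossGram (Fin.append F G) (Fin.append F' G')).det =
      (crossGram F F').det * (crossGram G G').det := by
  rw [← Matrix.det_fromBlocks_zero₂₁ _ 0, ← Matrix.det_reindex_self finSumFinEquiv]
  congr 1
  ext i j
  refine Fin.addCases (fun i => ?_) (fun i => ?_) i <;>
    refine Fin.addCases (fun j => ?_) (fun j => ?_) j <;> simp [crossGram, h, h']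

/-! ### Whitney sums -/

/-- The Whitney sum of two maps to Grassmannians. -/
noncomputable def bundleSum {X : Type*} [TopologicalSpace X] {m n : ℕ} (f : C(X, BU m))
    (g : C(X, BU n)) : C(X, BU (m + n)) :=
  (whitneySum m n).comp (f.prodMk g)

theorem mem_range_whitneySum {m n : ℕ} (P : BU m) (Q : BU n) (w : EllTwo) :
    w ∈ (whitneySum m n (P, Q)).1.range ↔
      ∃ u ∈ P.1.range, ∃ v ∈ Q.1.range, w = evenEmb u + oddEmb v := by
  constructor
  · rintro ⟨a, rfl⟩
    exact ⟨_, P.apply_mem _, _, Q.apply_mem _, blockSum_apply P.1 Q.1 a⟩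
  · rintro ⟨u, hu, v, hv, rfl⟩
    refine ⟨evenEmb u + oddEmb v, ?_⟩
    change blockSum P.1 Q.1 _ = _
    rw [blockSum_apply]
    simp only [map_add, evenEmb_adjoint_even, evenEmb_adjoint_odd, oddEmb_adjoint_even,
      oddEmb_adjoint_odd, add_zero, zero_add, P.mem_range_iff.1 hu, Q.mem_range_iff.1 hv]

theorem inner_evenEmb_oddEmb (u v : EllTwo) : inner ℂ (evenEmb u) (oddEmb v) = 0 := by
  have := ContinuousLinearMap.adjoint_inner_right evenEmb.toContinuousLinearMap u (oddEmb v)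
  rw [evenEmb_adjoint_odd, inner_zero_right] at this
  exact this.symm

theorem inner_oddEmb_evenEmb (u v : EllTwo) : inner ℂ (oddEmb u) (evenEmb v) = 0 :=
  inner_eq_zero_symm.1 (inner_evenEmb_oddEmb v u)

theorem IsFrame.append {m n : ℕ} {P : BU m} {Q : BU n} {F : Fin m → EllTwo} {G : Fin n → EllTwo}
    (hF : IsFrame P F) (hG : IsFrame Q G) :
    IsFrame (whitneySum m n (P, Q))
      (Fin.append (fun i => evenEmb (F i)) fun i => oddEmb (G i)) := by
  constructor
  · intro j
    rw [mem_range_whitneySum]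
    refine Fin.addCases (fun i => ?_) (fun i => ?_) j
    · exact ⟨F i, hF.1 i, 0, zero_mem _, by simp⟩
    · exact ⟨0, zero_mem _, G i, hG.1 i, by simp⟩
  · rw [Fintype.linearIndependent_iff]
    intro c hc
    simp only [Fin.sum_univ_add, Fin.append_left, Fin.append_right] at hc
    have h1 := congrArg evenEmb.toContinuousLinearMap.adjoint hc
    have h2 := congrArg oddEmb.toContinuousLinearMap.adjoint hc
    simp only [map_add, map_sum, map_smul, evenEmb_adjoint_even, evenEmb_adjoint_odd,
      oddEmb_adjoint_even, oddEmb_adjoint_odd, smul_zero, Finset.sum_const_zero, add_zero,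
      zero_add, map_zero] at h1 h2
    intro j
    refine Fin.addCases (fun i => ?_) (fun i => ?_) j
    · exact Fintype.linearIndependent_iff.1 hF.2 _ h1 i
    · exact Fintype.linearIndependent_iff.1 hG.2 _ h2 i

theorem continuous_append {Y : Type*} [TopologicalSpace Y] {m n : ℕ} {F : Y → Fin m → EllTwo}
    {G : Y → Fin n → EllTwo} (hF : Continuous F) (hG : Continuous G) :
    Continuous fun y => Fin.append (F y) (G y) := by
  refine continuous_pi fun j => ?_
  refine Fin.addCases (fun i => ?_) (fun i => ?_) j
  · simpa [Function.comp_def] using (continuous_apply i).comp hF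
  · simpa [Function.comp_def] using (continuous_apply i).comp hG

/-- The Gram determinants of a sum of frames. -/
theorem det_crossGram_even_odd {m n : ℕ} (F F' : Fin m → EllTwo) (G G' : Fin n → EllTwo) :
    (crossGram (Fin.append (fun i => evenEmb (F i)) fun i => oddEmb (G i))
      (Fin.append (fun i => evenEmb (F' i)) fun i => oddEmb (G' i))).det =
      (crossGram F F').det * (crossGram G G').det := by
  rw [det_crossGram_append _ _ _ _ (fun _ _ => inner_evenEmb_oddEmb _ _)
    fun _ _ => inner_oddEmb_evenEmb _ _]
  simp only [crossGram, LinearIsometry.inner_map_map]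

theorem mem_range_basePointBU_one {u : EllTwo} (hu : u ∈ (basePointBU 1).1.range) :
    ∃ c : ℂ, u = c • ellBasis 0 := by
  rw [basePointBU, Submodule.range_starProjection] at hu
  have : (Set.range fun i : Fin 1 => ellBasis i) = {ellBasis 0} := by
    ext; simp
  rw [this, Submodule.mem_span_singleton] at hu
  obtain ⟨c, rfl⟩ := hu
  exact ⟨c, rfl⟩

/-- The constant map, classifying the trivial bundle. -/
noncomputable abbrev trivialBundle (X : Type*) [TopologicalSpace X] (n : ℕ) : C(X, BU n) :=
  ContinuousMap.const X (basePointBU n)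

/-! ### Splitting a trivial line off a bundle with a nowhere zero section. -/

theorem continuous_rankOne {Y : Type*} [TopologicalSpace Y] {a b : Y → EllTwo}
    (ha : Continuous a) (hb : Continuous b) :
    Continuous fun y => InnerProductSpace.rankOne ℂ (a y) (b y) := by
  have h : (fun y => InnerProductSpace.rankOne ℂ (a y) (b y)) = fun y =>
      ContinuousLinearMap.smulRightL ℂ EllTwo EllTwo (innerSL ℂ (b y)) (a y) := by
    funext y
    ext1 u
    simp
  rw [h]
  exact ((ContinuousLinearMap.smulRightL ℂ EllTwo EllTwo).continuous.comp
    ((innerSL ℂ).continuous.comp hb)).clm_apply ha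

theorem norm_ellBasis (i : ℕ) : ‖ellBasis i‖ = 1 := ellBasis.orthonormal.1 i

theorem BU.isStarProjection_sub_rankOne {n : ℕ} (P : BU n) {v : EllTwo} (hv : ‖v‖ = 1)
    (h : v ∈ P.1.range) : IsStarProjection (P.1 - InnerProductSpace.rankOne ℂ v v) := by
  refine (InnerProductSpace.isStarProjection_rankOne_self hv).sub_of_mul_eq_right P.2.1 ?_
  ext1 u
  simp [P.mem_range_iff.1 h]

theorem BU.range_sub_rankOne {n : ℕ} (P : BU n) {v : EllTwo} (hv : ‖v‖ = 1)
    (h : v ∈ P.1.range) :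
    (P.1 - InnerProductSpace.rankOne ℂ v v).range = (Submodule.span ℂ {v})ᗮ ⊓ P.1.range := by
  ext u
  rw [Submodule.mem_inf, Submodule.mem_orthogonal_singleton_iff_inner_right,
    (P.isStarProjection_sub_rankOne hv h).mem_range_iff, P.mem_range_iff]
  have hval : (P.1 - InnerProductSpace.rankOne ℂ v v) u = P.1 u - inner ℂ v u • v := rfl
  rw [hval]
  constructor
  · intro h1
    have h2 : inner ℂ v u = 0 := by
      have h3 := congrArg (inner ℂ v) h1
      rw [inner_sub_right, ← P.inner_apply, P.mem_range_iff.1 h, inner_smul_right,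
        inner_self_eq_norm_sq_to_K, hv] at h3
      simpa using h3.symm
    exact ⟨h2, by rwa [h2, zero_smul, sub_zero] at h1⟩
  · rintro ⟨h1, h2⟩
    rw [h1, h2, zero_smul, sub_zero]

/-- The complement in `P` of a line spanned by a unit vector. -/
noncomputable def BU.compl {n : ℕ} (P : BU (n + 1)) (v : EllTwo) (hv : ‖v‖ = 1)
    (h : v ∈ P.1.range) : BU n :=
  ⟨P.1 - InnerProductSpace.rankOne ℂ v v, P.isStarProjection_sub_rankOne hv h, by
    have hle : Submodule.span ℂ {v} ≤ P.1.range := by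
      rwa [Submodule.span_singleton_le_iff_mem]
    have hfin := Submodule.finrank_add_inf_finrank_orthogonal hle
    rw [P.finrank_range,
      finrank_span_singleton (norm_ne_zero_iff.1 (by rw [hv]; exact one_ne_zero)),
      add_comm, add_left_inj, ← P.range_sub_rankOne hv h] at hfin
    have : FiniteDimensional ℂ (P.1 - InnerProductSpace.rankOne ℂ v v).range := by
      rw [P.range_sub_rankOne hv h]
      exact Submodule.finiteDimensional_inf_right _ _
    rw [← Module.finrank_eq_rank, hfin]⟩

theorem BU.mem_range_compl {n : ℕ} (P : BU (n + 1)) (v : EllTwo) (hv : ‖v‖ = 1)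
    (h : v ∈ P.1.range) {u : EllTwo} (hu : u ∈ (P.compl v hv h).1.range) :
    u ∈ P.1.range ∧ inner ℂ v u = 0 := by
  rw [BU.compl, P.range_sub_rankOne hv h, Submodule.mem_inf,
    Submodule.mem_orthogonal_singleton_iff_inner_right] at hu
  exact hu.symm

theorem exists_bundleSum_of_section {X : Type*} [TopologicalSpace X] {n : ℕ} (f : C(X, BU (n + 1)))
    (s : C(X, EllTwo)) (hs : ∀ x, s x ∈ (f x).1.range) (hs0 : ∀ x, s x ≠ 0) :
    ∃ g : C(X, BU n), BundleIso (bundleSum g (trivialBundle X 1)) f := by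
  let v : C(X, EllTwo) := ⟨fun x => ((‖s x‖⁻¹ : ℝ) : ℂ) • s x,
    (Complex.continuous_ofReal.comp ((s.continuous.norm).inv₀ fun x =>
      norm_ne_zero_iff.2 (hs0 x))).smul s.continuous⟩
  have hv : ∀ x, v x ∈ (f x).1.range := fun x => Submodule.smul_mem _ _ (hs x)
  have hv1 : ∀ x, ‖v x‖ = 1 := fun x => by
    change ‖((‖s x‖⁻¹ : ℝ) : ℂ) • s x‖ = 1
    rw [norm_smul, Complex.norm_real, norm_inv, norm_norm,
      inv_mul_cancel₀ (norm_ne_zero_iff.2 (hs0 x))]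
  let g : C(X, BU n) := ⟨fun x => (f x).compl (v x) (hv1 x) (hv x), by
    refine Continuous.subtype_mk ?_ _
    exact (continuous_subtype_val.comp f.continuous).sub
      (continuous_rankOne v.continuous v.continuous)⟩
  -- This operator undoes the block sum: the even part goes back to the orthogonal complement of `v
  -- x`, and the basis vector of the trivial line goes to `v x`.
  refine ⟨g, ⟨fun x => evenEmb.toContinuousLinearMap.adjoint +
    (InnerProductSpace.rankOne ℂ (v x) (ellBasis 0)) ∘L oddEmb.toContinuousLinearMap.adjoint,
    continuous_const.add ((continuous_rankOne v.continuous continuous_const).clm_comp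
      continuous_const)⟩, fun x w hw => ?_⟩
  obtain ⟨a, ha, b, hb, rfl⟩ := (mem_range_whitneySum _ _ _).1 hw
  obtain ⟨c, rfl⟩ := mem_range_basePointBU_one hb
  obtain ⟨ha1, ha2⟩ := BU.mem_range_compl _ _ (hv1 x) (hv x) ha
  have hval : (evenEmb.toContinuousLinearMap.adjoint +
    (InnerProductSpace.rankOne ℂ (v x) (ellBasis 0)) ∘L oddEmb.toContinuousLinearMap.adjoint)
      (evenEmb a + oddEmb (c • ellBasis 0)) = a + c • v x := by
    simp [evenEmb_adjoint_even, evenEmb_adjoint_odd, oddEmb_adjoint_even, oddEmb_adjoint_odd,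
      norm_ellBasis]
  constructor
  · change (_ + _ : EllTwo →L[ℂ] EllTwo) _ ∈ _
    rw [hval]
    exact add_mem ha1 (Submodule.smul_mem _ _ (hv x))
  · intro h0
    replace h0 := hval.symm.trans h0
    have h1 := congrArg (inner ℂ (v x)) h0
    rw [inner_add_right, ha2, inner_smul_right, inner_self_eq_norm_sq_to_K, hv1] at h1
    have hc : c = 0 := by simpa using h1
    rw [hc, zero_smul, add_zero] at h0
    rw [h0, hc]
    simp

/-! ### Logarithms and degrees of maps from the circle -/

/-- The exponential is a covering of `ℂ ∖ {0}`; the contraction is a homotopy from a constant map to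
`b`, and it lifts starting from a constant logarithm. -/
theorem exists_log {K : Type*} [TopologicalSpace K] [ContractibleSpace K] (b : C(K, ℂ))
    (hb : ∀ x, b x ≠ 0) : ∃ l : C(K, ℂ), ∀ x, Complex.exp (l x) = b x := by
  have cov := Complex.isAddQuotientCoveringMap_exp.isCoveringMap
  obtain ⟨y, hy⟩ := id_nullhomotopic K
  let b' : C(K, {z : ℂ // z ≠ 0}) := ⟨fun x => ⟨b x, hb x⟩, by fun_prop⟩
  obtain ⟨H⟩ : Homotopic (ContinuousMap.const K (b' y)) b' :=
    (Homotopic.comp (Homotopic.refl b') hy).symm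
  have h0 : ∀ x, H.toContinuousMap (0, x) = (fun z : ℂ => (⟨Complex.exp z, z.exp_ne_zero⟩ :
      {z : ℂ // z ≠ 0})) (ContinuousMap.const K (Complex.log (b y)) x) := by
    intro x
    refine (H.apply_zero x).trans (Subtype.ext ?_)
    exact (Complex.exp_log (hb y)).symm
  refine ⟨(cov.liftHomotopy H.toContinuousMap _ h0).comp
    ((ContinuousMap.const K 1).prodMk (ContinuousMap.id K)), fun x => ?_⟩
  have h1 := congrFun (cov.liftHomotopy_lifts H.toContinuousMap _ h0) (1, x)
  have h2 := congrArg Subtype.val (h1.trans (H.apply_one x))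
  exact h2

theorem eq_of_exp_eq {Y : Type*} [TopologicalSpace Y] [PreconnectedSpace Y] {a b : Y → ℂ}
    (ha : Continuous a) (hb : Continuous b) (h : ∀ y, Complex.exp (a y) = Complex.exp (b y))
    {y₀ : Y} (h₀ : a y₀ = b y₀) : a = b :=
  Complex.isAddQuotientCoveringMap_exp.isCoveringMap.eq_of_comp_eq ha hb
    (funext fun y => Subtype.ext (h y)) y₀ h₀

instance : ContractibleSpace I := (convex_Icc (0 : ℝ) 1).contractibleSpace ⟨0, by simp⟩

instance : ContractibleSpace DiscTwo :=
  (convex_closedBall (0 : ℂ) 1).contractibleSpace ⟨0, by simp⟩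

/-- The parametrization `t ↦ e^{2πit}` of the circle. -/
noncomputable def circleParam : C(I, Circle) :=
  ⟨fun t => Circle.exp (2 * Real.pi * t), by fun_prop⟩

theorem coe_circleParam (t : I) :
    (circleParam t : ℂ) = Complex.exp (2 * Real.pi * Complex.I * (t : ℝ)) := by
  simp only [circleParam, ContinuousMap.coe_mk, Circle.coe_exp]
  congr 1
  push_cast
  ring

theorem circleParam_surjective : Function.Surjective circleParam := by
  intro z
  obtain ⟨x, rfl⟩ := Circle.exp_surjective z
  have hpi := Real.pi_pos
  refine ⟨⟨Int.fract (x / (2 * Real.pi)), Int.fract_nonneg _, (Int.fract_lt_one _).le⟩, ?_⟩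
  change Circle.exp _ = _
  rw [Circle.exp_eq_exp]
  refine ⟨-⌊x / (2 * Real.pi)⌋, ?_⟩
  have h := Int.floor_add_fract (x / (2 * Real.pi))
  have h1 : x = 2 * Real.pi * (x / (2 * Real.pi)) := by field_simp
  rw [← h] at h1
  push_cast
  linarith

theorem isQuotientMap_circleParam : Topology.IsQuotientMap circleParam :=
  circleParam.continuous.isClosedMap.isQuotientMap circleParam.continuous circleParam_surjective

theorem circleParam_eq {s t : I} (h : circleParam s = circleParam t) :
    s = t ∨ (s ∈ ({0, 1} : Set I) ∧ t ∈ ({0, 1} : Set I)) := by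
  obtain ⟨m, hm⟩ := Circle.exp_eq_exp.1 h
  have hpi := Real.pi_pos
  have h1 : (s : ℝ) = t + m := by
    have : 2 * Real.pi * (s : ℝ) = 2 * Real.pi * (t + m) := by rw [hm]; ring
    exact mul_left_cancel₀ (by positivity) this
  have hs := s.2
  have ht := t.2
  have h2 : m ≤ 1 := by
    have : (m : ℝ) ≤ 1 := by linarith [hs.2, ht.1]
    exact_mod_cast this
  have h3 : -1 ≤ m := by
    have : (-1 : ℝ) ≤ m := by linarith [hs.1, ht.2]
    exact_mod_cast this
  obtain rfl | rfl | rfl : m = -1 ∨ m = 0 ∨ m = 1 := by omega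
  · right
    push_cast at h1
    exact ⟨Or.inl (Subtype.ext (by push_cast; linarith [hs.1, ht.2])),
      Or.inr (Subtype.ext (by push_cast; linarith [hs.1, ht.2]))⟩
  · left
    exact Subtype.ext (by simpa using h1)
  · right
    push_cast at h1
    exact ⟨Or.inr (Subtype.ext (by push_cast; linarith [hs.2, ht.1])),
      Or.inl (Subtype.ext (by push_cast; linarith [hs.2, ht.1]))⟩

theorem circleParam_zero_one : circleParam 0 = circleParam 1 := by
  simp [circleParam]

/-- The function `φ` on the circle has no zeros and winds `k` times around the origin. -/
def IsDeg (φ : Circle → ℂ) (k : ℤ) : Prop :=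
  ∃ L : C(Circle, ℂ), ∀ z, φ z = (z : ℂ) ^ k * Complex.exp (L z)

/-- The winding number is the defect of a logarithm along the interval: its end values differ by
`2πik`. -/
theorem exists_isDeg {φ : Circle → ℂ} (hφ : Continuous φ) (h0 : ∀ z, φ z ≠ 0) :
    ∃ k, IsDeg φ k := by
  obtain ⟨l, hl⟩ := exists_log (⟨fun t => φ (circleParam t), by fun_prop⟩ : C(I, ℂ))
    fun t => h0 _
  have hl' : ∀ t, Complex.exp (l t) = φ (circleParam t) := hl
  obtain ⟨k, hk⟩ := Complex.exp_eq_exp_iff_exists_int.1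
    ((hl' 1).trans ((congrArg φ circleParam_zero_one.symm).trans (hl' 0).symm))
  -- Subtracting the linear function `2πikt` makes the end values agree, so the rest descends to the
  -- circle.
  let l' : C(I, ℂ) := ⟨fun t => l t - 2 * Real.pi * Complex.I * (t : ℝ) * k, by fun_prop⟩
  have h01 : l' 0 = l' 1 := by
    simp only [l', ContinuousMap.coe_mk, hk]
    simp
    ring
  have hfac : Function.FactorsThrough l' circleParam := by
    intro s t hst
    rcases circleParam_eq hst with rfl | ⟨rfl | rfl, rfl | rfl⟩
    exacts [rfl, rfl, h01, h01.symm, rfl]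
  refine ⟨k, isQuotientMap_circleParam.lift l' hfac, fun z => ?_⟩
  obtain ⟨t, rfl⟩ := circleParam_surjective z
  have h2 : isQuotientMap_circleParam.lift l' hfac (circleParam t) = l' t :=
    congrArg (fun g : C(I, ℂ) => g t) (isQuotientMap_circleParam.lift_comp l' hfac)
  rw [h2, ← hl', coe_circleParam, ← Complex.exp_int_mul, ← Complex.exp_add]
  congr 1
  simp only [l', ContinuousMap.coe_mk]
  ring

/-- Both representations give logarithms of `φ (γ t) / φ (γ 0)` along the interval, with `γ =
circleParam`. They vanish at `t = 0`, so they agree at `t = 1`, where their values are `2πik` and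
`2πik'`. -/
theorem IsDeg.unique {φ : Circle → ℂ} {k k' : ℤ} (h : IsDeg φ k) (h' : IsDeg φ k') : k = k' := by
  obtain ⟨L, hL⟩ := h
  obtain ⟨L', hL'⟩ := h'
  have hexp : ∀ {k : ℤ} {L : C(Circle, ℂ)}, (∀ z, φ z = (z : ℂ) ^ k * Complex.exp (L z)) →
      ∀ t : I, Complex.exp (2 * Real.pi * Complex.I * (t : ℝ) * k + (L (circleParam t) -
        L (circleParam 0))) = φ (circleParam t) / φ (circleParam 0) := by
    intro k L hL t
    rw [hL, hL (circleParam 0), coe_circleParam, coe_circleParam, ← Complex.exp_int_mul,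
      Complex.exp_add, Complex.exp_sub]
    simp
    ring_nf
  have key := eq_of_exp_eq (Y := I)
    (a := fun t => 2 * Real.pi * Complex.I * (t : ℝ) * k + (L (circleParam t) -
      L (circleParam 0)))
    (b := fun t => 2 * Real.pi * Complex.I * (t : ℝ) * k' + (L' (circleParam t) -
      L' (circleParam 0))) (by fun_prop) (by fun_prop)
    (fun t => (hexp hL t).trans (hexp hL' t).symm) (y₀ := 0) (by simp)
  have h1 := congrFun key 1
  rw [circleParam_zero_one] at h1
  simpa using h1

theorem IsDeg.mul {φ ψ : Circle → ℂ} {k l : ℤ} (h : IsDeg φ k) (h' : IsDeg ψ l) :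
    IsDeg (fun z => φ z * ψ z) (k + l) := by
  obtain ⟨L, hL⟩ := h
  obtain ⟨L', hL'⟩ := h'
  refine ⟨L + L', fun z => ?_⟩
  change φ z * ψ z = _
  rw [hL, hL', zpow_add₀ (Circle.coe_ne_zero z), ContinuousMap.add_apply, Complex.exp_add]
  ring

theorem isDeg_zpow (k : ℤ) : IsDeg (fun z => (z : ℂ) ^ k) k := ⟨0, fun z => by simp⟩

theorem isDeg_zero_of_exp {φ : Circle → ℂ} (L : C(Circle, ℂ)) (h : ∀ z, Complex.exp (L z) = φ z) :
    IsDeg φ 0 := ⟨L, fun z => by simp [h]⟩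

theorem isDeg_zero_of_pos {φ : Circle → ℝ} (hφ : Continuous φ) (h : ∀ z, 0 < φ z) :
    IsDeg (fun z => (φ z : ℂ)) 0 := by
  refine isDeg_zero_of_exp ⟨fun z => (Real.log (φ z) : ℂ),
    Complex.continuous_ofReal.comp (hφ.log fun z => (h z).ne')⟩ fun z => ?_
  change Complex.exp (Real.log (φ z) : ℂ) = _
  rw [← Complex.ofReal_exp, Real.exp_log (h z)]

/-- The boundary circle of the disc. -/
def circleToDisc : C(Circle, DiscTwo) :=
  ⟨fun z => ⟨z, by simp [Circle.norm_coe]⟩, by fun_prop⟩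

theorem isDeg_zero_of_disc {ψ : DiscTwo → ℂ} (hψ : Continuous ψ) (h : ∀ z, ψ z ≠ 0) :
    IsDeg (fun z => ψ (circleToDisc z)) 0 := by
  obtain ⟨l, hl⟩ := exists_log ⟨ψ, hψ⟩ h
  exact isDeg_zero_of_exp (l.comp circleToDisc) fun z => hl _

theorem IsDeg.comp_pow {φ : Circle → ℂ} {k : ℤ} (h : IsDeg φ k) (p : ℕ) :
    IsDeg (fun z => φ (z ^ p)) (p * k) := by
  obtain ⟨L, hL⟩ := h
  refine ⟨L.comp ⟨fun z => z ^ p, by fun_prop⟩, fun z => ?_⟩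
  change φ (z ^ p) = _
  rw [hL, zpow_mul, zpow_natCast, Circle.coe_pow]
  rfl

/-- The degree is determined by multiplicative relations. -/
theorem IsDeg.of_mul_eq {φ ψ χ : Circle → ℂ} {k l : ℤ} (hψ : IsDeg ψ k) (hχ : IsDeg χ l)
    (h : ∀ z, φ z * ψ z = χ z) : IsDeg φ (l - k) := by
  obtain ⟨L, hL⟩ := hψ
  obtain ⟨L', hL'⟩ := hχ
  refine ⟨L' - L, fun z => ?_⟩
  have hz := Circle.coe_ne_zero z
  have h1 := h z
  rw [hL, hL'] at h1
  rw [zpow_sub₀ hz, ContinuousMap.sub_apply, Complex.exp_sub, div_mul_div_comm, ← h1,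
    mul_div_cancel_right₀]
  exact mul_ne_zero (zpow_ne_zero _ hz) (Complex.exp_ne_zero _)

/-! ### Extension of nowhere vanishing functions and sections -/

section Extension

variable {E : Type*} [NormedAddCommGroup E] [NormedSpace ℝ E]
  {K : Type*} [TopologicalSpace K] [CompactSpace K]

/-- Stone–Weierstrass for the restrictions of `C¹` functions; linear functionals already separate
points. -/
theorem exists_contDiff_near_real (c : C(K, E)) (hc : Function.Injective c) (f : C(K, ℝ)) {ε : ℝ}
    (hε : 0 < ε) : ∃ g : E → ℝ, ContDiff ℝ 1 g ∧ ∀ x, |g (c x) - f x| < ε := by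
  let 𝒜 : Subalgebra ℝ C(K, ℝ) :=
    { carrier := {u | ∃ g : E → ℝ, ContDiff ℝ 1 g ∧ ∀ x, u x = g (c x)}
      mul_mem' := by
        rintro u v ⟨g, hg, hu⟩ ⟨h, hh, hv⟩
        exact ⟨fun e => g e * h e, hg.mul hh, fun x => by simp [hu, hv]⟩
      add_mem' := by
        rintro u v ⟨g, hg, hu⟩ ⟨h, hh, hv⟩
        exact ⟨fun e => g e + h e, hg.add hh, fun x => by simp [hu, hv]⟩
      algebraMap_mem' := fun r => ⟨fun _ => r, contDiff_const, fun x => rfl⟩ }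
  have hsep : 𝒜.SeparatesPoints := by
    intro x y hxy
    obtain ⟨φ, hφ⟩ := SeparatingDual.exists_separating_of_ne (R := ℝ) (hc.ne hxy)
    exact ⟨_, ⟨⟨fun x => φ (c x), by fun_prop⟩, ⟨φ, φ.contDiff, fun _ => rfl⟩, rfl⟩, hφ⟩
  obtain ⟨⟨g, g', hg', hg⟩, h⟩ :=
    ContinuousMap.exists_mem_subalgebra_near_continuous_of_separatesPoints 𝒜 hsep f f.continuous
      ε hε
  refine ⟨g', hg', fun x => ?_⟩
  rw [← hg]
  exact h x

theorem exists_contDiff_near {n : ℕ} (c : C(K, E)) (hc : Function.Injective c)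
    (f : C(K, Fin n → ℂ)) {ε : ℝ} (hε : 0 < ε) :
    ∃ g : E → Fin n → ℂ, ContDiff ℝ 1 g ∧ ∀ x, ‖g (c x) - f x‖ < ε := by
  have h1 := fun j => exists_contDiff_near_real c hc ⟨fun x => (f x j).re, by fun_prop⟩
    (half_pos hε)
  have h2 := fun j => exists_contDiff_near_real c hc ⟨fun x => (f x j).im, by fun_prop⟩
    (half_pos hε)
  choose g hg hg' using h1
  choose h hh hh' using h2
  refine ⟨fun e j => g j e + h j e * Complex.I, ?_, fun x => ?_⟩
  · refine contDiff_pi.2 fun j => ?_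
    exact (Complex.ofRealCLM.contDiff.comp (hg j)).add
      ((Complex.ofRealCLM.contDiff.comp (hh j)).mul contDiff_const)
  · rw [pi_norm_lt_iff hε]
    intro j
    refine (Complex.norm_le_abs_re_add_abs_im _).trans_lt ?_
    have h3 := hg' j x
    have h4 := hh' j x
    simp only [ContinuousMap.coe_mk] at h3 h4
    simp only [Pi.sub_apply, Complex.sub_re, Complex.add_re, Complex.ofReal_re, Complex.mul_re,
      Complex.I_re, Complex.ofReal_im, Complex.I_im, Complex.sub_im, Complex.add_im,
      Complex.mul_im, mul_zero, mul_one, sub_self, add_zero, zero_add]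
    linarith

variable [FiniteDimensional ℝ E]

/-- General position: on a compact space of dimension less than `2 n`, maps to `ℂⁿ` without zeros
extend without zeros from closed subsets. -/
theorem exists_extension_ne_zero [T2Space K] (c : C(K, E)) (hc : Function.Injective c)
    {A : Set K} (hA : IsClosed A) {n : ℕ} (hn : Module.finrank ℝ E < 2 * n)
    (a : C(A, Fin n → ℂ)) (ha : ∀ x, a x ≠ 0) :
    ∃ b : C(K, Fin n → ℂ), (∀ x, b x ≠ 0) ∧ ∀ x : A, b x = a x := by
  obtain ⟨e, he⟩ := ContinuousMap.exists_restrict_eq hA a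
  have hea : ∀ x : A, e x = a x := fun x => congrArg (fun g : C(A, Fin n → ℂ) => g x) he
  obtain ⟨m, hm, hmA⟩ : ∃ m : ℝ, 0 < m ∧ ∀ x ∈ A, m ≤ ‖e x‖ := by
    rcases A.eq_empty_or_nonempty with rfl | hne
    · exact ⟨1, one_pos, by simp⟩
    · obtain ⟨x₀, hx₀, hmin⟩ := hA.isCompact.exists_isMinOn hne e.continuous.norm.continuousOn
      refine ⟨‖e x₀‖, ?_, fun x hx => hmin hx⟩
      rw [norm_pos_iff, hea ⟨x₀, hx₀⟩]
      exact ha _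
  -- Half of the allowed error `m / 2` is for smoothing, the other half for the translation by `y`.
  obtain ⟨g, hg, hge⟩ := exists_contDiff_near c hc e (show 0 < m / 4 by positivity)
  have hdim : Module.finrank ℝ E < Module.finrank ℝ (Fin n → ℂ) := by
    rw [Module.finrank_pi_fintype]
    simpa [mul_comm] using hn
  -- The `C¹` image of a space of smaller dimension has dense complement, so a small `y` is missed
  -- and `g - y` has no zeros.
  obtain ⟨y, hy, hy'⟩ := Metric.dense_iff.1 (hg.dense_compl_range_of_finrank_lt_finrank hdim) 0
    (m / 4) (by positivity)
  rw [mem_ball_zero_iff] at hy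
  let h : C(K, Fin n → ℂ) := ⟨fun x => g (c x) - y, by
    have := hg.continuous
    fun_prop⟩
  have h0 : ∀ x, h x ≠ 0 := fun x hx => hy' ⟨c x, sub_eq_zero.1 hx⟩
  have hhe : ∀ x, ‖e x - h x‖ < m / 2 := by
    intro x
    have h1 : e x - h x = -(g (c x) - e x) + y := by
      change e x - (g (c x) - y) = _
      abel
    rw [h1]
    refine (norm_add_le _ _).trans_lt ?_
    rw [norm_neg]
    linarith [hge x]
  -- The cutoff is `1` where `‖e‖ ≥ m`, in particular on `A`, and `0` where `‖e‖ ≤ m / 2`. Where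
  -- `‖e‖ > m / 2`, the segment from `h` to `e` avoids zero because `‖e - h‖ < m / 2`.
  let χ : K → ℝ := fun x => max 0 (min 1 ((‖e x‖ - m / 2) / (m / 2)))
  have hχ : Continuous χ := by fun_prop
  refine ⟨⟨fun x => h x + (χ x : ℂ) • (e x - h x), by fun_prop⟩, fun x hx => ?_, fun x => ?_⟩
  · change h x + (χ x : ℂ) • (e x - h x) = 0 at hx
    rcases le_or_gt ‖e x‖ (m / 2) with hle | hlt
    · have hχ0 : χ x = 0 := by
        refine max_eq_left ((min_le_right _ _).trans ?_)
        exact div_nonpos_of_nonpos_of_nonneg (by linarith) (by positivity)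
      rw [hχ0] at hx
      exact h0 x (by simpa using hx)
    · have h1 : e x = (1 - χ x : ℂ) • (e x - h x) := by
        rw [sub_smul, one_smul]
        calc e x = e x - (h x + (χ x : ℂ) • (e x - h x)) := by rw [hx, sub_zero]
          _ = _ := by abel
      have h2 : 0 ≤ χ x := le_max_left _ _
      have h3 : χ x ≤ 1 := max_le zero_le_one (min_le_left _ _)
      have h4 := congrArg norm h1
      rw [norm_smul, ← Complex.ofReal_one, ← Complex.ofReal_sub, Complex.norm_real,
        Real.norm_of_nonneg (by linarith)] at h4
      nlinarith [hhe x, norm_nonneg (e x - h x)]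
  · have hχ1 : χ x = 1 := by
      have h1 : 1 ≤ (‖e x‖ - m / 2) / (m / 2) := by
        rw [le_div_iff₀ (by positivity)]
        linarith [hmA x x.2]
      change max 0 (min 1 _) = (1 : ℝ)
      rw [min_eq_left h1, max_eq_right zero_le_one]
    change h x + (χ x : ℂ) • (e x - h x) = a x
    rw [hχ1, ← hea]
    simp

/-- The coordinates of a section with respect to a frame are continuous. -/
theorem exists_coords {Y : Type*} [TopologicalSpace Y] {n : ℕ} {f : Y → BU n}
    {F : Y → Fin n → EllTwo} (hF : Continuous F) (hFr : ∀ y, IsFrame (f y) (F y))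
    {s : Y → EllTwo} (hs : Continuous s) (hsf : ∀ y, s y ∈ (f y).1.range) :
    ∃ a : C(Y, Fin n → ℂ), ∀ y, s y = ∑ j, a y j • F y j := by
  have hdet : ∀ y, (crossGram (F y) (F y)).det ≠ 0 := fun y =>
    (hFr y).det_crossGram_ne_zero (hFr y)
  have hFj : ∀ j, Continuous fun y => F y j := fun j => (continuous_apply j).comp hF
  have hM : Continuous fun y => crossGram (F y) (F y) :=
    continuous_matrix fun i j => (hFj i).inner (hFj j)
  refine ⟨⟨fun y => (crossGram (F y) (F y))⁻¹ *ᵥ fun i => inner ℂ (F y i) (s y), ?_⟩,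
    fun y => ?_⟩
  · refine Continuous.matrix_mulVec ?_ (continuous_pi fun i => (hFj i).inner hs)
    simp only [Matrix.inv_def, Ring.inverse_eq_inv']
    exact (hM.matrix_det.inv₀ hdet).smul hM.matrix_adjugate
  · have h1 := hsf y
    rw [← (hFr y).span_eq, Submodule.mem_span_range_iff_exists_fun] at h1
    obtain ⟨c, hc⟩ := h1
    have h2 : (fun i => inner ℂ (F y i) (s y)) = crossGram (F y) (F y) *ᵥ c := by
      funext i
      simp [← hc, crossGram, Matrix.mulVec, dotProduct, mul_comm]
    simp only [ContinuousMap.coe_mk]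
    rw [h2, Matrix.mulVec_mulVec, Matrix.nonsing_inv_mul _ (isUnit_iff_ne_zero.2 (hdet y)),
      Matrix.one_mulVec, hc]

/-- Sections without zeros extend over a cell of dimension less than `2 n`. -/
theorem exists_section_extension [T2Space K] [ContractibleSpace K] {X : Type*}
    [TopologicalSpace X] (c : C(K, E)) (hc : Function.Injective c) {q : C(K, X)}
    (hq : Topology.IsQuotientMap q) {A : Set K} (hA : IsClosed A)
    (hqA : ∀ k k', q k = q k' → k = k' ∨ (k ∈ A ∧ k' ∈ A)) {n : ℕ}
    (hn : Module.finrank ℝ E < 2 * n) (f : C(X, BU n)) (s : C(A, EllTwo))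
    (hs : ∀ k : A, s k ∈ (f (q k)).1.range) (hs0 : ∀ k, s k ≠ 0)
    (hsq : ∀ k k' : A, q k = q k' → s k = s k') :
    ∃ S : C(X, EllTwo), (∀ x, S x ∈ (f x).1.range) ∧ (∀ x, S x ≠ 0) ∧ ∀ k : A, S (q k) = s k := by
  -- Over the contractible cell the bundle is trivial, so sections become functions to `ℂⁿ`.
  obtain ⟨F, hF⟩ := exists_frame (f.comp q)
  obtain ⟨a, ha⟩ := exists_coords (f := fun k : A => f (q k)) (F := fun k : A => F k)
    (by fun_prop) (fun k => hF k) s.continuous hs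
  obtain ⟨b, hb0, hba⟩ := exists_extension_ne_zero c hc hA hn a fun k hk => hs0 k (by
    rw [ha, hk]; simp)
  let S : C(K, EllTwo) := ⟨fun k => ∑ j, b k j • F k j, by fun_prop⟩
  have hSs : ∀ k : A, S k = s k := fun k => by
    rw [ha, ← hba]; rfl
  have hfac : Function.FactorsThrough S q := by
    intro k k' hkk'
    rcases hqA k k' hkk' with rfl | ⟨h1, h2⟩
    · rfl
    · rw [hSs ⟨k, h1⟩, hSs ⟨k', h2⟩]
      exact hsq _ _ hkk'
  have hlift : ∀ k, hq.lift S hfac (q k) = S k := fun k =>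
    congrArg (fun g : C(K, EllTwo) => g k) (hq.lift_comp S hfac)
  refine ⟨hq.lift S hfac, fun x => ?_, fun x => ?_, fun k => (hlift k).trans (hSs k)⟩
  · obtain ⟨k, rfl⟩ := hq.surjective x
    rw [hlift]
    change ∑ j, b k j • F k j ∈ (f (q k)).1.range
    exact Submodule.sum_mem _ fun j _ => Submodule.smul_mem _ _ ((hF k).1 j)
  · obtain ⟨k, rfl⟩ := hq.surjective x
    rw [hlift]
    intro h
    exact hb0 k (funext (Fintype.linearIndependent_iff.1 (hF k).2 _ h))

end Extension

/-- Every bundle of positive rank on the circle has a section without zeros. -/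
theorem exists_section_circle {n : ℕ} (hn : 1 ≤ n) (f : C(Circle, BU n)) :
    ∃ S : C(Circle, EllTwo), (∀ x, S x ∈ (f x).1.range) ∧ ∀ x, S x ≠ 0 := by
  obtain ⟨F, hF⟩ := exists_isFrame (f (circleParam 0))
  have hA : ∀ t ∈ ({0, 1} : Set I), circleParam t = circleParam 0 := by
    rintro t (rfl | rfl)
    exacts [rfl, circleParam_zero_one.symm]
  -- The circle is an interval with its ends glued; the same vector is prescribed at both ends.
  obtain ⟨S, hS, hS0, -⟩ := exists_section_extension (E := ℝ) (K := I)
    ⟨Subtype.val, continuous_subtype_val⟩ Subtype.val_injective isQuotientMap_circleParam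
    (A := {0, 1}) (Set.toFinite _).isClosed (fun _ _ => circleParam_eq) (n := n)
    (by rw [Module.finrank_self]; omega) f (ContinuousMap.const _ (F ⟨0, hn⟩))
    (fun k => by
      rw [hA k k.2]
      exact hF.1 _) (fun _ => hF.2.ne_zero _) fun _ _ _ => rfl
  exact ⟨S, hS, hS0⟩

/-- Bundles on the circle are trivial. -/
theorem exists_frame_circle {n : ℕ} (f : C(Circle, BU n)) :
    ∃ G : C(Circle, Fin n → EllTwo), ∀ w, IsFrame (f w) (G w) := by
  induction n with
  | zero =>
    exact ⟨ContinuousMap.const _ 0, fun w => ⟨fun j => j.elim0, linearIndependent_empty_type⟩⟩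
  | succ n ih =>
    obtain ⟨S, hS, hS0⟩ := exists_section_circle (Nat.le_add_left 1 n) f
    obtain ⟨g, T, hT⟩ := exists_bundleSum_of_section f S hS hS0
    obtain ⟨G, hG⟩ := ih g
    obtain ⟨b, hb⟩ := exists_isFrame (basePointBU 1)
    refine ⟨⟨fun w j => T w (Fin.append (fun i => evenEmb (G w i)) (fun i => oddEmb (b i)) j), ?_⟩,
      fun w => ((hG w).append hb).map (hT w)⟩
    have h : Continuous fun w =>
        (Fin.append (fun i => evenEmb (G w i)) fun i => oddEmb (b i) : Fin (n + 1) → EllTwo) :=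
      continuous_append (continuous_pi fun i => evenEmb.continuous.comp (by fun_prop))
        continuous_const
    refine continuous_pi fun j => ?_
    exact T.continuous.clm_apply ((continuous_apply j).comp h)

/-! ### Operators between lines, and gluing isomorphisms of line bundles. -/

theorem ellTwo_inner_self (v : EllTwo) : inner ℂ v v = (‖v‖ : ℂ) ^ 2 :=
  inner_self_eq_norm_sq_to_K v

theorem isFrame_one {P : BU 1} {v : EllTwo} (hv : v ∈ P.1.range) (h0 : v ≠ 0) :
    IsFrame P fun _ => v :=
  ⟨fun _ => hv, LinearIndependent.of_subsingleton 0 h0⟩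

theorem BU.exists_smul_eq {P : BU 1} {u v : EllTwo} (hu : u ∈ P.1.range) (hv : v ∈ P.1.range)
    (h0 : v ≠ 0) : ∃ x : ℂ, u = x • v := by
  rw [← (isFrame_one hv h0).span_eq, Set.range_const, Submodule.mem_span_singleton] at hu
  obtain ⟨x, rfl⟩ := hu
  exact ⟨x, rfl⟩

/-- The operator taking `v` to `w`, and zero on the orthogonal complement of `v`. -/
noncomputable def lineMap (w v : EllTwo) : EllTwo →L[ℂ] EllTwo :=
  ((‖v‖ ^ 2)⁻¹ : ℂ) • InnerProductSpace.rankOne ℂ w v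

theorem lineMap_apply (w v u : EllTwo) :
    lineMap w v u = ((‖v‖ ^ 2)⁻¹ : ℂ) • inner ℂ v u • w := rfl

theorem lineMap_self (w : EllTwo) {v : EllTwo} (hv : v ≠ 0) : lineMap w v v = w := by
  have h : (‖v‖ : ℂ) ≠ 0 := by simpa using hv
  rw [lineMap_apply, inner_self_eq_norm_sq_to_K, smul_smul]
  simp [h]

/-- The factor `‖v‖⁻²` makes the operator depend only on the linear map of lines `v ↦ w`. This lets
isomorphisms written in frames upstairs descend to a quotient whose frames need not match. -/
theorem lineMap_smul (w v : EllTwo) {x : ℂ} (hx : x ≠ 0) :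
    lineMap (x • w) (x • v) = lineMap w v := by
  ext1 u
  have h : (‖x‖ : ℂ) ^ 2 = x * (starRingEnd ℂ) x := by rw [Complex.mul_conj']
  have hx' : (starRingEnd ℂ) x ≠ 0 := by simpa using hx
  rw [lineMap_apply, lineMap_apply, inner_smul_left, smul_smul, smul_smul, smul_smul, norm_smul]
  congr 1
  push_cast
  rw [mul_pow, h, mul_inv, mul_inv]
  field_simp

theorem continuous_lineMap {Y : Type*} [TopologicalSpace Y] {w v : Y → EllTwo}
    (hw : Continuous w) (hv : Continuous v) (h : ∀ y, v y ≠ 0) :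
    Continuous fun y => lineMap (w y) (v y) := by
  have hn : Continuous fun y => (‖v y‖ : ℂ) ^ 2 := by fun_prop
  refine Continuous.smul (hn.inv₀ fun y => ?_) (continuous_rankOne hw hv)
  simpa using h y

/-- A continuous family of isomorphisms of line bundles over a cell which descends to the
quotient on the boundary. -/
theorem bundleIso_of_exp {K X : Type*} [TopologicalSpace K] [TopologicalSpace X] {q : C(K, X)}
    (hq : Topology.IsQuotientMap q) {A : Set K}
    (hqA : ∀ k k', q k = q k' → k = k' ∨ (k ∈ A ∧ k' ∈ A)) {f f' : C(X, BU 1)}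
    {F F' : C(K, EllTwo)} (hF : ∀ k, F k ∈ (f (q k)).1.range) (hF0 : ∀ k, F k ≠ 0)
    (hF' : ∀ k, F' k ∈ (f' (q k)).1.range) (hF0' : ∀ k, F' k ≠ 0) (a : C(K, ℂ))
    (ha : ∀ k, a k ≠ 0)
    (T : K → EllTwo →L[ℂ] EllTwo) (hT : ∀ k ∈ A, T k (F k) = a k • F' k)
    (hTq : ∀ k ∈ A, ∀ k' ∈ A, q k = q k' → T k = T k') : BundleIso f f' := by
  let W : C(K, EllTwo →L[ℂ] EllTwo) := ⟨fun k => lineMap (a k • F' k) (F k),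
    continuous_lineMap (by fun_prop) F.continuous hF0⟩
  have hfac : Function.FactorsThrough W q := by
    intro k k' hkk'
    rcases hqA k k' hkk' with rfl | ⟨h1, h2⟩
    · rfl
    · obtain ⟨x, hx⟩ := BU.exists_smul_eq (P := f (q k)) (hF k) (by rw [hkk']; exact hF k') (hF0 k')
      have hx0 : x ≠ 0 := by
        rintro rfl
        exact hF0 k (by simpa using hx)
      change lineMap (a k • F' k) (F k) = lineMap (a k' • F' k') (F k')
      rw [← hT k h1, ← hT k' h2, hTq k h1 k' h2 hkk', hx, map_smul, lineMap_smul _ _ hx0]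
  refine ⟨hq.lift W hfac, fun x u hu => ?_⟩
  obtain ⟨k, rfl⟩ := hq.surjective x
  have hW : hq.lift W hfac (q k) = lineMap (a k • F' k) (F k) :=
    congrArg (fun g : C(K, EllTwo →L[ℂ] EllTwo) => g k) (hq.lift_comp W hfac)
  obtain ⟨x, rfl⟩ := BU.exists_smul_eq hu (hF k) (hF0 k)
  rw [hW, map_smul, lineMap_self _ (hF0 k)]
  refine ⟨Submodule.smul_mem _ _ (Submodule.smul_mem _ _ (hF' k)), fun h => ?_⟩
  rcases smul_eq_zero.1 h with h | h
  · rw [h, zero_smul]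
  · rcases smul_eq_zero.1 h with h | h
    exacts [absurd h (ha k), absurd h (hF0' k)]

/-! ### Degrees of bundles on the Moore space -/

/-- The quotient map from the disc to the Moore space. -/
def mooreMk (p : ℕ) : C(DiscTwo, MooreSpace p) := ⟨Quotient.mk _, continuous_quotient_mk'⟩

theorem isQuotientMap_mooreMk (p : ℕ) : Topology.IsQuotientMap (mooreMk p) :=
  isQuotientMap_quotient_mk'

/-- The boundary of the disc. -/
def discBoundary : Set DiscTwo := {z | ‖z.1‖ = 1}

theorem isClosed_discBoundary : IsClosed discBoundary :=
  isClosed_eq (by fun_prop) continuous_const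

theorem mooreMk_eq {p : ℕ} {z w : DiscTwo} (h : mooreMk p z = mooreMk p w) :
    z = w ∨ (z ∈ discBoundary ∧ w ∈ discBoundary) := by
  rcases Quotient.exact h with h | ⟨h1, h2, -⟩
  exacts [Or.inl h, Or.inr ⟨h1, h2⟩]

theorem coe_circleToDisc (z : Circle) : (circleToDisc z).1 = z := rfl

/-- The boundary of the disc, as a circle. -/
def discBoundaryToCircle : C(discBoundary, Circle) :=
  ⟨fun z => ⟨z.1.1, mem_sphere_zero_iff_norm.2 z.2⟩, by fun_prop⟩

theorem circleToDisc_discBoundaryToCircle (z : discBoundary) :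
    circleToDisc (discBoundaryToCircle z) = z := rfl

theorem mooreMk_circleToDisc_eq_iff {p : ℕ} {z w : Circle} :
    mooreMk p (circleToDisc z) = mooreMk p (circleToDisc w) ↔ z ^ p = w ^ p ∨ z = w := by
  constructor
  · intro h
    rcases Quotient.exact h with h | ⟨-, -, h⟩
    · exact Or.inr (Circle.ext (congrArg (fun z : DiscTwo => z.1) h))
    · exact Or.inl (Circle.ext (by simpa [coe_circleToDisc] using h))
  · rintro (h | rfl)
    · refine Quotient.sound (Or.inr ⟨Circle.norm_coe z, Circle.norm_coe w, ?_⟩)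
      have := congrArg (fun z : Circle => (z : ℂ)) h
      simpa [coe_circleToDisc] using this
    · rfl

/-- For `p > 0` the power map is a quotient map of the circle, and the boundary map of the disc
factors through it. For `p = 0` the whole boundary is one point and the circle maps to it
constantly; this case is kept because `P²(0)` is the sphere. -/
theorem exists_mooreCircle (p : ℕ) :
    ∃ c : C(Circle, MooreSpace p), (∀ z, c (z ^ p) = mooreMk p (circleToDisc z)) ∧
      ∀ w, ∃ z, c w = mooreMk p (circleToDisc z) := by
  rcases Nat.eq_zero_or_pos p with rfl | hp
  · refine ⟨ContinuousMap.const _ (mooreMk 0 (circleToDisc 1)), fun z => ?_, fun _ => ⟨1, rfl⟩⟩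
    exact mooreMk_circleToDisc_eq_iff.2 (Or.inl (by simp))
  · have : NeZero p := ⟨hp.ne'⟩
    let P : C(Circle, Circle) := ⟨fun z => z ^ p, by fun_prop⟩
    have hP : Topology.IsQuotientMap P := (Circle.isQuotientCoveringMap_npow p).toIsQuotientMap
    have hfac : Function.FactorsThrough ((mooreMk p).comp circleToDisc) P := fun z w h =>
      mooreMk_circleToDisc_eq_iff.2 (Or.inl h)
    have h : ∀ z, hP.lift _ hfac (z ^ p) = mooreMk p (circleToDisc z) := fun z =>
      congrArg (fun g : C(Circle, MooreSpace p) => g z) (hP.lift_comp _ hfac)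
    refine ⟨hP.lift _ hfac, h, fun w => ?_⟩
    obtain ⟨z, rfl⟩ := hP.surjective w
    exact ⟨z, h z⟩

/-- The circle in the Moore space. -/
noncomputable def mooreCircle (p : ℕ) : C(Circle, MooreSpace p) := (exists_mooreCircle p).choose

theorem mooreCircle_pow {p : ℕ} (z : Circle) :
    mooreCircle p (z ^ p) = mooreMk p (circleToDisc z) := (exists_mooreCircle p).choose_spec.1 z

theorem exists_mooreCircle_eq {p : ℕ} (w : Circle) :
    ∃ z, mooreCircle p w = mooreMk p (circleToDisc z) := (exists_mooreCircle p).choose_spec.2 w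

section Moore

variable {p n : ℕ}

/-- The clutching function of the bundle `f`, which compares a frame on the disc to a frame on the
circle, has determinant of degree `k`. -/
def HasDeg (f : C(MooreSpace p, BU n)) (k : ℤ) : Prop :=
  ∃ (F : C(DiscTwo, Fin n → EllTwo)) (G : C(Circle, Fin n → EllTwo)),
    (∀ z, IsFrame (f (mooreMk p z)) (F z)) ∧ (∀ w, IsFrame (f (mooreCircle p w)) (G w)) ∧
      IsDeg (fun z => (crossGram (G (z ^ p)) (F (circleToDisc z))).det) k

theorem isFrame_pow {f : C(MooreSpace p, BU n)} {G : C(Circle, Fin n → EllTwo)}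
    (hG : ∀ w, IsFrame (f (mooreCircle p w)) (G w)) (z : Circle) :
    IsFrame (f (mooreMk p (circleToDisc z))) (G (z ^ p)) := by
  rw [← mooreCircle_pow]
  exact hG _

theorem exists_hasDeg (f : C(MooreSpace p, BU n)) : ∃ k, HasDeg f k := by
  obtain ⟨F, hF⟩ := exists_frame (f.comp (mooreMk p))
  obtain ⟨G, hG⟩ := exists_frame_circle (f.comp (mooreCircle p))
  obtain ⟨k, hk⟩ := exists_isDeg
    (φ := fun z => (crossGram (G (z ^ p)) (F (circleToDisc z))).det)
    (continuous_det_crossGram (by fun_prop) (by fun_prop))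
    fun z => (isFrame_pow hG z).det_crossGram_ne_zero (hF _)
  exact ⟨k, F, G, hF, hG, hk⟩

/-- Transport both frames of `f` by the isomorphism. Two frames over the disc differ by a function
of degree `0` on the boundary; two frames over the circle differ by a function of `z ^ p`, whose
degree is divisible by `p`. -/
theorem HasDeg.congr {f f' : C(MooreSpace p, BU n)} {k k' : ℤ} (hk : HasDeg f k)
    (hk' : HasDeg f' k') (h : BundleIso f f') : (k : ZMod p) = k' := by
  obtain ⟨F, G, hF, hG, hφ⟩ := hk
  obtain ⟨F', G', hF', hG', hφ'⟩ := hk'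
  obtain ⟨T, hT⟩ := h
  let TF : C(DiscTwo, Fin n → EllTwo) := ⟨fun z j => T (mooreMk p z) (F z j), by fun_prop⟩
  let TG : C(Circle, Fin n → EllTwo) := ⟨fun w j => T (mooreCircle p w) (G w j), by fun_prop⟩
  have hTF : ∀ z, IsFrame (f' (mooreMk p z)) (TF z) := fun z => (hF z).map (hT _)
  have hTG : ∀ w, IsFrame (f' (mooreCircle p w)) (TG w) := fun w => (hG w).map (hT _)
  have hGG := fun w => (hG w).det_crossGram_ne_zero (hG w)
  have hGT := fun w => (hG' w).det_crossGram_ne_zero (hTG w)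
  obtain ⟨m₀, hm₀⟩ := exists_isDeg (continuous_det_crossGram (by fun_prop) (by fun_prop)) hGG
  obtain ⟨m₁, hm₁⟩ := exists_isDeg (continuous_det_crossGram (by fun_prop) (by fun_prop)) hGT
  have h1 := isDeg_zero_of_disc (continuous_det_crossGram (by fun_prop) (by fun_prop))
    fun z => (hTF z).det_crossGram_ne_zero (hTF z)
  have h2 := isDeg_zero_of_disc (continuous_det_crossGram (by fun_prop) (by fun_prop))
    fun z => (hTF z).det_crossGram_ne_zero (hF' z)
  -- Both sides are degrees of one function: with `F = h G` and `F' = a TF` on the boundary, each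
  -- product of Gram determinants contains `det h * det a` and the same remaining factors.
  have key := ((hφ'.mul (hm₀.comp_pow p)).mul h1).unique
    (k' := p * m₁ + k + 0) ?_
  · have h3 := congrArg (fun m : ℤ => (m : ZMod p)) key
    simpa using h3.symm
  · convert ((hm₁.comp_pow p).mul hφ).mul h2 using 2 with z
    obtain ⟨h, hh⟩ := (hF (circleToDisc z)).exists_matrix (isFrame_pow hG z)
    obtain ⟨a, ha⟩ := (hF' (circleToDisc z)).exists_matrix (hTF (circleToDisc z))
    have hTh : ∀ j, TF (circleToDisc z) j = ∑ i, h i j • TG (z ^ p) i := by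
      intro j
      change T (mooreMk p (circleToDisc z)) (F (circleToDisc z) j) =
        ∑ i, h i j • T (mooreCircle p (z ^ p)) (G (z ^ p) i)
      rw [hh, mooreCircle_pow]
      simp
    rw [det_crossGram_of_eq ha, det_crossGram_of_eq hTh, det_crossGram_of_eq hh,
      det_crossGram_of_eq ha]
    ring

/-- The degree of a bundle on the Moore space. -/
noncomputable def mooreDegree (f : C(MooreSpace p, BU n)) : ZMod p := (exists_hasDeg f).choose

theorem BundleIso.mooreDegree_eq {f f' : C(MooreSpace p, BU n)} (h : BundleIso f f') :
    mooreDegree f = mooreDegree f' :=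
  (exists_hasDeg f).choose_spec.congr (exists_hasDeg f').choose_spec h

theorem BundleIso.refl {X : Type*} [TopologicalSpace X] (f : C(X, BU n)) : BundleIso f f :=
  ⟨1, fun _ _ hu => ⟨hu, id⟩⟩

theorem HasDeg.mooreDegree_eq {f : C(MooreSpace p, BU n)} {k : ℤ} (h : HasDeg f k) :
    mooreDegree f = k :=
  (exists_hasDeg f).choose_spec.congr h (BundleIso.refl f)

theorem HasDeg.bundleSum {m : ℕ} {f : C(MooreSpace p, BU m)} {g : C(MooreSpace p, BU n)}
    {k l : ℤ} (hk : HasDeg f k) (hl : HasDeg g l) : HasDeg (bundleSum f g) (k + l) := by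
  obtain ⟨F, G, hF, hG, hφ⟩ := hk
  obtain ⟨F', G', hF', hG', hφ'⟩ := hl
  have hc : ∀ {Y : Type} [TopologicalSpace Y] (F : C(Y, Fin m → EllTwo))
      (F' : C(Y, Fin n → EllTwo)), Continuous fun y =>
        Fin.append (fun i => evenEmb (F y i)) fun i => oddEmb (F' y i) := fun F F' =>
    continuous_append (continuous_pi fun i => evenEmb.continuous.comp (by fun_prop))
      (continuous_pi fun i => oddEmb.continuous.comp (by fun_prop))
  refine ⟨⟨_, hc F F'⟩, ⟨_, hc G G'⟩, fun z => (hF z).append (hF' z),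
    fun w => (hG w).append (hG' w), ?_⟩
  convert hφ.mul hφ' using 2 with z
  exact det_crossGram_even_odd _ _ _ _

theorem hasDeg_trivialBundle : HasDeg (trivialBundle (MooreSpace p) n) 0 := by
  obtain ⟨b, hb⟩ := exists_isFrame (basePointBU n)
  exact ⟨ContinuousMap.const _ b, ContinuousMap.const _ b, fun _ => hb, fun _ => hb,
    isDeg_zero_of_disc (ψ := fun _ => (crossGram b b).det) continuous_const
      fun _ => hb.det_crossGram_ne_zero hb⟩

theorem mooreDegree_bundleSum {m : ℕ} (f : C(MooreSpace p, BU m)) (g : C(MooreSpace p, BU n)) :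
    mooreDegree (bundleSum f g) = mooreDegree f + mooreDegree g := by
  obtain ⟨k, hk⟩ := exists_hasDeg f
  obtain ⟨l, hl⟩ := exists_hasDeg g
  rw [(hk.bundleSum hl).mooreDegree_eq, hk.mooreDegree_eq, hl.mooreDegree_eq, Int.cast_add]

theorem mooreDegree_trivialBundle : mooreDegree (trivialBundle (MooreSpace p) n) = 0 := by
  rw [hasDeg_trivialBundle.mooreDegree_eq, Int.cast_zero]

/-- A bundle of rank at least two on the Moore space has a section without zeros. -/
theorem exists_section_moore (hn : 2 ≤ n) (f : C(MooreSpace p, BU n)) :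
    ∃ S : C(MooreSpace p, EllTwo), (∀ x, S x ∈ (f x).1.range) ∧ ∀ x, S x ≠ 0 := by
  obtain ⟨s, hs, hs0⟩ := exists_section_circle (by omega) (f.comp (mooreCircle p))
  obtain ⟨S, hS, hS0, -⟩ := exists_section_extension (E := ℂ) (K := DiscTwo)
    ⟨Subtype.val, continuous_subtype_val⟩ Subtype.val_injective (isQuotientMap_mooreMk p)
    isClosed_discBoundary (fun _ _ => mooreMk_eq) (n := n)
    (by rw [Complex.finrank_real_complex]; omega) f
    -- A section over the circle composed with `z ↦ z ^ p` respects the identifications of the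
    -- boundary.
    (s.comp ⟨fun z => discBoundaryToCircle z ^ p, by fun_prop⟩)
    (fun z => by
      have := hs (discBoundaryToCircle z ^ p)
      rw [ContinuousMap.comp_apply, mooreCircle_pow] at this
      exact this) (fun _ => hs0 _) fun z w h => by
        rcases mooreMk_circleToDisc_eq_iff (z := discBoundaryToCircle z)
          (w := discBoundaryToCircle w) |>.1 h with h | h
        · exact congrArg s h
        · exact congrArg (fun z => s (z ^ p)) h
  exact ⟨S, hS, hS0⟩

/-! ### Classification of bundles on the Moore space. -/

theorem IsDeg.conj {φ : Circle → ℂ} {k : ℤ} (h : IsDeg φ k) :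
    IsDeg (fun z => (starRingEnd ℂ) (φ z)) (-k) := by
  obtain ⟨L, hL⟩ := h
  refine ⟨⟨fun z => (starRingEnd ℂ) (L z), by fun_prop⟩, fun z => ?_⟩
  change (starRingEnd ℂ) (φ z) = _
  rw [hL, map_mul, map_zpow₀, ← Complex.exp_conj, ← Circle.coe_inv_eq_conj, Circle.coe_inv,
    inv_zpow']
  rfl

theorem HasDeg.exists_line {f : C(MooreSpace p, BU 1)} {k : ℤ} (h : HasDeg f k) :
    ∃ (F : C(DiscTwo, EllTwo)) (G : C(Circle, EllTwo)),
      (∀ z, F z ∈ (f (mooreMk p z)).1.range) ∧ (∀ z, F z ≠ 0) ∧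
      (∀ w, G w ∈ (f (mooreCircle p w)).1.range) ∧ (∀ w, G w ≠ 0) ∧
      IsDeg (fun z => inner ℂ (G (z ^ p)) (F (circleToDisc z))) k := by
  obtain ⟨F, G, hF, hG, h⟩ := h
  refine ⟨⟨fun z => F z 0, by fun_prop⟩, ⟨fun w => G w 0, by fun_prop⟩, fun z => (hF z).1 0,
    fun z => (hF z).2.ne_zero 0, fun z => (hG z).1 0, fun z => (hG z).2.ne_zero 0, ?_⟩
  convert h using 2 with z
  rw [Matrix.det_fin_one]
  rfl

theorem hasDeg_of_line {f : C(MooreSpace p, BU 1)} {k : ℤ} (F : C(DiscTwo, EllTwo))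
    (G : C(Circle, EllTwo)) (hF : ∀ z, F z ∈ (f (mooreMk p z)).1.range) (hF0 : ∀ z, F z ≠ 0)
    (hG : ∀ w, G w ∈ (f (mooreCircle p w)).1.range) (hG0 : ∀ w, G w ≠ 0)
    (h : IsDeg (fun z => inner ℂ (G (z ^ p)) (F (circleToDisc z))) k) : HasDeg f k := by
  refine ⟨⟨fun z _ => F z, by fun_prop⟩, ⟨fun w _ => G w, by fun_prop⟩,
    fun z => isFrame_one (hF z) (hF0 z), fun w => isFrame_one (hG w) (hG0 w), ?_⟩
  convert h using 2 with z
  rw [Matrix.det_fin_one]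
  rfl

theorem isClosedEmbedding_circleToDisc : Topology.IsClosedEmbedding circleToDisc :=
  circleToDisc.continuous.isClosedEmbedding fun _ _ h =>
    Circle.ext (congrArg (fun z : DiscTwo => z.1) h)

theorem isDeg_norm_sq {v : Circle → EllTwo} (hv : Continuous v) (h : ∀ z, v z ≠ 0) :
    IsDeg (fun z => (‖v z‖ : ℂ) ^ 2) 0 := by
  have := isDeg_zero_of_pos (φ := fun z => ‖v z‖ ^ 2) (by fun_prop)
    fun z => by have := norm_pos_iff.2 (h z); positivity
  convert this using 2 with z
  push_cast
  rfl

/-- The isomorphism `G ↦ G'` over the circle may be twisted by `w ^ j`, which shifts the boundary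
degree by `p j`. With `k' - k = p j` the result has degree `0` in the frames `F`, `F'`, and so
extends over the disc. -/
theorem bundleIso_of_mooreDegree_eq_one {f f' : C(MooreSpace p, BU 1)}
    (h : mooreDegree f = mooreDegree f') : BundleIso f f' := by
  obtain ⟨k, hk⟩ := exists_hasDeg f
  obtain ⟨k', hk'⟩ := exists_hasDeg f'
  rw [hk.mooreDegree_eq, hk'.mooreDegree_eq, ZMod.intCast_eq_intCast_iff_dvd_sub] at h
  obtain ⟨j, hj⟩ := h
  obtain ⟨F, G, hF, hF0, hG, hG0, hφ⟩ := hk.exists_line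
  obtain ⟨F', G', hF', hF0', hG', hG0', hφ'⟩ := hk'.exists_line
  let T : Circle → EllTwo →L[ℂ] EllTwo := fun w => (w : ℂ) ^ j • lineMap (G' w) (G w)
  have hG'z : ∀ z, G' (z ^ p) ∈ (f' (mooreMk p (circleToDisc z))).1.range := fun z => by
    rw [← mooreCircle_pow]; exact hG' _
  have hchoose : ∀ z, ∃ a : ℂ,
      T (z ^ p) (F (circleToDisc z)) = a • F' (circleToDisc z) := fun z =>
    BU.exists_smul_eq (Submodule.smul_mem _ _ (Submodule.smul_mem _ _
      (Submodule.smul_mem _ _ (hG'z z)))) (hF' _) (hF0' _)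
  choose a ha using hchoose
  have hdeg : IsDeg a 0 := by
    -- Pairing the defining equation of `a` with `F'` gives `a ‖G‖² ‖F'‖² = z ^ (p j) ⟪G, F⟫ conj
    -- ⟪G', F'⟫`, of degree `p j + k - k' = 0`.
    have h1 := (isDeg_norm_sq (v := fun z => G (z ^ p)) (by fun_prop) fun z => hG0 _).mul
      (isDeg_norm_sq (v := fun z => F' (circleToDisc z)) (by fun_prop) fun z => hF0' _)
    have h2 := (((isDeg_zpow j).comp_pow p).mul hφ).mul hφ'.conj
    convert h1.of_mul_eq h2 (φ := a) fun z => ?_ using 1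
    · linarith
    · have h3 := congrArg (inner ℂ (F' (circleToDisc z))) (ha z)
      have h4 : (‖G (z ^ p)‖ : ℂ) ≠ 0 := by simpa using hG0 (z ^ p)
      simp only [T, smul_apply, lineMap_apply, inner_smul_right,
        ellTwo_inner_self] at h3
      rw [inner_conj_symm]
      field_simp at h3
      rw [h3]
      ring
  obtain ⟨L, hL⟩ := hdeg
  -- Tietze extends the logarithm, and its exponential has no zeros on the disc.
  obtain ⟨l, hl⟩ := ContinuousMap.exists_extension' isClosedEmbedding_circleToDisc L
  classical
  refine bundleIso_of_exp (isQuotientMap_mooreMk p) (fun _ _ => mooreMk_eq) hF hF0 hF' hF0'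
    ⟨fun z => Complex.exp (l z), by fun_prop⟩ (fun _ => Complex.exp_ne_zero _)
    (fun k => if hk : k ∈ discBoundary then T (discBoundaryToCircle ⟨k, hk⟩ ^ p) else 0) ?_ ?_
  · intro k hk
    rw [dif_pos hk]
    refine (ha (discBoundaryToCircle ⟨k, hk⟩)).trans ?_
    rw [hL, zpow_zero, one_mul, ← congrFun hl]
    rfl
  · intro k hk k' hk' h
    rw [dif_pos hk, dif_pos hk']
    rcases mooreMk_circleToDisc_eq_iff (z := discBoundaryToCircle ⟨k, hk⟩)
      (w := discBoundaryToCircle ⟨k', hk'⟩) |>.1 h with h | h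
    · rw [h]
    · rw [h]

/-- Bundles on the Moore space are determined by their degree. -/
theorem homotopic_of_mooreDegree_eq (hn : 1 ≤ n) {f f' : C(MooreSpace p, BU n)}
    (h : mooreDegree f = mooreDegree f') : Homotopic f f' := by
  induction n, hn using Nat.le_induction with
  | base => exact (bundleIso_of_mooreDegree_eq_one h).homotopic
  | succ n hn ih =>
    obtain ⟨s, hs, hs0⟩ := exists_section_moore (by omega) f
    obtain ⟨s', hs', hs0'⟩ := exists_section_moore (by omega) f'
    obtain ⟨g, hg⟩ := exists_bundleSum_of_section f s hs hs0
    obtain ⟨g', hg'⟩ := exists_bundleSum_of_section f' s' hs' hs0'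
    have hdeg : mooreDegree g = mooreDegree g' := by
      rw [← hg.mooreDegree_eq, ← hg'.mooreDegree_eq, mooreDegree_bundleSum,
        mooreDegree_bundleSum] at h
      exact add_right_cancel h
    refine (hg.homotopic.symm.trans ?_).trans hg'.homotopic
    exact Homotopic.comp (Homotopic.refl _) ((ih hdeg).prodMk (Homotopic.refl _))

/-- The pairing sends frames to frames, and if `F = x G` and `F' = y G'`, bilinearity gives the
transition function `x y`. -/
theorem mooreDegree_of_isTensorMap {f g h : C(MooreSpace p, BU 1)} (ht : IsTensorMap f g h) :
    mooreDegree h = mooreDegree f + mooreDegree g := by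
  obtain ⟨B, hB⟩ := ht
  obtain ⟨k, hk⟩ := exists_hasDeg f
  obtain ⟨l, hl⟩ := exists_hasDeg g
  rw [hk.mooreDegree_eq, hl.mooreDegree_eq, ← Int.cast_add]
  refine HasDeg.mooreDegree_eq ?_
  obtain ⟨F, G, hF, hF0, hG, hG0, hφ⟩ := hk.exists_line
  obtain ⟨F', G', hF', hF0', hG', hG0', hφ'⟩ := hl.exists_line
  have hGz : ∀ z, G (z ^ p) ∈ (f (mooreMk p (circleToDisc z))).1.range := fun z => by
    rw [← mooreCircle_pow]; exact hG _
  have hGz' : ∀ z, G' (z ^ p) ∈ (g (mooreMk p (circleToDisc z))).1.range := fun z => by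
    rw [← mooreCircle_pow]; exact hG' _
  have hBF := fun z => hB _ _ (hF z) _ (hF' z)
  have hBG := fun w => hB _ _ (hG w) _ (hG' w)
  refine hasDeg_of_line ⟨fun z => B (mooreMk p z) (F z) (F' z), by fun_prop⟩
    ⟨fun w => B (mooreCircle p w) (G w) (G' w), by fun_prop⟩ (fun z => (hBF z).1)
    (fun z => (hBF z).2 (hF0 z) (hF0' z)) (fun w => (hBG w).1)
    (fun w => (hBG w).2 (hG0 w) (hG0' w)) ?_
  have h1 := (isDeg_norm_sq (v := fun z => G (z ^ p)) (by fun_prop) fun z => hG0 _).mul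
    (isDeg_norm_sq (v := fun z => G' (z ^ p)) (by fun_prop) fun z => hG0' _)
  have h2 := (hφ.mul hφ').mul (isDeg_norm_sq
    (v := fun z => B (mooreCircle p (z ^ p)) (G (z ^ p)) (G' (z ^ p))) (by fun_prop)
    fun z => (hBG _).2 (hG0 _) (hG0' _))
  convert h1.of_mul_eq h2 fun z => ?_ using 1
  · ring
  · obtain ⟨x, hx⟩ := BU.exists_smul_eq (hF (circleToDisc z)) (hGz z) (hG0 _)
    obtain ⟨y, hy⟩ := BU.exists_smul_eq (hF' (circleToDisc z)) (hGz' z) (hG0' _)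
    simp only [ContinuousMap.coe_mk, hx, hy, mooreCircle_pow, map_smul,
      smul_apply, inner_smul_right, ellTwo_inner_self]
    ring

end Moore

/-! ### Existence of bundles -/

theorem BU.eq_of_mem {P Q : BU 1} {v : EllTwo} (hP : v ∈ P.1.range) (hQ : v ∈ Q.1.range)
    (h0 : v ≠ 0) : P = Q :=
  BU.ext_range ((isFrame_one hP h0).span_eq.symm.trans (isFrame_one hQ h0).span_eq)

theorem ellBasis_ne_zero (i : ℕ) : ellBasis i ≠ 0 := ellBasis.orthonormal.ne_zero i

theorem lineMap_injOn {v : EllTwo} (hv : v ≠ 0) :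
    ∀ u ∈ (basePointBU 1).1.range, lineMap v (ellBasis 0) u = 0 → u = 0 := by
  intro u hu h
  obtain ⟨c, rfl⟩ := mem_range_basePointBU_one hu
  rw [map_smul, lineMap_self _ (ellBasis_ne_zero 0), smul_eq_zero, or_iff_left hv] at h
  rw [h, zero_smul]

theorem ellBasis_zero_mem : ellBasis 0 ∈ (basePointBU 1).1.range := by
  rw [basePointBU, Submodule.range_starProjection]
  exact Submodule.subset_span ⟨0, rfl⟩

/-- The line spanned by a vector. -/
noncomputable def lineBU (v : EllTwo) (hv : v ≠ 0) : BU 1 :=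
  (basePointBU 1).img (lineMap v (ellBasis 0)) (lineMap_injOn hv)

theorem range_lineBU (v : EllTwo) (hv : v ≠ 0) : (lineBU v hv).1.range =
    (basePointBU 1).1.range.map (lineMap v (ellBasis 0)).toLinearMap :=
  range_imgProj (lineMap_injOn hv)

theorem mem_lineBU (v : EllTwo) (hv : v ≠ 0) : v ∈ (lineBU v hv).1.range := by
  rw [range_lineBU]
  exact ⟨ellBasis 0, ellBasis_zero_mem, lineMap_self v (ellBasis_ne_zero 0)⟩

theorem continuous_lineBU {Y : Type*} [TopologicalSpace Y] {v : Y → EllTwo} (hv : Continuous v)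
    (h0 : ∀ y, v y ≠ 0) : Continuous fun y => lineBU (v y) (h0 y) :=
  continuous_iff_continuousAt.2 fun _ => BU.continuousAt_of_range_eq_map
    (P := fun _ => basePointBU 1) (A := fun y => lineMap (v y) (ellBasis 0)) continuousAt_const
    (continuous_lineMap hv continuous_const fun _ => ellBasis_ne_zero 0).continuousAt
    (Filter.Eventually.of_forall fun y => ⟨lineMap_injOn (h0 y), range_lineBU _ _⟩)

theorem exists_disc_extension_zpow (k : ℤ) :
    ∃ φ : C(DiscTwo, ℂ), ∀ z, φ (circleToDisc z) = (z : ℂ) ^ k := by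
  obtain ⟨m, rfl | rfl⟩ := k.eq_nat_or_neg
  · exact ⟨⟨fun z => z.1 ^ m, by fun_prop⟩, fun z => by simp [coe_circleToDisc]⟩
  · refine ⟨⟨fun z => (starRingEnd ℂ) z.1 ^ m, by fun_prop⟩, fun z => ?_⟩
    simp only [ContinuousMap.coe_mk, coe_circleToDisc]
    rw [← Circle.coe_inv_eq_conj, Circle.coe_inv, zpow_neg, zpow_natCast, inv_pow]

/-- Take the line spanned by `v z`, where the coordinate on `ellBasis 1` prevents zeros inside the
disc. On the boundary the line is constant, so it descends, while its spanning vector `v` winds `k`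
times. -/
theorem exists_hasDeg_line (p : ℕ) (k : ℤ) : ∃ f : C(MooreSpace p, BU 1), HasDeg f k := by
  obtain ⟨φ, hφ⟩ := exists_disc_extension_zpow k
  let v : C(DiscTwo, EllTwo) :=
    ⟨fun z => φ z • ellBasis 0 + (1 - ‖z.1‖ : ℂ) • ellBasis 1, by fun_prop⟩
  have hvb : ∀ z, v (circleToDisc z) = (z : ℂ) ^ k • ellBasis 0 := fun z => by
    simp [v, hφ, coe_circleToDisc, Circle.norm_coe]
  have hv0 : ∀ z, v z ≠ 0 := by
    intro z hz
    by_cases hb : z ∈ discBoundary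
    · have h1 := hvb (discBoundaryToCircle ⟨z, hb⟩)
      rw [circleToDisc_discBoundaryToCircle, hz] at h1
      rcases smul_eq_zero.1 h1.symm with h | h
      exacts [zpow_ne_zero k (Circle.coe_ne_zero _) h, ellBasis_ne_zero 0 h]
    · have h1 := congrArg (inner ℂ (ellBasis 1)) hz
      simp only [v, ContinuousMap.coe_mk, inner_add_right, inner_smul_right, inner_zero_right,
        ellTwo_inner_self, norm_ellBasis, ellBasis.orthonormal.2 (one_ne_zero : (1 : ℕ) ≠ 0)] at h1
      refine hb ?_
      have h2 : (1 : ℂ) = ‖z.1‖ := sub_eq_zero.1 (by simpa using h1)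
      exact (by exact_mod_cast h2.symm : ‖z.1‖ = 1)
  let g : C(DiscTwo, BU 1) := ⟨fun z => lineBU (v z) (hv0 z), continuous_lineBU v.continuous hv0⟩
  have hgb : ∀ z : Circle, ellBasis 0 ∈ (g (circleToDisc z)).1.range := by
    intro z
    have h1 := mem_lineBU _ (hv0 (circleToDisc z))
    have h2 : ellBasis 0 = ((z : ℂ) ^ k)⁻¹ • v (circleToDisc z) := by
      rw [hvb, inv_smul_smul₀ (zpow_ne_zero k (Circle.coe_ne_zero _))]
    rw [h2]
    exact Submodule.smul_mem _ _ h1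
  have hfac : Function.FactorsThrough g (mooreMk p) := by
    intro z w h
    rcases mooreMk_eq h with rfl | ⟨h1, h2⟩
    · rfl
    · exact BU.eq_of_mem (hgb (discBoundaryToCircle ⟨z, h1⟩))
        (hgb (discBoundaryToCircle ⟨w, h2⟩)) (ellBasis_ne_zero 0)
  have hlift : ∀ z, (isQuotientMap_mooreMk p).lift g hfac (mooreMk p z) = g z := fun z =>
    congrArg (fun g : C(DiscTwo, BU 1) => g z) ((isQuotientMap_mooreMk p).lift_comp g hfac)
  refine ⟨(isQuotientMap_mooreMk p).lift g hfac, hasDeg_of_line v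
    (ContinuousMap.const _ (ellBasis 0)) (fun z => ?_) hv0 (fun w => ?_)
    (fun _ => ellBasis_ne_zero 0) ?_⟩
  · rw [hlift]
    exact mem_lineBU _ (hv0 z)
  · obtain ⟨z, hz⟩ := exists_mooreCircle_eq (p := p) w
    rw [hz, hlift]
    exact hgb z
  · convert isDeg_zpow k using 2 with z
    rw [hvb, ContinuousMap.const_apply, inner_smul_right, ellTwo_inner_self, norm_ellBasis]
    simp

theorem exists_mooreDegree_eq {p n : ℕ} (hn : 1 ≤ n) (d : ZMod p) :
    ∃ f : C(MooreSpace p, BU n), mooreDegree f = d := by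
  obtain ⟨k, rfl⟩ := ZMod.intCast_surjective d
  obtain ⟨m, rfl⟩ := Nat.exists_eq_add_of_le hn
  obtain ⟨f, hf⟩ := exists_hasDeg_line p k
  refine ⟨bundleSum f (trivialBundle _ m), ?_⟩
  rw [mooreDegree_bundleSum, mooreDegree_trivialBundle, hf.mooreDegree_eq, add_zero]

/-! ### Tensor products of line bundles -/

theorem summable_geometric_smulRight {H : Type*} [NormedAddCommGroup H] [InnerProductSpace ℂ H]
    [CompleteSpace H] {b : ℕ → H} (hb : ∀ i, ‖b i‖ = 1) {S : ℕ → H →L[ℂ] H}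
    (hS : ∀ i, ‖S i‖ ≤ 1) :
    Summable fun i => ((2 : ℂ)⁻¹ ^ i) • (innerSL ℂ (b i)).smulRight (S i) := by
  refine Summable.of_norm_bounded (g := fun i => (2 : ℝ)⁻¹ ^ i)
    (summable_geometric_of_lt_one (by norm_num) (by norm_num)) fun i => ?_
  rw [norm_smul, ContinuousLinearMap.norm_smulRight_apply, innerSL_apply_norm,
    hb, one_mul, norm_pow, norm_inv, RCLike.norm_ofNat]
  exact mul_le_of_le_one_right (by positivity) (hS i)

/-- A summand of `convMul`. -/
noncomputable def convMulTerm (i : ℕ) : EllTwo →L[ℂ] EllTwo →L[ℂ] EllTwo :=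
  ((2 : ℂ)⁻¹ ^ i) • (innerSL ℂ (ellBasis i)).smulRight
    (ellEmb (fun j => j + i) (add_left_injective i)).toContinuousLinearMap

/-- A continuous bilinear product on `ℓ²(ℕ)` without zero divisors: multiplication of power series
with weights. -/
noncomputable def convMul : EllTwo →L[ℂ] EllTwo →L[ℂ] EllTwo := ∑' i, convMulTerm i

theorem summable_convMulTerm : Summable convMulTerm :=
  summable_geometric_smulRight norm_ellBasis
    fun _ => LinearIsometry.norm_toContinuousLinearMap_le _

/-- As for power series, if `a` and `b` are the lowest indices of nonzero coefficients, then
coefficient `a + b` of the product has the single nonzero summand `2⁻ᵃ u_a w_b`. -/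
theorem convMul_ne_zero {u w : EllTwo} (hu : u ≠ 0) (hw : w ≠ 0) : convMul u w ≠ 0 := by
  classical
  have hex : ∀ {u : EllTwo}, u ≠ 0 → ∃ i, u i ≠ 0 := fun {u} hu => by
    by_contra! h
    exact hu (by ext i; exact h i)
  have hu' := hex hu
  have hw' := hex hw
  set a := Nat.find hu' with ha
  set b := Nat.find hw' with hb
  have hua : u a ≠ 0 := Nat.find_spec hu'
  have hwb : w b ≠ 0 := Nat.find_spec hw'
  have hsum : HasSum (fun i => inner ℂ (ellBasis (a + b)) (convMulTerm i u w))
      (inner ℂ (ellBasis (a + b)) (convMul u w)) := by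
    have h1 := summable_convMulTerm.hasSum.mapL (ContinuousLinearMap.apply ℂ _ u)
    have h2 := h1.mapL (ContinuousLinearMap.apply ℂ _ w)
    exact h2.mapL (innerSL ℂ (ellBasis (a + b)))
  have hterm : ∀ i, inner ℂ (ellBasis (a + b)) (convMulTerm i u w) =
      (2 : ℂ)⁻¹ ^ i * (u i * ellEmb (fun j => j + i) (add_left_injective i) w (a + b)) := by
    intro i
    rw [← ellBasis_repr _ (a + b), ← ellBasis_repr u i, ← inner_smul_right, ← inner_smul_right]
    rfl
  have hsingle := hasSum_single a (f := fun i =>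
    inner ℂ (ellBasis (a + b)) (convMulTerm i u w)) fun i hi => by
      rw [hterm]
      rcases lt_or_gt_of_ne hi with hlt | hgt
      · have : u i = 0 := by
          by_contra h
          exact Nat.find_min hu' hlt h
        rw [this, zero_mul, mul_zero]
      · rcases le_or_gt i (a + b) with hle | hlt
        · obtain ⟨j, hj⟩ := Nat.exists_eq_add_of_le hle
          have h1 : ellEmb (fun j => j + i) (add_left_injective i) w (a + b) = w j := by
            rw [hj, add_comm i j]
            exact inner_ellBasis_ellEmb (fun j => j + i) _ w j
          have h2 : w j = 0 := by
            by_contra h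
            exact Nat.find_min hw' (show j < b by omega) h
          rw [h1, h2, mul_zero, mul_zero]
        · rw [ellEmb_apply_of_notMem _ _ _ _ fun j => by omega, mul_zero, mul_zero]
  intro h0
  have h1 := hsum.unique hsingle
  rw [h0, inner_zero_right, hterm, add_comm a b,
    inner_ellBasis_ellEmb (fun j => j + a) (add_left_injective a) w b] at h1
  exact mul_ne_zero (pow_ne_zero _ (by norm_num)) (mul_ne_zero hua hwb) h1.symm

/-- The tensor product is realized inside `ℓ²` as the line of products `convMul a b`. -/
theorem exists_isTensorMap {X : Type} [TopologicalSpace X] (f g : C(X, BU 1)) :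
    ∃ h : C(X, BU 1), IsTensorMap f g h := by
  have hex : ∀ P : BU 1, ∃ u ∈ P.1.range, u ≠ 0 := fun P => by
    obtain ⟨F, hF⟩ := exists_isFrame P
    exact ⟨F 0, hF.1 0, hF.2.ne_zero 0⟩
  choose u hu hu0 using fun x => hex (f x)
  choose w hw hw0 using fun x => hex (g x)
  have key : ∀ x, ∀ a ∈ (f x).1.range, ∀ b ∈ (g x).1.range,
      convMul a b ∈ (lineBU _ (convMul_ne_zero (hu0 x) (hw0 x))).1.range := by
    intro x a ha b hb
    obtain ⟨c, rfl⟩ := BU.exists_smul_eq ha (hu x) (hu0 x)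
    obtain ⟨d, rfl⟩ := BU.exists_smul_eq hb (hw x) (hw0 x)
    rw [map_smul, map_smul, smul_apply]
    exact Submodule.smul_mem _ _ (Submodule.smul_mem _ _ (mem_lineBU _ _))
  refine ⟨⟨fun x => lineBU _ (convMul_ne_zero (hu0 x) (hw0 x)), ?_⟩, ContinuousMap.const _ convMul,
    fun x a ha b hb => ⟨key x a ha b hb, convMul_ne_zero⟩⟩
  refine continuous_iff_continuousAt.2 fun x₀ => ?_
  -- The chosen vectors `u x` need not be continuous; near `x₀` they are replaced by the projections
  -- of `u x₀` to `f x`.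
  refine BU.continuousAt_of_range_eq_map (P := g) (A := fun x => convMul ((f x).1 (u x₀)))
    g.continuous.continuousAt (by fun_prop) ?_
  have h1 : ∀ᶠ x in nhds x₀, (f x).1 (u x₀) ≠ 0 := by
    have hc : Continuous fun x => (f x).1 (u x₀) := by fun_prop
    refine hc.continuousAt.eventually_ne ?_
    rw [(f x₀).mem_range_iff.1 (hu x₀)]
    exact hu0 x₀
  filter_upwards [h1] with x hx
  have h2 : ∀ b ∈ (g x).1.range, convMul ((f x).1 (u x₀)) b = 0 → b = 0 := by
    intro b _ hb0
    by_contra h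
    exact convMul_ne_zero hx h hb0
  exact ⟨h2, (BU.map_range_eq fun b hb => ⟨key x _ ((f x).apply_mem _) b hb, h2 b hb⟩).symm⟩

/-! ### The group structures -/

theorem htpyClass_eq_iff {X Y : Type} [TopologicalSpace X] [TopologicalSpace Y] {f g : C(X, Y)} :
    htpyClass f = htpyClass g ↔ Homotopic f g :=
  ⟨fun h => Quotient.exact h, fun h => Quotient.sound h⟩

theorem htpyClass_surjective {X Y : Type} [TopologicalSpace X] [TopologicalSpace Y] :
    Function.Surjective (htpyClass (X := X) (Y := Y)) := Quotient.exists_rep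

theorem mooreDegree_eq_of_homotopic {p n : ℕ} {f g : C(MooreSpace p, BU n)} (h : Homotopic f g) :
    mooreDegree f = mooreDegree g :=
  (Homotopic.bundleIso h).mooreDegree_eq

section Group

variable {X : Type} [TopologicalSpace X] {p : ℕ}

/-- The degree of a bundle, measured along a map from a Moore space. -/
noncomputable def classDegree (j : C(MooreSpace p, X)) {n : ℕ} :
    HtpyClasses X (BU n) → ZMod p :=
  Quotient.lift (fun f : C(X, BU n) => mooreDegree (f.comp j)) fun _ _ h =>
    mooreDegree_eq_of_homotopic (Homotopic.comp h (Homotopic.refl j))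

theorem classDegree_htpyClass (j : C(MooreSpace p, X)) {n : ℕ} (f : C(X, BU n)) :
    classDegree j (htpyClass f) = mooreDegree (f.comp j) := rfl

theorem classDegree_classSum (j : C(MooreSpace p, X)) {m n : ℕ} (α : HtpyClasses X (BU m))
    (β : HtpyClasses X (BU n)) :
    classDegree j (classSum α β) = classDegree j α + classDegree j β := by
  obtain ⟨f, rfl⟩ := htpyClass_surjective α
  obtain ⟨g, rfl⟩ := htpyClass_surjective β
  exact mooreDegree_bundleSum (f.comp j) (g.comp j)

theorem classDegree_trivialClass (j : C(MooreSpace p, X)) (n : ℕ) :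
    classDegree j (trivialClass X n) = 0 :=
  mooreDegree_trivialBundle

theorem classDegree_of_isTensorProd (j : C(MooreSpace p, X)) {α β γ : HtpyClasses X (BU 1)}
    (h : IsTensorProd α β γ) : classDegree j γ = classDegree j α + classDegree j β := by
  obtain ⟨f, g, h, rfl, rfl, rfl, B, hB⟩ := h
  exact mooreDegree_of_isTensorMap ⟨B.comp j, fun x => hB (j x)⟩

/-- Degrees are additive for either operation, and injectivity turns equal degrees into equal
classes. Injectivity is assumed in every rank because stable sums are compared in rank `2 n`, where
no further stabilization is needed. -/
theorem classDegree_eq_add_iff (j : C(MooreSpace p, X))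
    (hinj : ∀ m, 1 ≤ m → Function.Injective (classDegree j (n := m))) {n : ℕ} (hn : 1 ≤ n)
    (α β γ : HtpyClasses X (BU n)) :
    classDegree j γ = classDegree j α + classDegree j β ↔ IsClassAdd n α β γ := by
  obtain rfl | hn1 := eq_or_ne n 1
  · refine ⟨fun h => ?_, classDegree_of_isTensorProd j⟩
    obtain ⟨f, rfl⟩ := htpyClass_surjective α
    obtain ⟨g, rfl⟩ := htpyClass_surjective β
    obtain ⟨t, ht⟩ := exists_isTensorMap f g
    refine ⟨f, g, t, rfl, rfl, hinj 1 le_rfl ?_, ht⟩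
    rw [h]
    exact classDegree_of_isTensorProd j ⟨f, g, t, rfl, rfl, rfl, ht⟩
  · have hadd : IsClassAdd n α β γ = IsStableSum α β γ := by
      match n, hn1 with
      | 0, _ => rfl
      | 1, h => exact absurd rfl h
      | _ + 2, _ => rfl
    have hsum : ∀ k, classDegree j (classSum (classSum α β) (trivialClass X k)) =
        classDegree j (classSum (classSum γ (trivialClass X n)) (trivialClass X k)) ↔
        classDegree j γ = classDegree j α + classDegree j β := by
      intro k
      simp only [classDegree_classSum, classDegree_trivialClass, add_zero]
      exact eq_comm
    rw [hadd]
    constructor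
    · exact fun h => ⟨0, hinj _ (by omega) ((hsum 0).2 h)⟩
    · rintro ⟨k, hk⟩
      exact (hsum k).1 (congrArg (classDegree j) hk)

theorem exists_bundleGroup (j : C(MooreSpace p, X))
    (hinj : ∀ m, 1 ≤ m → Function.Injective (classDegree j (n := m))) {n : ℕ} (hn : 1 ≤ n)
    (hsurj : Function.Surjective (classDegree j (n := n))) :
    ∃ (_ : AddCommGroup (HtpyClasses X (BU n))) (e : HtpyClasses X (BU n) ≃+ ZMod p),
      IsBundleGroup X n ∧ ∀ α, e α = classDegree j α := by
  let e := Equiv.ofBijective (classDegree j (n := n)) ⟨hinj n hn, hsurj⟩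
  refine ⟨e.addCommGroup, @Equiv.addEquiv _ _ e _, ?_, fun _ => rfl⟩
  intro α β γ
  rw [← classDegree_eq_add_iff j hinj hn, ← (hinj n hn).eq_iff]
  refine Eq.congr_right ?_
  exact e.apply_symm_apply _

end Group

theorem classDegree_moore_injective {p n : ℕ} (hn : 1 ≤ n) :
    Function.Injective (classDegree (ContinuousMap.id (MooreSpace p)) (n := n)) := by
  intro α β h
  obtain ⟨f, rfl⟩ := htpyClass_surjective α
  obtain ⟨g, rfl⟩ := htpyClass_surjective β
  exact htpyClass_eq_iff.2 (homotopic_of_mooreDegree_eq hn h)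

theorem classDegree_moore_surjective {p n : ℕ} (hn : 1 ≤ n) :
    Function.Surjective (classDegree (ContinuousMap.id (MooreSpace p)) (n := n)) := by
  intro d
  obtain ⟨f, hf⟩ := exists_mooreDegree_eq hn d
  exact ⟨htpyClass f, hf⟩

/-! ### The sphere -/

theorem pinchMap_mooreMk {p : ℕ} (z : DiscTwo) : pinchMap p (mooreMk p z) = discToSphereTwo z :=
  rfl

/-- For `p = 0` the frame over the circle enters only through `G 1`. The pinch map collapses the
circle for every `p`, so the same disc frame and the constant frame `G 1` give the same clutching
function. -/
theorem HasDeg.pinchMap {n : ℕ} {f : C(SphereTwo, BU n)} {k : ℤ}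
    (h : HasDeg (f.comp (pinchMap 0)) k) (p : ℕ) : HasDeg (f.comp (pinchMap p)) k := by
  obtain ⟨F, G, hF, hG, hφ⟩ := h
  refine ⟨F, ContinuousMap.const _ (G 1), hF, fun w => ?_, by simpa using hφ⟩
  obtain ⟨z, hz⟩ := exists_mooreCircle_eq (p := p) w
  have h1 := isFrame_pow hG z
  rw [pow_zero] at h1
  rw [ContinuousMap.comp_apply, hz, pinchMap_mooreMk]
  exact h1

/-- As `ZMod 0` is `ℤ`, the cast is reduction mod `p`; this is the content of (b). -/
theorem mooreDegree_pinchMap {n : ℕ} (f : C(SphereTwo, BU n)) (p : ℕ) :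
    mooreDegree (f.comp (pinchMap p)) = Int.cast (mooreDegree (f.comp (pinchMap 0))) := by
  obtain ⟨k, hk⟩ := exists_hasDeg (f.comp (pinchMap 0))
  rw [(hk.pinchMap p).mooreDegree_eq, hk.mooreDegree_eq]
  rfl

theorem discToSphereTwo_surjective : Function.Surjective discToSphereTwo := by
  intro y
  have hy := mem_sphere_zero_iff_norm.1 y.2
  rw [EuclideanSpace.norm_eq, Real.sqrt_eq_one, Fin.sum_univ_three] at hy
  simp only [Real.norm_eq_abs, sq_abs] at hy
  set a := y.1 0
  set b := y.1 1
  set c := y.1 2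
  obtain ⟨z, hz, hre, him, hn⟩ : ∃ z : ℂ, ‖z‖ ≤ 1 ∧ 2 * √(1 - ‖z‖ ^ 2) * z.re = a ∧
      2 * √(1 - ‖z‖ ^ 2) * z.im = b ∧ 2 * ‖z‖ ^ 2 - 1 = c := by
    by_cases hc : c = 1
    · rw [hc] at hy
      have ha : a = 0 := by nlinarith [sq_nonneg a, sq_nonneg b]
      have hb : b = 0 := by nlinarith [sq_nonneg a, sq_nonneg b]
      exact ⟨1, by simp, by simp [ha], by simp [hb], by rw [norm_one, hc]; norm_num⟩
    · have hc1 : c < 1 := lt_of_le_of_ne (by nlinarith [sq_nonneg a, sq_nonneg b]) hc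
      have hc2 : -1 ≤ c := by nlinarith [sq_nonneg a, sq_nonneg b]
      -- Here `s` is the value `√(1 - |z|²)` forced by `2 |z|² - 1 = c`, and the first two
      -- coordinates then determine `z`.
      obtain ⟨s, hs0, hs⟩ : ∃ s : ℝ, 0 < s ∧ s ^ 2 = (1 - c) / 2 :=
        ⟨√((1 - c) / 2), Real.sqrt_pos.2 (by linarith), Real.sq_sqrt (by linarith)⟩
      have hnorm : ‖(⟨a / (2 * s), b / (2 * s)⟩ : ℂ)‖ ^ 2 = (1 + c) / 2 := by
        rw [Complex.sq_norm, Complex.normSq_apply]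
        field_simp
        rw [hs]
        nlinarith
      have hsq : √(1 - ‖(⟨a / (2 * s), b / (2 * s)⟩ : ℂ)‖ ^ 2) = s := by
        rw [hnorm, Real.sqrt_eq_iff_mul_self_eq_of_pos hs0]
        nlinarith
      refine ⟨⟨a / (2 * s), b / (2 * s)⟩, ?_, ?_, ?_, ?_⟩
      · rw [← sq_le_one_iff₀ (norm_nonneg _), hnorm]
        linarith
      · rw [hsq]
        field_simp
      · rw [hsq]
        field_simp
      · rw [hnorm]
        ring
  refine ⟨⟨z, mem_closedBall_zero_iff.2 hz⟩, Subtype.ext ?_⟩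
  ext i
  fin_cases i
  exacts [hre, him, hn]

theorem discToSphereTwo_eq {z w : DiscTwo} (h : discToSphereTwo z = discToSphereTwo w) :
    z = w ∨ (‖z.1‖ = 1 ∧ ‖w.1‖ = 1) := by
  have h0 : 2 * √(1 - ‖z.1‖ ^ 2) * z.1.re = 2 * √(1 - ‖w.1‖ ^ 2) * w.1.re :=
    congrArg (fun y : SphereTwo => y.1 0) h
  have h1 : 2 * √(1 - ‖z.1‖ ^ 2) * z.1.im = 2 * √(1 - ‖w.1‖ ^ 2) * w.1.im :=
    congrArg (fun y : SphereTwo => y.1 1) h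
  have h2 : 2 * ‖z.1‖ ^ 2 - 1 = 2 * ‖w.1‖ ^ 2 - 1 := congrArg (fun y : SphereTwo => y.1 2) h
  have h3 : ‖z.1‖ = ‖w.1‖ :=
    (sq_eq_sq₀ (norm_nonneg _) (norm_nonneg _)).1 (by linarith)
  rcases eq_or_lt_of_le z.norm_le with hz | hz
  · exact Or.inr ⟨hz, h3 ▸ hz⟩
  · left
    rw [← h3] at h0 h1
    have hs : 2 * √(1 - ‖z.1‖ ^ 2) ≠ 0 := by
      have : 0 < √(1 - ‖z.1‖ ^ 2) := Real.sqrt_pos.2 (by nlinarith [norm_nonneg z.1])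
      positivity
    exact Subtype.ext (Complex.ext (mul_left_cancel₀ hs h0) (mul_left_cancel₀ hs h1))

/-- The sphere is the Moore space of the constant map of the circle. -/
noncomputable def pinchHomeomorph : MooreSpace 0 ≃ₜ SphereTwo := by
  refine Continuous.homeoOfEquivCompactToT2 (f := Equiv.ofBijective (pinchMap 0) ⟨?_, ?_⟩)
    (pinchMap 0).continuous
  · intro x y
    refine Quotient.inductionOn₂ x y fun z w h => ?_
    rcases discToSphereTwo_eq h with rfl | ⟨h1, h2⟩
    · rfl
    · exact Quotient.sound (Or.inr ⟨h1, h2, by simp⟩)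
  · intro y
    obtain ⟨z, hz⟩ := discToSphereTwo_surjective y
    exact ⟨mooreMk 0 z, hz⟩

theorem classDegree_sphere_injective {n : ℕ} (hn : 1 ≤ n) :
    Function.Injective (classDegree (pinchMap 0) (n := n)) := by
  intro α β h
  obtain ⟨f, rfl⟩ := htpyClass_surjective α
  obtain ⟨g, rfl⟩ := htpyClass_surjective β
  have h1 := Homotopic.comp (homotopic_of_mooreDegree_eq hn h)
    (Homotopic.refl (pinchHomeomorph.symm : C(SphereTwo, MooreSpace 0)))
  have h2 : ∀ f : C(SphereTwo, BU n), (f.comp (pinchMap 0)).comp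
      (pinchHomeomorph.symm : C(SphereTwo, MooreSpace 0)) = f := fun f => by
    ext1 x
    exact congrArg f (pinchHomeomorph.apply_symm_apply x)
  rw [h2, h2] at h1
  exact htpyClass_eq_iff.2 h1

theorem classDegree_sphere_surjective {n : ℕ} (hn : 1 ≤ n) :
    Function.Surjective (classDegree (pinchMap 0) (n := n)) := by
  intro d
  obtain ⟨f, hf⟩ := exists_mooreDegree_eq hn d
  refine ⟨htpyClass (f.comp (pinchHomeomorph.symm : C(SphereTwo, MooreSpace 0))), ?_⟩
  rw [classDegree_htpyClass, ← hf]
  congr 1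
  ext1 x
  exact congrArg f (pinchHomeomorph.symm_apply_apply x)

/-! ### The cell structure of the lens space -/

/-- The point `e^{2πit/p}` of the circle. -/
noncomputable def lensExp (p : ℕ) (t : ℝ) : ℂ := Complex.exp (2 * Real.pi * Complex.I * t / p)

theorem lensExp_add (p : ℕ) (s t : ℝ) : lensExp p (s + t) = lensExp p s * lensExp p t := by
  rw [lensExp, lensExp, lensExp, ← Complex.exp_add]
  push_cast
  ring_nf

theorem lensExp_zero (p : ℕ) : lensExp p 0 = 1 := by simp [lensExp]

theorem lensExp_ne_zero (p : ℕ) (t : ℝ) : lensExp p t ≠ 0 := Complex.exp_ne_zero _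

theorem norm_lensExp (p : ℕ) (t : ℝ) : ‖lensExp p t‖ = 1 := by
  have h : 2 * Real.pi * Complex.I * t / p = ((2 * Real.pi * t / p : ℝ) : ℂ) * Complex.I := by
    push_cast
    ring
  rw [lensExp, h, Complex.norm_exp_ofReal_mul_I]

theorem lensExp_nat_mul (p m : ℕ) (t : ℝ) : lensExp p (m * t) = lensExp p t ^ m := by
  rw [lensExp, lensExp, ← Complex.exp_nat_mul]
  push_cast
  ring_nf

theorem conj_lensExp (p : ℕ) (t : ℝ) : (starRingEnd ℂ) (lensExp p t) = lensExp p (-t) := by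
  rw [lensExp, lensExp, ← Complex.exp_conj]
  simp [Complex.conj_ofNat]

theorem lensExp_eq_one_iff {p : ℕ} (hp : 2 ≤ p) {t : ℝ} :
    lensExp p t = 1 ↔ ∃ m : ℤ, t = m * p := by
  have hp0 : (p : ℂ) ≠ 0 := by
    rw [Nat.cast_ne_zero]; omega
  rw [lensExp, Complex.exp_eq_one_iff]
  refine exists_congr fun m => ?_
  have hpi : (2 * Real.pi * Complex.I : ℂ) ≠ 0 := Complex.two_pi_I_ne_zero
  rw [mul_div_assoc, mul_comm (m : ℂ), mul_right_inj' hpi, div_eq_iff hp0]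
  constructor
  · intro h
    exact_mod_cast h
  · intro h
    exact_mod_cast h

theorem lensExp_int_eq_one_iff {p : ℕ} (hp : 2 ≤ p) {k : ℤ} :
    lensExp p k = 1 ↔ (p : ℤ) ∣ k := by
  rw [lensExp_eq_one_iff hp]
  constructor
  · rintro ⟨m, hm⟩
    exact ⟨m, by rw [mul_comm]; exact_mod_cast hm⟩
  · rintro ⟨m, rfl⟩
    exact ⟨m, by push_cast; ring⟩

theorem exists_eq_lensExp_mul {p : ℕ} (hp : 2 ≤ p) {z w : ℂ} (hz : z ≠ 0) (h : w ^ p = z ^ p) :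
    ∃ k : ℤ, w = lensExp p k * z := by
  have : NeZero p := ⟨by omega⟩
  have hζ : (w / z) ^ p = 1 := by rw [div_pow, h, div_self (pow_ne_zero _ hz)]
  obtain ⟨k, -, hk⟩ := (Complex.isPrimitiveRoot_exp p (NeZero.ne p)).eq_pow_of_pow_eq_one hζ
  refine ⟨k, ?_⟩
  rw [← div_eq_iff hz, ← hk, lensExp, ← Complex.exp_nat_mul]
  push_cast
  ring_nf

/-- The quotient map from the sphere to the lens space. -/
def lensMk (p : ℕ) (q : ℤ) : C(SphereThree, LensSpace p q) :=
  ⟨Quotient.mk _, continuous_quotient_mk'⟩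

theorem lensMk_eq_iff {p : ℕ} {q : ℤ} {x y : SphereThree} :
    lensMk p q x = lensMk p q y ↔
      ∃ k : ℤ, y.1 0 = lensExp p k * x.1 0 ∧ y.1 1 = lensExp p (q * k) * x.1 1 := by
  have h : (lensMk p q x = lensMk p q y) ↔
      ∃ k : ℤ, y.1 0 = Complex.exp (2 * Real.pi * Complex.I * k / p) * x.1 0 ∧
        y.1 1 = Complex.exp (2 * Real.pi * Complex.I * (q * k) / p) * x.1 1 := Quotient.eq
  rw [h]
  simp [lensExp]

theorem exists_inverse_mod {p : ℕ} {q : ℤ} (hp : 2 ≤ p) (hq : IsCoprime (p : ℤ) q) :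
    ∃ r : ℕ, 1 ≤ r ∧ (p : ℤ) ∣ q * r - 1 := by
  obtain ⟨a, b, hab⟩ := hq
  have hp0 : (p : ℤ) ≠ 0 := by omega
  -- The inverse of `q` serves as an exponent in `hopfMap`; adding `p` makes it positive.
  refine ⟨(b % p).toNat + p, by omega, ?_⟩
  have h1 : ((b % p).toNat : ℤ) = b % p := Int.toNat_of_nonneg (Int.emod_nonneg b hp0)
  have h2 := Int.emod_add_mul_ediv b p
  refine ⟨q - a - q * (b / p), ?_⟩
  push_cast
  rw [h1]
  linear_combination q * h2 + hab

theorem exists_mul_sub_dvd {p : ℕ} {q : ℤ} (hq : IsCoprime (p : ℤ) q) (m : ℤ) :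
    ∃ k : ℤ, (p : ℤ) ∣ q * k - m := by
  obtain ⟨a, b, hab⟩ := hq
  exact ⟨b * m, -a * m, by linear_combination m * hab⟩

theorem sphereThree_norm (x : SphereThree) : ‖x.1 0‖ ^ 2 + ‖x.1 1‖ ^ 2 = 1 := by
  have h := mem_sphere_zero_iff_norm.1 x.2
  rwa [EuclideanSpace.norm_eq, Real.sqrt_eq_one, Fin.sum_univ_two] at h

/-- Invariant functions which separate the points of the lens space. -/
theorem lensSpace_t2Space {p : ℕ} {q : ℤ} (hp : 2 ≤ p) (hq : IsCoprime (p : ℤ) q) :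
    T2Space (LensSpace p q) := by
  have hp0 : (p : ℤ) ≠ 0 := by omega
  obtain ⟨m, hm⟩ : ∃ m : ℕ, (p : ℤ) ∣ m - q := by
    refine ⟨(q % p).toNat, -(q / p), ?_⟩
    rw [Int.toNat_of_nonneg (Int.emod_nonneg q hp0)]
    linear_combination Int.emod_add_mul_ediv q p
  have hmq : ∀ k : ℤ, lensExp p (m * k) = lensExp p (q * k) := by
    intro k
    have h1 : lensExp p ((m - q) * k) = 1 := by
      have := (lensExp_int_eq_one_iff hp (k := (m - q) * k)).2 (hm.mul_right k)
      simpa using this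
    have h2 := lensExp_add p ((m - q) * k) (q * k)
    rw [h1, one_mul, ← add_mul, sub_add_cancel] at h2
    exact h2
  have hpow : ∀ k : ℤ, lensExp p k ^ p = 1 := by
    intro k
    rw [← lensExp_nat_mul, lensExp_eq_one_iff hp]
    exact ⟨k, mul_comm _ _⟩
  have hpow' : ∀ k : ℤ, lensExp p (q * k) ^ p = 1 := by
    intro k
    simpa using hpow (q * k)
  have hconj : ∀ k : ℤ, lensExp p (q * k) * (starRingEnd ℂ) (lensExp p k) ^ m = 1 := by
    intro k
    rw [conj_lensExp, ← lensExp_nat_mul, ← hmq, ← lensExp_add, mul_neg, add_neg_cancel,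
      lensExp_zero]
  -- The `p`-th powers determine each coordinate up to a root of unity; the third function, with `m
  -- ≡ q` mod `p`, ties the two roots together.
  let φ : SphereThree → ℂ × ℂ × ℂ := fun x =>
    (x.1 0 ^ p, x.1 1 ^ p, x.1 1 * (starRingEnd ℂ) (x.1 0) ^ m)
  have hφ : Continuous φ := by fun_prop
  have hφ' : ∀ x y, (lensSetoid p q).r x y → φ x = φ y := by
    intro x y hxy
    obtain ⟨k, h0, h1⟩ := lensMk_eq_iff.1 (Quotient.sound hxy : lensMk p q x = lensMk p q y)
    simp only [φ, h0, h1, mul_pow, hpow, hpow', one_mul, map_mul]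
    congr 2
    linear_combination (-(x.1 1 * (starRingEnd ℂ) (x.1 0) ^ m)) * hconj k
  refine T2Space.of_injective_continuous (f := Quotient.lift φ hφ') ?_ (hφ.quotient_lift hφ')
  intro x y
  refine Quotient.inductionOn₂ x y fun x y h => lensMk_eq_iff.2 ?_
  replace h : φ x = φ y := h
  simp only [φ, Prod.mk.injEq] at h
  obtain ⟨h0, h1, h2⟩ := h
  -- If the first coordinate vanishes, the third invariant carries no information, and invertibility
  -- of `q` mod `p` supplies the group element.
  by_cases hx : x.1 0 = 0
  · have hy : y.1 0 = 0 := by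
      rw [hx, zero_pow (by omega)] at h0
      exact pow_eq_zero_iff (by omega) |>.1 h0.symm
    have hx1 : x.1 1 ≠ 0 := by
      intro h
      have := sphereThree_norm x
      simp [hx, h] at this
    obtain ⟨j, hj⟩ := exists_eq_lensExp_mul hp hx1 h1.symm
    obtain ⟨k, hk⟩ := exists_mul_sub_dvd hq j
    refine ⟨k, by rw [hx, hy, mul_zero], ?_⟩
    rw [hj]
    have h3 := lensExp_add p (q * k - j) j
    have h4 := (lensExp_int_eq_one_iff hp).2 hk
    push_cast at h4
    rw [h4, one_mul, sub_add_cancel] at h3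
    rw [h3]
  · obtain ⟨k, hk⟩ := exists_eq_lensExp_mul hp hx h0.symm
    refine ⟨k, hk, ?_⟩
    rw [hk, map_mul, mul_pow] at h2
    have hx' : (starRingEnd ℂ) (x.1 0) ^ m ≠ 0 := pow_ne_zero _ (by simpa using hx)
    have h3 : x.1 1 = y.1 1 * (starRingEnd ℂ) (lensExp p k) ^ m :=
      mul_right_cancel₀ hx' (by rw [h2]; ring)
    rw [h3]
    linear_combination (-(y.1 1)) * hconj k

/-- The cylinder, which parametrizes the top cell of the lens space. -/
abbrev Cyl : Type := DiscTwo × I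

/-- The boundary of the cylinder. -/
def cylBoundary : Set Cyl := {x | ‖x.1.1‖ = 1 ∨ x.2 = 0 ∨ x.2 = 1}

theorem isClosed_cylBoundary : IsClosed cylBoundary :=
  (isClosed_eq (by fun_prop) continuous_const).union
    ((isClosed_eq (by fun_prop) continuous_const).union
      (isClosed_eq (by fun_prop) continuous_const))

/-- The map `(z, s) ↦ (z, √(1 - |z|²) e^{2πis/p})`. -/
noncomputable def cylToSphere (p : ℕ) : C(Cyl, SphereThree) where
  toFun x := ⟨!₂[x.1.1, (Real.sqrt (1 - ‖x.1.1‖ ^ 2) : ℂ) * lensExp p x.2], by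
    simp [EuclideanSpace.norm_eq, DiscTwo.sq_sqrt, norm_lensExp]⟩
  continuous_toFun := by
    refine Continuous.subtype_mk ?_ _
    refine (PiLp.continuous_toLp 2 _).comp (continuous_pi fun i => ?_)
    fin_cases i
    · exact continuous_subtype_val.comp continuous_fst
    · change Continuous fun x : Cyl => (Real.sqrt (1 - ‖x.1.1‖ ^ 2) : ℂ) * lensExp p x.2
      unfold lensExp
      fun_prop

theorem cylToSphere_zero (p : ℕ) (x : Cyl) : (cylToSphere p x).1 0 = x.1.1 := rfl

theorem cylToSphere_one (p : ℕ) (x : Cyl) :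
    (cylToSphere p x).1 1 = (Real.sqrt (1 - ‖x.1.1‖ ^ 2) : ℂ) * lensExp p x.2 := rfl

/-- The characteristic map of the top cell of the lens space. -/
noncomputable def lensCell (p : ℕ) (q : ℤ) : C(Cyl, LensSpace p q) :=
  (lensMk p q).comp (cylToSphere p)

/-- Comparing second coordinates, the radius cancels unless it is zero, and the heights then differ
by `q k` modulo `p`. -/
theorem lensCell_eq {p : ℕ} {q : ℤ} (hp : 2 ≤ p) {x y : Cyl}
    (h : lensCell p q x = lensCell p q y) :
    ∃ k : ℤ, y.1.1 = lensExp p k * x.1.1 ∧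
      ((‖x.1.1‖ = 1 ∧ ‖y.1.1‖ = 1) ∨ ∃ m : ℤ, (y.2 : ℝ) - x.2 = q * k + m * p) := by
  obtain ⟨k, h0, h1⟩ := lensMk_eq_iff.1 h
  rw [cylToSphere_zero, cylToSphere_zero] at h0
  rw [cylToSphere_one, cylToSphere_one] at h1
  refine ⟨k, h0, ?_⟩
  have hn : ‖y.1.1‖ = ‖x.1.1‖ := by rw [h0, norm_mul, norm_lensExp, one_mul]
  rcases eq_or_lt_of_le x.1.norm_le with hx | hx
  · exact Or.inl ⟨hx, hn.trans hx⟩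
  · right
    have hs : (Real.sqrt (1 - ‖x.1.1‖ ^ 2) : ℂ) ≠ 0 := by
      have : 0 < Real.sqrt (1 - ‖x.1.1‖ ^ 2) :=
        Real.sqrt_pos.2 (by nlinarith [norm_nonneg x.1.1])
      exact_mod_cast this.ne'
    rw [hn, mul_left_comm] at h1
    have h2 := mul_left_cancel₀ hs h1
    rw [← lensExp_add] at h2
    have h3 : lensExp p (y.2 - (q * k + x.2)) = 1 := by
      have h4 := lensExp_add p (y.2 - (q * k + x.2)) (q * k + x.2)
      rw [sub_add_cancel, h2] at h4
      exact mul_right_cancel₀ (lensExp_ne_zero p (q * k + x.2)) (by rw [one_mul, ← h4])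
    obtain ⟨m, hm⟩ := (lensExp_eq_one_iff hp).1 h3
    exact ⟨m, by linarith⟩

theorem lensExp_eq_one_of_mul {p : ℕ} {q k m : ℤ} (hp : 2 ≤ p) (hq : IsCoprime (p : ℤ) q)
    (h : (0 : ℝ) = q * k + m * p) : lensExp p k = 1 := by
  rw [lensExp_int_eq_one_iff hp]
  refine hq.dvd_of_dvd_mul_left ⟨-m, ?_⟩
  have h1 : (0 : ℤ) = q * k + m * p := by exact_mod_cast h
  linarith

/-- Away from the side, identified points have heights in `[0, 1]` that differ by an integer.
Difference `0` forces `p ∣ k`, hence equal points; difference `±1` puts them on opposite ends. -/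
theorem lensCell_injOn {p : ℕ} {q : ℤ} (hp : 2 ≤ p) (hq : IsCoprime (p : ℤ) q) (x y : Cyl)
    (h : lensCell p q x = lensCell p q y) : x = y ∨ (x ∈ cylBoundary ∧ y ∈ cylBoundary) := by
  obtain ⟨k, h0, ⟨h1, h2⟩ | ⟨m, hm⟩⟩ := lensCell_eq hp h
  · exact Or.inr ⟨Or.inl h1, Or.inl h2⟩
  · have hx := x.2.2
    have hy := y.2.2
    have h3 : (y.2 : ℝ) - x.2 = (q * k + m * p : ℤ) := by rw [hm]; push_cast; ring
    have h4 : -1 ≤ q * k + m * p := by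
      have : (-1 : ℝ) ≤ (q * k + m * p : ℤ) := by rw [← h3]; linarith [hx.2, hy.1]
      exact_mod_cast this
    have h5 : q * k + m * p ≤ 1 := by
      have : ((q * k + m * p : ℤ) : ℝ) ≤ 1 := by rw [← h3]; linarith [hx.1, hy.2]
      exact_mod_cast this
    obtain h6 | h6 | h6 : q * k + m * p = -1 ∨ q * k + m * p = 0 ∨ q * k + m * p = 1 := by omega
    · right
      rw [h6] at h3
      push_cast at h3
      exact ⟨Or.inr (Or.inr (Subtype.ext (by push_cast; linarith [hx.2, hy.1]))),
        Or.inr (Or.inl (Subtype.ext (by push_cast; linarith [hx.2, hy.1])))⟩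
    · left
      rw [h6] at h3
      have h7 := lensExp_eq_one_of_mul (k := k) (m := m) hp hq (by exact_mod_cast h6.symm)
      rw [h7, one_mul] at h0
      refine Prod.ext (Subtype.ext h0.symm) (Subtype.ext ?_)
      push_cast at h3
      linarith
    · right
      rw [h6] at h3
      push_cast at h3
      exact ⟨Or.inr (Or.inl (Subtype.ext (by push_cast; linarith [hx.1, hy.2]))),
        Or.inr (Or.inr (Subtype.ext (by push_cast; linarith [hx.1, hy.2])))⟩

theorem lensCell_surjective {p : ℕ} {q : ℤ} (hp : 2 ≤ p) (hq : IsCoprime (p : ℤ) q) :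
    Function.Surjective (lensCell p q) := by
  intro y
  obtain ⟨y, rfl⟩ := Quotient.exists_rep y
  have hp0 : (p : ℝ) ≠ 0 := by
    rw [Nat.cast_ne_zero]; omega
  have hpi := Real.pi_pos
  set t : ℝ := (y.1 1).arg / (2 * Real.pi) * p with ht
  have hy1 : y.1 1 = ‖y.1 1‖ * lensExp p t := by
    conv_lhs => rw [← Complex.norm_mul_exp_arg_mul_I (y.1 1)]
    rw [lensExp, ht]
    congr 2
    have : (p : ℂ) ≠ 0 := by exact_mod_cast hp0
    have : (Real.pi : ℂ) ≠ 0 := by exact_mod_cast hpi.ne'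
    push_cast
    field_simp
  -- `t` is the argument of the second coordinate in units of `2π/p`; this group element rotates it
  -- back to its fractional part.
  obtain ⟨k, hk⟩ := exists_mul_sub_dvd hq (-⌊t⌋)
  have hyn := sphereThree_norm y
  have hz : ‖lensExp p k * y.1 0‖ = ‖y.1 0‖ := by rw [norm_mul, norm_lensExp, one_mul]
  refine ⟨(⟨lensExp p k * y.1 0, mem_closedBall_zero_iff.2 ?_⟩,
    ⟨Int.fract t, Int.fract_nonneg _, (Int.fract_lt_one _).le⟩), ?_⟩
  · rw [hz]
    nlinarith [norm_nonneg (y.1 0), sq_nonneg ‖y.1 1‖]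
  · refine (lensMk_eq_iff.2 ⟨k, rfl, ?_⟩).symm
    rw [cylToSphere_one]
    simp only [hz]
    have hsq : Real.sqrt (1 - ‖y.1 0‖ ^ 2) = ‖y.1 1‖ := by
      rw [← eq_sub_of_add_eq' hyn, Real.sqrt_sq (norm_nonneg _)]
    rw [hsq]
    conv_rhs => rw [hy1]
    rw [mul_left_comm, ← lensExp_add]
    congr 1
    have h1 := (lensExp_int_eq_one_iff hp).2 hk
    have h2 := lensExp_add p ((q * k - -⌊t⌋ : ℤ) : ℝ) (Int.fract t)
    rw [h1, one_mul] at h2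
    rw [← h2]
    congr 1
    push_cast
    linarith [Int.floor_add_fract t]

theorem isQuotientMap_lensCell {p : ℕ} {q : ℤ} (hp : 2 ≤ p) (hq : IsCoprime (p : ℤ) q) :
    Topology.IsQuotientMap (lensCell p q) := by
  have := lensSpace_t2Space hp hq
  exact (lensCell p q).continuous.isClosedMap.isQuotientMap (lensCell p q).continuous
    (lensCell_surjective hp hq)

theorem skeletonIncl_mooreMk {p : ℕ} {q : ℤ} (hp : 2 ≤ p) (z : DiscTwo) :
    skeletonIncl p q hp (mooreMk p z) = lensCell p q (z, 0) := by
  refine congrArg (lensMk p q) (Subtype.ext ?_)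
  ext i
  fin_cases i
  · rfl
  · change _ = (cylToSphere p (z, 0)).1 1
    rw [cylToSphere_one]
    simp [lensExp_zero, discToSphereThree]

theorem skeletonIncl_injective {p : ℕ} {q : ℤ} (hp : 2 ≤ p) (hq : IsCoprime (p : ℤ) q) :
    Function.Injective (skeletonIncl p q hp) := by
  intro x y
  refine Quotient.inductionOn₂ x y fun z w h => ?_
  replace h : lensCell p q (z, 0) = lensCell p q (w, 0) :=
    (skeletonIncl_mooreMk hp z).symm.trans (h.trans (skeletonIncl_mooreMk hp w))
  obtain ⟨k, h0, ⟨h1, h2⟩ | ⟨m, hm⟩⟩ := lensCell_eq hp h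
  · refine Quotient.sound (Or.inr ⟨h1, h2, ?_⟩)
    rw [show w.1 = lensExp p k * z.1 from h0, mul_pow, ← lensExp_nat_mul,
      (lensExp_eq_one_iff hp).2 ⟨k, mul_comm _ _⟩, one_mul]
  · have h7 := lensExp_eq_one_of_mul (k := k) (m := m) hp hq (by simpa using hm)
    rw [h7, one_mul] at h0
    exact congrArg _ (Subtype.ext h0.symm)

/-- The attaching map of the top cell of the lens space. -/
theorem exists_attaching_map {p : ℕ} {q : ℤ} (hp : 2 ≤ p) (hq : IsCoprime (p : ℤ) q) :
    ∃ r : C(cylBoundary, MooreSpace p), ∀ x, skeletonIncl p q hp (r x) = lensCell p q x := by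
  have := lensSpace_t2Space hp hq
  have hemb : Topology.IsClosedEmbedding (skeletonIncl p q hp) :=
    (skeletonIncl p q hp).continuous.isClosedEmbedding (skeletonIncl_injective hp hq)
  have hex : ∀ x : cylBoundary, ∃ y, skeletonIncl p q hp y = lensCell p q x := by
    rintro ⟨⟨z, s⟩, h | h | h⟩
    · refine ⟨mooreMk p z, ?_⟩
      rw [skeletonIncl_mooreMk]
      refine congrArg (lensMk p q) (Subtype.ext ?_)
      ext i
      fin_cases i
      · rfl
      · change (cylToSphere p (z, 0)).1 1 = (cylToSphere p (z, s)).1 1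
        rw [cylToSphere_one, cylToSphere_one]
        simp [show ‖z.1‖ = 1 from h]
    · refine ⟨mooreMk p z, ?_⟩
      exact (skeletonIncl_mooreMk hp z).trans
        (congrArg (fun s => lensCell p q (z, s)) (show s = 0 from h).symm)
    -- The group element with `q k ≡ -1` carries the top disc to the bottom one, rotating `z`.
    · obtain ⟨k, hk⟩ := exists_mul_sub_dvd hq (-1)
      have hz : ‖lensExp p k * z.1‖ = ‖z.1‖ := by rw [norm_mul, norm_lensExp, one_mul]
      refine ⟨mooreMk p ⟨lensExp p k * z.1, mem_closedBall_zero_iff.2 (hz ▸ z.norm_le)⟩, ?_⟩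
      rw [skeletonIncl_mooreMk]
      refine (lensMk_eq_iff.2 ⟨k, rfl, ?_⟩).symm
      rw [cylToSphere_one, cylToSphere_one]
      simp only [hz, show s = 1 from h]
      rw [mul_left_comm, ← lensExp_add]
      congr 1
      have h1 := (lensExp_int_eq_one_iff hp).2 hk
      push_cast at h1
      simp only [sub_neg_eq_add] at h1
      simp [h1, lensExp_zero]
  choose r hr using hex
  -- The skeleton is embedded, so continuity of `r` can be checked in the lens space.
  refine ⟨⟨r, hemb.isEmbedding.continuous_iff.2 ?_⟩, hr⟩
  have : (skeletonIncl p q hp ∘ r) = fun x : cylBoundary => lensCell p q x := funext hr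
  rw [this]
  fun_prop

/-! ### Bundles on the lens space -/

/-- The retraction of the cylinder onto its bottom and side, by projection from a point above. -/
noncomputable def cylRetract : C(Cyl, cylBoundary) where
  -- The centre of projection is `(0, 2)`. The ray through `x` is stretched by the inverse of the
  -- maximum: it hits the side if `|z| ≥ 1 - s / 2` and the bottom otherwise.
  toFun x := ⟨(⟨x.1.1 / (max ‖x.1.1‖ (1 - (x.2 : ℝ) / 2) : ℝ), by
      have h : 0 < max ‖x.1.1‖ (1 - (x.2 : ℝ) / 2) := lt_max_of_lt_right (by linarith [x.2.2.2])
      rw [mem_closedBall_zero_iff, norm_div, Complex.norm_real, Real.norm_of_nonneg h.le,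
        div_le_one h]
      exact le_max_left _ _⟩,
    ⟨2 - (2 - x.2) / max ‖x.1.1‖ (1 - (x.2 : ℝ) / 2), by
      have h : 0 < max ‖x.1.1‖ (1 - (x.2 : ℝ) / 2) := lt_max_of_lt_right (by linarith [x.2.2.2])
      constructor
      · rw [sub_nonneg, div_le_iff₀ h]
        linarith [le_max_right ‖x.1.1‖ (1 - (x.2 : ℝ) / 2)]
      · rw [sub_le_comm, le_div_iff₀ h]
        have h1 : max ‖x.1.1‖ (1 - (x.2 : ℝ) / 2) ≤ 2 - x.2 :=
          max_le (by linarith [x.1.norm_le, x.2.2.2]) (by linarith [x.2.2.2])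
        linarith⟩), by
    have h : 0 < max ‖x.1.1‖ (1 - (x.2 : ℝ) / 2) := lt_max_of_lt_right (by linarith [x.2.2.2])
    rcases le_total (1 - (x.2 : ℝ) / 2) ‖x.1.1‖ with h1 | h1
    · left
      change ‖x.1.1 / (max ‖x.1.1‖ (1 - (x.2 : ℝ) / 2) : ℝ)‖ = 1
      rw [norm_div, Complex.norm_real, Real.norm_of_nonneg h.le]
      rw [max_eq_left h1] at h ⊢
      exact div_self h.ne'
    · right
      left
      refine Subtype.ext ?_
      change 2 - (2 - (x.2 : ℝ)) / max ‖x.1.1‖ (1 - (x.2 : ℝ) / 2) = 0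
      rw [max_eq_right h1] at h ⊢
      rw [sub_eq_zero, eq_div_iff h.ne']
      ring⟩
  continuous_toFun := by
    have h : ∀ x : Cyl, max ‖x.1.1‖ (1 - (x.2 : ℝ) / 2) ≠ 0 := fun x =>
      (lt_max_of_lt_right (by linarith [x.2.2.2]) : 0 < max ‖x.1.1‖ (1 - (x.2 : ℝ) / 2)).ne'
    have h' : ∀ x : Cyl, ((max ‖x.1.1‖ (1 - (x.2 : ℝ) / 2) : ℝ) : ℂ) ≠ 0 := fun x => by
      exact_mod_cast h x
    refine Continuous.subtype_mk (Continuous.prodMk (Continuous.subtype_mk ?_ _)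
      (Continuous.subtype_mk ?_ _)) _
    · exact Continuous.div (by fun_prop) (by fun_prop) h'
    · exact continuous_const.sub (Continuous.div (by fun_prop) (by fun_prop) h)

theorem cylRetract_eq {x : Cyl} (hx : ‖x.1.1‖ = 1 ∨ x.2 = 0) : (cylRetract x : Cyl) = x := by
  have h1 : max ‖x.1.1‖ (1 - (x.2 : ℝ) / 2) = 1 := by
    rcases hx with hx | hx
    · rw [hx]
      exact max_eq_left (by linarith [x.2.2.1])
    · rw [hx]
      simpa using x.1.norm_le
  refine Prod.ext (Subtype.ext ?_) (Subtype.ext ?_)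
  · change x.1.1 / (max ‖x.1.1‖ (1 - (x.2 : ℝ) / 2) : ℝ) = x.1.1
    rw [h1, Complex.ofReal_one, div_one]
  · change 2 - (2 - (x.2 : ℝ)) / max ‖x.1.1‖ (1 - (x.2 : ℝ) / 2) = x.2
    rw [h1]
    ring

/-- Functions without zeros extend from the boundary of the cylinder to the cylinder. -/
theorem exists_cyl_extension (a : C(cylBoundary, ℂ)) (ha : ∀ x, a x ≠ 0) :
    ∃ b : C(Cyl, ℂ), (∀ x, b x ≠ 0) ∧ ∀ x : cylBoundary, b x = a x := by
  -- This logarithm is correct on the bottom and the side, but not necessarily on the top.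
  obtain ⟨l, hl⟩ := exists_log (a.comp cylRetract) fun _ => ha _
  have hl' : ∀ x : cylBoundary, (‖x.1.1.1‖ = 1 ∨ x.1.2 = 0) → Complex.exp (l x) = a x := by
    intro x hx
    rw [hl]
    exact congrArg a (Subtype.ext (cylRetract_eq hx))
  let top : C(DiscTwo, cylBoundary) := ⟨fun z => ⟨(z, 1), Or.inr (Or.inr rfl)⟩, by fun_prop⟩
  obtain ⟨m, hm⟩ := exists_log
    (⟨fun z => a (top z) * Complex.exp (-l (top z)), by fun_prop⟩ : C(DiscTwo, ℂ))
    fun z => mul_ne_zero (ha _) (Complex.exp_ne_zero _)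
  have hm' : ∀ z, Complex.exp (l (z, 1)) * Complex.exp (m z) = a (top z) := fun z => by
    rw [hm]
    change Complex.exp (l (z, 1)) * (a (top z) * Complex.exp (-l (z, 1))) = _
    rw [Complex.exp_neg]
    field_simp
  have hm1 : ∀ z, Complex.exp (m (circleToDisc z)) = 1 := fun z => by
    have h1 := hm' (circleToDisc z)
    rw [← hl' (top (circleToDisc z)) (Or.inl (Circle.norm_coe z))] at h1
    exact mul_left_cancel₀ (Complex.exp_ne_zero _) (h1.trans (mul_one _).symm)
  -- The correction `m` on the top takes values in `2πiℤ` on the rim, where `l` is already correct,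
  -- so it is constant there.
  have hmc := eq_of_exp_eq (a := fun z => m (circleToDisc z)) (b := fun _ => m (circleToDisc 1))
    (by fun_prop) continuous_const (fun z => (hm1 z).trans (hm1 1).symm) (y₀ := 1) rfl
  -- The correction enters with factor `s`, so it vanishes on the bottom; subtracting the rim value
  -- makes it vanish on the side.
  refine ⟨⟨fun x => Complex.exp (l x + (x.2 : ℝ) * (m x.1 - m (circleToDisc 1))), by fun_prop⟩,
    fun _ => Complex.exp_ne_zero _, ?_⟩
  rintro ⟨⟨z, s⟩, h | h | h⟩
  · have h1 : m z = m (circleToDisc 1) := congrFun hmc (discBoundaryToCircle ⟨z, h⟩)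
    rw [← hl' _ (Or.inl h)]
    change Complex.exp (l (z, s) + (s : ℝ) * (m z - m (circleToDisc 1))) = _
    rw [h1, sub_self, mul_zero, add_zero]
  · obtain rfl : s = 0 := h
    rw [← hl' _ (Or.inr rfl)]
    change Complex.exp (l (z, 0) + ((0 : I) : ℝ) * (m z - m (circleToDisc 1))) =
      Complex.exp (l (z, 0))
    simp
  · obtain rfl : s = 1 := h
    refine Eq.trans ?_ (hm' z)
    change Complex.exp (l (z, 1) + ((1 : I) : ℝ) * (m z - m (circleToDisc 1))) = _
    rw [Complex.exp_add]
    congr 1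
    rw [Set.Icc.coe_one, Complex.ofReal_one, one_mul, Complex.exp_sub, hm1, div_one]

section Lens

variable {p n : ℕ} {q : ℤ}

/-- Along the attaching map the isomorphism over the skeleton becomes, in frames over the cell, a
function without zeros on the boundary of the cylinder. Such functions always extend, so the
`3`-cell gives no obstruction. -/
theorem bundleIso_of_skeleton_one (hp : 2 ≤ p) (hq : IsCoprime (p : ℤ) q)
    {f f' : C(LensSpace p q, BU 1)}
    (h : BundleIso (f.comp (skeletonIncl p q hp)) (f'.comp (skeletonIncl p q hp))) :
    BundleIso f f' := by
  obtain ⟨T, hT⟩ := h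
  obtain ⟨r, hr⟩ := exists_attaching_map hp hq
  obtain ⟨F, hF⟩ := exists_frame (f.comp (lensCell p q))
  obtain ⟨F', hF'⟩ := exists_frame (f'.comp (lensCell p q))
  have hTx : ∀ x : cylBoundary, T (r x) (F x 0) ∈ (f' (lensCell p q x)).1.range ∧
      T (r x) (F x 0) ≠ 0 := by
    intro x
    have h1 := hT (r x) (F x 0) (by
      rw [ContinuousMap.comp_apply, hr]
      exact (hF x).1 0)
    rw [ContinuousMap.comp_apply, hr] at h1
    exact ⟨h1.1, fun h => (hF x).2.ne_zero 0 (h1.2 h)⟩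
  obtain ⟨a, ha⟩ := exists_coords (f := fun x : cylBoundary => f' (lensCell p q x))
    (F := fun x : cylBoundary => F' x) (by fun_prop) (fun x => hF' x)
    (s := fun x => T (r x) (F x 0)) (by fun_prop) fun x => (hTx x).1
  obtain ⟨b, hb0, hba⟩ := exists_cyl_extension ⟨fun x => a x 0, by fun_prop⟩ fun x hx =>
    (hTx x).2 (by
      rw [ha, Fin.sum_univ_one, show a x 0 = 0 from hx, zero_smul])
  classical
  refine bundleIso_of_exp (isQuotientMap_lensCell hp hq) (lensCell_injOn hp hq)
    (F := ⟨fun x => F x 0, by fun_prop⟩) (F' := ⟨fun x => F' x 0, by fun_prop⟩)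
    (fun x => (hF x).1 0) (fun x => (hF x).2.ne_zero 0) (fun x => (hF' x).1 0)
    (fun x => (hF' x).2.ne_zero 0) b hb0
    (fun x => if hx : x ∈ cylBoundary then T (r ⟨x, hx⟩) else 0) ?_ ?_
  · intro x hx
    rw [dif_pos hx]
    refine (ha ⟨x, hx⟩).trans ?_
    rw [Fin.sum_univ_one, ← show b x = a ⟨x, hx⟩ 0 from hba ⟨x, hx⟩]
    rfl
  · intro x hx y hy hxy
    rw [dif_pos hx, dif_pos hy]
    congr 1
    refine skeletonIncl_injective hp hq ?_
    rw [hr, hr]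
    exact hxy

/-- A bundle of rank at least two on the lens space has a section without zeros. -/
theorem exists_section_lens (hp : 2 ≤ p) (hq : IsCoprime (p : ℤ) q) (hn : 2 ≤ n)
    (f : C(LensSpace p q, BU n)) :
    ∃ S : C(LensSpace p q, EllTwo), (∀ x, S x ∈ (f x).1.range) ∧ ∀ x, S x ≠ 0 := by
  obtain ⟨s, hs, hs0⟩ := exists_section_moore hn (f.comp (skeletonIncl p q hp))
  obtain ⟨r, hr⟩ := exists_attaching_map hp hq
  obtain ⟨S, hS, hS0, -⟩ := exists_section_extension (E := ℂ × ℝ) (K := Cyl)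
    ⟨fun x => (x.1.1, x.2.1), by fun_prop⟩
    (fun x y h => Prod.ext (Subtype.ext (congrArg Prod.fst h)) (Subtype.ext (congrArg Prod.snd h)))
    (isQuotientMap_lensCell hp hq) isClosed_cylBoundary (lensCell_injOn hp hq) (n := n)
    (by rw [Module.finrank_prod, Complex.finrank_real_complex, Module.finrank_self]; omega) f
    (s.comp r)
    (fun x => by
      have := hs (r x)
      rw [ContinuousMap.comp_apply, hr] at this
      exact this) (fun _ => hs0 _) fun x y h => by
        refine congrArg s (skeletonIncl_injective hp hq ?_)
        rw [hr, hr]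
        exact h
  exact ⟨S, hS, hS0⟩

theorem homotopic_of_mooreDegree_skeleton_eq (hp : 2 ≤ p) (hq : IsCoprime (p : ℤ) q) (hn : 1 ≤ n)
    {f f' : C(LensSpace p q, BU n)} (h : mooreDegree (f.comp (skeletonIncl p q hp)) =
      mooreDegree (f'.comp (skeletonIncl p q hp))) : Homotopic f f' := by
  induction n, hn using Nat.le_induction with
  | base =>
    exact (bundleIso_of_skeleton_one hp hq (bundleIso_of_mooreDegree_eq_one h)).homotopic
  | succ n hn ih =>
    obtain ⟨s, hs, hs0⟩ := exists_section_lens hp hq (by omega) f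
    obtain ⟨s', hs', hs0'⟩ := exists_section_lens hp hq (by omega) f'
    obtain ⟨g, hg⟩ := exists_bundleSum_of_section f s hs hs0
    obtain ⟨g', hg'⟩ := exists_bundleSum_of_section f' s' hs' hs0'
    have hdeg : mooreDegree (g.comp (skeletonIncl p q hp)) =
        mooreDegree (g'.comp (skeletonIncl p q hp)) := by
      rw [← (hg.comp _).mooreDegree_eq, ← (hg'.comp _).mooreDegree_eq] at h
      have h1 : ∀ g : C(LensSpace p q, BU n),
          (bundleSum g (trivialBundle _ 1)).comp (skeletonIncl p q hp) =
            bundleSum (g.comp (skeletonIncl p q hp)) (trivialBundle _ 1) := fun _ => rfl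
      rw [h1, h1, mooreDegree_bundleSum, mooreDegree_bundleSum] at h
      exact add_right_cancel h
    refine (hg.homotopic.symm.trans ?_).trans hg'.homotopic
    exact Homotopic.comp (Homotopic.refl _) ((ih hdeg).prodMk (Homotopic.refl _))

/-! ### Extension of the pinch map to the lens space. -/

/-- The function `z ↦ |z| (z̄ / |z|) ^ r`. -/
noncomputable def conjPow (r : ℕ) (z : ℂ) : ℂ :=
  (starRingEnd ℂ) z ^ r / (‖z‖ : ℂ) ^ (r - 1)

theorem norm_conjPow {r : ℕ} (hr : 1 ≤ r) (z : ℂ) : ‖conjPow r z‖ = ‖z‖ := by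
  obtain ⟨m, rfl⟩ := Nat.exists_eq_add_of_le' hr
  rw [conjPow, norm_div, norm_pow, norm_pow, Complex.norm_conj, Complex.norm_real, norm_norm,
    Nat.add_sub_cancel]
  rcases eq_or_ne ‖z‖ 0 with h | h
  · simp [h]
  · rw [pow_succ]
    field_simp

theorem continuous_conjPow {r : ℕ} (hr : 1 ≤ r) : Continuous (conjPow r) := by
  refine continuous_iff_continuousAt.2 fun z => ?_
  rcases eq_or_ne z 0 with rfl | hz
  · have h0 : conjPow r 0 = 0 := norm_eq_zero.1 (by rw [norm_conjPow hr, norm_zero])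
    rw [ContinuousAt, h0]
    refine squeeze_zero_norm (fun z => (norm_conjPow hr z).le) ?_
    simpa using (continuous_norm (E := ℂ)).tendsto 0
  · refine ContinuousAt.div (by fun_prop) (by fun_prop) ?_
    simpa using fun h : z = 0 => absurd h hz

theorem conjPow_ofReal {r : ℕ} (hr : 1 ≤ r) {s : ℝ} (hs : 0 ≤ s) : conjPow r s = s := by
  obtain ⟨m, rfl⟩ := Nat.exists_eq_add_of_le' hr
  rw [conjPow, Complex.conj_ofReal, Complex.norm_of_nonneg hs, Nat.add_sub_cancel]
  rcases eq_or_ne s 0 with rfl | h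
  · simp
  · have : (s : ℂ) ≠ 0 := by exact_mod_cast h
    rw [pow_succ]
    field_simp

/-- The map from the sphere `S³` to `S²` which induces the extension of the pinch map. -/
noncomputable def hopfMap (r : ℕ) (hr : 1 ≤ r) : C(SphereThree, SphereTwo) where
  toFun x := ⟨!₂[2 * (x.1 0 * conjPow r (x.1 1)).re, 2 * (x.1 0 * conjPow r (x.1 1)).im,
      2 * ‖x.1 0‖ ^ 2 - 1], by
    have h1 := sphereThree_norm x
    have h2 : (x.1 0 * conjPow r (x.1 1)).re ^ 2 + (x.1 0 * conjPow r (x.1 1)).im ^ 2 =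
        ‖x.1 0‖ ^ 2 * ‖x.1 1‖ ^ 2 := by
      rw [← norm_conjPow hr (x.1 1), ← mul_pow, ← norm_mul, Complex.sq_norm,
        Complex.normSq_apply]
      ring
    rw [mem_sphere_zero_iff_norm, EuclideanSpace.norm_eq, Real.sqrt_eq_one, Fin.sum_univ_three]
    simp only [Real.norm_eq_abs, sq_abs]
    change (2 * (x.1 0 * conjPow r (x.1 1)).re) ^ 2 + (2 * (x.1 0 * conjPow r (x.1 1)).im) ^ 2 +
      (2 * ‖x.1 0‖ ^ 2 - 1) ^ 2 = 1
    linear_combination 4 * h2 + 4 * ‖x.1 0‖ ^ 2 * h1⟩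
  continuous_toFun := by
    have h := continuous_conjPow hr
    have h1 : Continuous fun x : SphereThree => x.1 0 * conjPow r (x.1 1) := by fun_prop
    refine Continuous.subtype_mk ?_ _
    refine (PiLp.continuous_toLp 2 _).comp (continuous_pi fun i => ?_)
    fin_cases i
    · exact continuous_const.mul (Complex.continuous_re.comp h1)
    · exact continuous_const.mul (Complex.continuous_im.comp h1)
    · change Continuous fun x : SphereThree => 2 * ‖x.1 0‖ ^ 2 - 1
      fun_prop

/-- With `q r ≡ 1` mod `p`, the rotation of `z₀` cancels that of `conjPow r z₁`, so `hopfMap` is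
invariant. On the skeleton `z₁` is real and nonnegative, `conjPow` fixes it, and the formula becomes
that of the pinch map. -/
theorem exists_pinch_extension (hp : 2 ≤ p) (hq : IsCoprime (p : ℤ) q) :
    ∃ πbar : C(LensSpace p q, SphereTwo), πbar.comp (skeletonIncl p q hp) = pinchMap p := by
  obtain ⟨r, hr, hqr⟩ := exists_inverse_mod hp hq
  have hinv : ∀ k : ℤ, lensExp p k * (starRingEnd ℂ) (lensExp p (q * k)) ^ r = 1 := by
    intro k
    rw [conj_lensExp, ← lensExp_nat_mul, ← lensExp_add]
    have h := (lensExp_int_eq_one_iff hp (k := (q * r - 1) * -k)).2 (hqr.mul_right _)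
    rw [← h]
    congr 1
    push_cast
    ring
  have hfac : ∀ x y : SphereThree, (lensSetoid p q).r x y → hopfMap r hr x = hopfMap r hr y := by
    intro x y hxy
    obtain ⟨k, h0, h1⟩ := lensMk_eq_iff.1 (Quotient.sound hxy : lensMk p q x = lensMk p q y)
    have hn : ‖y.1 0‖ = ‖x.1 0‖ := by rw [h0, norm_mul, norm_lensExp, one_mul]
    have hm : y.1 0 * conjPow r (y.1 1) = x.1 0 * conjPow r (x.1 1) := by
      rw [h0, h1, conjPow, conjPow, norm_mul, norm_lensExp, one_mul, map_mul, mul_pow]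
      linear_combination (x.1 0 * ((starRingEnd ℂ) (x.1 1) ^ r /
        (‖x.1 1‖ : ℂ) ^ (r - 1))) * hinv k
    refine Subtype.ext ?_
    simp only [hopfMap, ContinuousMap.coe_mk, hn, hm]
  refine ⟨⟨Quotient.lift (hopfMap r hr) hfac, (hopfMap r hr).continuous.quotient_lift hfac⟩, ?_⟩
  ext1 x
  refine Quotient.inductionOn x fun z => ?_
  refine Subtype.ext ?_
  have h : conjPow r (Real.sqrt (1 - ‖z.1‖ ^ 2) : ℂ) = Real.sqrt (1 - ‖z.1‖ ^ 2) :=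
    conjPow_ofReal hr (Real.sqrt_nonneg _)
  ext i
  fin_cases i
  · change 2 * (z.1 * conjPow r (Real.sqrt (1 - ‖z.1‖ ^ 2) : ℂ)).re =
      2 * Real.sqrt (1 - ‖z.1‖ ^ 2) * z.1.re
    rw [h, Complex.re_mul_ofReal]
    ring
  · change 2 * (z.1 * conjPow r (Real.sqrt (1 - ‖z.1‖ ^ 2) : ℂ)).im =
      2 * Real.sqrt (1 - ‖z.1‖ ^ 2) * z.1.im
    rw [h, Complex.im_mul_ofReal]
    ring
  · rfl

theorem classDegree_lens_injective (hp : 2 ≤ p) (hq : IsCoprime (p : ℤ) q) (hn : 1 ≤ n) :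
    Function.Injective (classDegree (skeletonIncl p q hp) (n := n)) := by
  intro α β h
  obtain ⟨f, rfl⟩ := htpyClass_surjective α
  obtain ⟨g, rfl⟩ := htpyClass_surjective β
  exact htpyClass_eq_iff.2 (homotopic_of_mooreDegree_skeleton_eq hp hq hn h)

/-- All integers are degrees on `S²`; pulling back along an extension of the pinch map reduces them
mod `p`. -/
theorem classDegree_lens_surjective (hp : 2 ≤ p) (hq : IsCoprime (p : ℤ) q) (hn : 1 ≤ n) :
    Function.Surjective (classDegree (skeletonIncl p q hp) (n := n)) := by
  intro d
  obtain ⟨k, rfl⟩ := ZMod.intCast_surjective d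
  obtain ⟨πbar, hπ⟩ := exists_pinch_extension hp hq
  obtain ⟨α, hα⟩ := classDegree_sphere_surjective hn (k : ZMod 0)
  obtain ⟨f, rfl⟩ := htpyClass_surjective α
  refine ⟨htpyClass (f.comp πbar), ?_⟩
  rw [classDegree_htpyClass, ContinuousMap.comp_assoc, hπ, mooreDegree_pinchMap]
  exact congrArg (fun k : ℤ => (k : ZMod p)) hα

end Lens

theorem lemma2p3 (n p : ℕ) (q : ℤ) (hn : 1 ≤ n) (hp : 2 ≤ p) (hq : IsCoprime (p : ℤ) q) :
    ∃ (_ : AddCommGroup (HtpyClasses SphereTwo (BU n)))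
      (_ : AddCommGroup (HtpyClasses (MooreSpace p) (BU n)))
      (_ : AddCommGroup (HtpyClasses (LensSpace p q) (BU n))),
      IsBundleGroup SphereTwo n ∧ IsBundleGroup (MooreSpace p) n ∧
      IsBundleGroup (LensSpace p q) n ∧
      ∃ (eS : HtpyClasses SphereTwo (BU n) ≃+ ℤ)
        (eP : HtpyClasses (MooreSpace p) (BU n) ≃+ ZMod p)
        (r : HtpyClasses (LensSpace p q) (BU n) ≃+ HtpyClasses (MooreSpace p) (BU n)),
        (∀ α, eP (htpyPullback (BU n) (pinchMap p) α) = (eS α : ZMod p)) ∧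
        (∀ α, r α = htpyPullback (BU n) (skeletonIncl p q hp) α) ∧
        (∃ πbar : C(LensSpace p q, SphereTwo), πbar.comp (skeletonIncl p q hp) = pinchMap p) ∧
        ∀ πbar : C(LensSpace p q, SphereTwo),
          (πbar.comp (skeletonIncl p q hp)).Homotopic (pinchMap p) →
          ∀ α, eP (r (htpyPullback (BU n) πbar α)) = (eS α : ZMod p) := by
  -- The degree along `pinchMap 0` takes values in `ZMod 0`, which is `ℤ` by definition.
  obtain ⟨gS, eS, hS, heS⟩ := exists_bundleGroup (pinchMap 0)
    (fun _ => classDegree_sphere_injective) hn (classDegree_sphere_surjective hn)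
  obtain ⟨gP, eP, hP, heP⟩ := exists_bundleGroup (ContinuousMap.id (MooreSpace p))
    (fun _ => classDegree_moore_injective) hn (classDegree_moore_surjective hn)
  obtain ⟨gL, eL, hL, heL⟩ := exists_bundleGroup (skeletonIncl p q hp)
    (fun _ => classDegree_lens_injective hp hq) hn (classDegree_lens_surjective hp hq hn)
  have hpinch : ∀ α, eP (htpyPullback (BU n) (pinchMap p) α) = Int.cast (eS α) := by
    intro α
    rw [heP, heS]
    obtain ⟨f, rfl⟩ := htpyClass_surjective α
    exact mooreDegree_pinchMap f p
  have hr : ∀ α, (eL.trans eP.symm) α = htpyPullback (BU n) (skeletonIncl p q hp) α := by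
    intro α
    rw [AddEquiv.trans_apply, AddEquiv.symm_apply_eq, heL, heP]
    obtain ⟨f, rfl⟩ := htpyClass_surjective α
    rfl
  refine ⟨gS, gP, gL, hS, hP, hL, eS, eP, eL.trans eP.symm, hpinch, hr,
    exists_pinch_extension hp hq, fun πbar hπ α => ?_⟩
  -- Restricted to the skeleton, `πbar` is homotopic to the pinch map, so (d) reduces to (b).
  refine (congrArg eP (hr _)).trans (Eq.trans ?_ (hpinch α))
  obtain ⟨f, rfl⟩ := htpyClass_surjective α
  exact congrArg eP (htpyClass_eq_iff.2 (Homotopic.comp (Homotopic.refl f) hπ))
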